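/- **Setting.** Let $\Lambda$ be a finite lattice, i.e. a finite connected graph with its path distance, of dimension $D$ with volume constant $V$: every ball $\{y:\mathrm{dist}(x,y)\le n\}$, $n\ge 1$, has at most $V n^D$ sites. Write $B_n(j)=\{k:\mathrm{dist}(k,j)<n\}$. Each site carries a finite-dimensional Hilbert space (spins), or a finite-dimensional $\mathbb Z_2$-graded one (fermions; observables are then parity-even); $\mathcal A_X$ is the algebra of observables supported on $X\subseteq\Lambda$, and $\|\cdot\|$ is the operator norm. Let $f:[0,\infty)\to(0,\infty)$ be non-increasing with $f(r)=O(r^{-\infty})$ and $f(0)=1$; put $f(x)=f(0)$ for $x<0$. Let $H(t)=\sum_j H_j(t)$ be $f$-local with interactions bounded by $C$: each $H_j(t)$ is Hermitian, continuous in $t$, $\|H_j(t)\|\le C$, and for every integer $n\ge 1$ there is an operator in $\mathcal A_{B_n(j)}$ within $\|H_j(t)\|f(n)$ of $H_j(t)$. Fix any choice of such approximants $H_{j,n}(t)\in\mathcal A_{B_n(j)}$, Hermitian and continuous in $t$, put $H_{j,0}=0$, $H_j^{(n)}=H_{j,n}-H_{j,n-1}$, and for a region $R$ let $H_R=\sum_j\sum_{n\ge1,\,B_n(j)\subseteq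 R}H_j^{(n)}$. For a time-dependent Hamiltonian $K$, $U_t^K$ is the solution of $i\partial_tU_t=K(t)U_t$, $U_0=1$. Let $\Lambda=A\sqcup B\sqcup C$ with $A,C\neq\varnothing$ and $B$ shielding $A$ from $C$ (every path from $A$ to $C$ meets $B$). Put $w=w(B)=\mathrm{dist}(A,C)$, $A_+=\{j\in B:\mathrm{dist}(j,A)<w/3\}$, $C_+=\{j\in B:\mathrm{dist}(j,C)<w/3\}$ and $$\tilde U_t^H=U_t^{H_B}\,\bigl(U_t^{H_{A_+}+H_{C_+}}\bigr)^\dagger\,U_t^{H_{C\cup C_+}+H_{A_+\cup A}} .$$ **Theorem.** (1) Let $c>0$, $0<\alpha<1$, $\nu>1$, and $h(r)=c\,f(\tfrac{r-1}{2})^\alpha/\max(r,1)^\nu$. Then for every $t\in\mathbb R$ $$\|U_t^H-\tilde U_t^H\|\le 2|B||t|\,f^\delta(w/3)+2|B|^2|t|\,F_t(w/6),$$ where $n,m,d$ run over integers, $$f^\delta(r)=\sum_{n>r/2}n^DV\,2C f(n-1),\qquad f^\partial(r)=\sum_{n>r}V(n/2)^D\,2C f(n/2-1),$$ $$C_\partial=\sum_{n\ge1}V(n/2)^D\,2C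 f(n/2-1),\qquad \tilde C=2C\sum_{n\ge1}f(n-1),$$ $$F_t(r)=|t|\sum_{d\ge\lfloor r\rfloor}V\max(d,1)^D\Bigl[2C_\partial\tilde f_t(d/2)+2\tilde Cf^\partial(d/2)+6\tilde f_t(d/2)f^\partial(d/2)\Bigr]+2|t|C_\partial f^\delta(r),$$ $$\tilde f_t(r)=2C\sup_j\sum_{k:\,\mathrm{dist}(j,k)\ge r}\Bigl(\sum_{1\le m\le \mathrm{dist}(j,k)/2}\frac{f(m-1)}{C_h}\bigl(e^{2M_fC_h|t|}-1\bigr)\sum_{x\in B_m(j)}h(\mathrm{dist}(x,k))+\sum_{m>\mathrm{dist}(j,k)/2}f(m-1)\Bigr),$$ $$M_f=\sup_{x,y}\frac{2C}{h(\mathrm{dist}(x,y))}\sum_j\sum_{n:\,x,y\in B_n(j)}f(n-1),\qquad C_h=\sup_{x,y}\sum_z\frac{h(\mathrm{dist}(x,z))h(\mathrm{dist}(z,y))}{h(\mathrm{dist}(x,y))}.$$ (2) $f^\delta$ and $F_t$ decay superpolynomially, independently of the system: $f^\delta$ (which depends only on $D,V,C,f$) is bounded by a function of order $O(r^{-\infty})$;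 and for all $c,\alpha,\nu,t$ and every constant $K$ there is a function $g(r)=O(r^{-\infty})$, depending only on $D,V,C,f,c,\alpha,\nu,t,K$, with $F_t\le g$ for all lattices as above for which $h$ is reproducing with constant $C_h\le K$. (3) For every such $f$ (whether or not a reproducing $h$ of the above form exists) and every $t$ there is a function $g(r)=O(r^{-\infty})$, depending only on $D,V,C,f,t$, such that $\|U_t^H-\tilde U_t^H\|\le |B|^2\,g(w(B))$ for all lattices, Hamiltonians, approximants and partitions as above; that is, the error is $O(\mathrm{poly}(|B|)\,w(B)^{-\infty})$ uniformly in the system. -/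

import Mathlib

open scoped NNReal ENNReal Matrix.Norms.L2Operator
open Filter

noncomputable section

namespace LGA

/-! ### Time evolution -/

section Evolution

variable {𝔸 : Type*} [NormedRing 𝔸] [NormedAlgebra ℂ 𝔸]

/-- The terms of the Dyson series of a time-dependent generator `H`. -/
def dysonTerm (H : ℝ → 𝔸) : ℕ → ℝ → 𝔸
  | 0, _ => 1
  | n + 1, t => (-Complex.I) • ∫ s in (0 : ℝ)..t, H s * dysonTerm H n s

/-- The time evolution `U_t^H` from time `0` to time `t` generated by `H` (time-ordered
exponential): the solution of `i ∂ₜ U = H(t) U`, `U 0 = 1`, see `evolution_zero` and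
`hasDerivAt_evolution`. -/
def evolution (H : ℝ → 𝔸) (t : ℝ) : 𝔸 := ∑' n, dysonTerm H n t

theorem continuous_dysonTerm {H : ℝ → 𝔸} (hH : Continuous H) (n : ℕ) :
    Continuous (dysonTerm H n) := by
  induction n with
  | zero => exact continuous_const
  | succ n ih =>
    refine Continuous.const_smul ?_ (-Complex.I)
    exact intervalIntegral.continuous_primitive
      (fun a b => (hH.mul ih).intervalIntegrable a b) 0

theorem hasDerivAt_dysonTerm [CompleteSpace 𝔸] {H : ℝ → 𝔸} (hH : Continuous H) (n : ℕ) (t : ℝ) :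
    HasDerivAt (dysonTerm H (n + 1)) ((-Complex.I) • (H t * dysonTerm H n t)) t := by
  have hc : Continuous fun s => H s * dysonTerm H n s := hH.mul (continuous_dysonTerm hH n)
  exact (intervalIntegral.integral_hasDerivAt_right (hc.intervalIntegrable 0 t)
    hc.stronglyMeasurable.stronglyMeasurableAtFilter hc.continuousAt).const_smul (-Complex.I)

theorem norm_dysonTerm_le {H : ℝ → 𝔸} {T K : ℝ} (hK : 0 ≤ K)
    (hb : ∀ s, |s| ≤ T → ‖H s‖ ≤ K) (n : ℕ) :
    ∀ t, |t| ≤ T → ‖dysonTerm H n t‖ ≤ ‖(1 : 𝔸)‖ * ((K * |t|) ^ n / n.factorial) := by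
  induction n with
  | zero => intro t _; simp [dysonTerm]
  | succ n ih =>
    intro t ht
    have key : ‖∫ s in (0 : ℝ)..t, H s * dysonTerm H n s‖ ≤
        |∫ s in (0 : ℝ)..t, K * (‖(1 : 𝔸)‖ * ((K * |s|) ^ n / n.factorial))| := by
      refine intervalIntegral.norm_integral_le_abs_of_norm_le ?_ ?_
      · refine (MeasureTheory.ae_restrict_iff' measurableSet_uIoc).2 (Eventually.of_forall ?_)
        intro s hs
        have hs' : |s| ≤ T := by
          refine le_trans ?_ ht
          rcases Set.mem_uIoc.1 hs with h | h
          · rw [abs_of_pos h.1, abs_of_pos (h.1.trans_le h.2)]; exact h.2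
          · rw [abs_of_nonpos h.2, abs_of_neg (h.1.trans_le h.2)]; linarith [h.1]
        exact (norm_mul_le _ _).trans
          (mul_le_mul (hb s hs') (ih s hs') (norm_nonneg _) hK)
      · exact Continuous.intervalIntegrable (by fun_prop) _ _
    have comp : |∫ s in (0 : ℝ)..t, K * (‖(1 : 𝔸)‖ * ((K * |s|) ^ n / n.factorial))| =
        ‖(1 : 𝔸)‖ * ((K * |t|) ^ (n + 1) / (n + 1).factorial) := by
      have e : ∀ s : ℝ, K * (‖(1 : 𝔸)‖ * ((K * |s|) ^ n / n.factorial)) =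
          (‖(1 : 𝔸)‖ * K ^ (n + 1) / n.factorial) * |s| ^ n := by
        intro s; ring
      simp_rw [e]
      rw [intervalIntegral.integral_const_mul, abs_mul]
      have hn : (0 : ℝ) < n.factorial := by exact_mod_cast n.factorial_pos
      have habs : |∫ s in (0 : ℝ)..t, |s| ^ n| = |t| ^ (n + 1) / (n + 1) := by
        rcases le_total 0 t with h | h
        · have : ∫ s in (0 : ℝ)..t, |s| ^ n = ∫ s in (0 : ℝ)..t, s ^ n := by
            refine intervalIntegral.integral_congr ?_
            intro s hs
            rw [Set.uIcc_of_le h] at hs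
            simp only [abs_of_nonneg hs.1]
          rw [this, integral_pow, abs_of_nonneg h]
          simp only [ne_eq, Nat.add_eq_zero_iff, one_ne_zero, and_false, not_false_eq_true,
            zero_pow, sub_zero]
          exact abs_of_nonneg (by positivity)
        · have : ∫ s in (0 : ℝ)..t, |s| ^ n = ∫ s in (0 : ℝ)..t, (-1) ^ n * s ^ n := by
            refine intervalIntegral.integral_congr ?_
            intro s hs
            rw [Set.uIcc_of_ge h] at hs
            simp only [abs_of_nonpos hs.2]
            rw [← mul_pow]; ring
          rw [this, intervalIntegral.integral_const_mul, integral_pow, abs_mul, abs_div]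
          simp only [ne_eq, Nat.add_eq_zero_iff, one_ne_zero, and_false, not_false_eq_true,
            zero_pow, sub_zero, abs_pow, abs_neg, abs_one, one_pow, one_mul]
          rw [abs_of_nonneg (by positivity : (0 : ℝ) ≤ (n : ℝ) + 1)]
      rw [habs, abs_of_nonneg (by positivity), Nat.factorial_succ]
      push_cast
      field_simp
      rw [mul_pow]; ring
    calc ‖dysonTerm H (n + 1) t‖ ≤ ‖∫ s in (0 : ℝ)..t, H s * dysonTerm H n s‖ := by
          simp [dysonTerm, norm_smul]
      _ ≤ _ := key.trans comp.le

theorem evolution_zero (H : ℝ → 𝔸) : evolution H 0 = 1 := by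
  rw [evolution, tsum_eq_single 0]
  · simp only [dysonTerm]
  · intro n hn
    obtain ⟨m, rfl⟩ := Nat.exists_eq_succ_of_ne_zero hn
    simp [dysonTerm]

set_option maxHeartbeats 1000000 in
theorem hasDerivAt_evolution [CompleteSpace 𝔸] {H : ℝ → 𝔸} (hH : Continuous H) (t : ℝ) :
    HasDerivAt (evolution H) ((-Complex.I) • (H t * evolution H t)) t := by
  set T : ℝ := |t| + 1 with hT
  obtain ⟨K, hKb⟩ : ∃ K, ∀ s, |s| ≤ T → ‖H s‖ ≤ K := by
    obtain ⟨K, hK⟩ := (isCompact_Icc (a := -T) (b := T)).exists_bound_of_continuousOn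
      hH.continuousOn
    exact ⟨K, fun s hs => hK s (abs_le.1 hs)⟩
  have hT0 : 0 ≤ T := by positivity
  have hK : 0 ≤ K := (norm_nonneg _).trans (hKb 0 (by simpa using hT0))
  set u : ℕ → ℝ := fun n => ‖(1 : 𝔸)‖ * ((K * T) ^ n / n.factorial) with hu
  have hus : Summable u := (Real.summable_pow_div_factorial (K * T)).mul_left _
  have hbd : ∀ n s, |s| ≤ T → ‖dysonTerm H n s‖ ≤ u n := by
    intro n s hs
    refine (norm_dysonTerm_le hK hKb n s hs).trans ?_
    simp only [hu]
    gcongr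
  have hsum : ∀ s, |s| ≤ T → Summable fun n => dysonTerm H n s := fun s hs =>
    Summable.of_norm_bounded hus fun n => hbd n s hs
  have hmem : t ∈ Metric.ball (0 : ℝ) T := by simp [hT]
  have hball : ∀ s ∈ Metric.ball (0 : ℝ) T, |s| ≤ T := by
    intro s hs
    rw [Metric.mem_ball, dist_zero_right, Real.norm_eq_abs] at hs
    exact hs.le
  have hd := hasDerivAt_tsum_of_isPreconnected (u := fun n => K * u n)
    (g := fun n => dysonTerm H (n + 1))
    (g' := fun n s => (-Complex.I) • (H s * dysonTerm H n s)) (hus.mul_left K)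
    Metric.isOpen_ball (convex_ball (0 : ℝ) T).isPreconnected
    (fun n s _ => hasDerivAt_dysonTerm hH n s)
    (fun n s hs => by
      rw [norm_smul, norm_neg, Complex.norm_I, one_mul]
      exact (norm_mul_le _ _).trans
        (mul_le_mul (hKb s (hball s hs)) (hbd n s (hball s hs)) (norm_nonneg _) hK))
    hmem ((summable_nat_add_iff 1).2 (hsum t (hball t hmem))) hmem
  have hval : (∑' n, (-Complex.I) • (H t * dysonTerm H n t)) =
      (-Complex.I) • (H t * evolution H t) := by
    have hst := hsum t (hball t hmem)
    rw [Summable.tsum_const_smul _ (hst.mul_left _), hst.tsum_mul_left, evolution]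
  rw [hval] at hd
  refine (hd.const_add 1).congr_of_eventuallyEq ?_
  filter_upwards [Metric.isOpen_ball.mem_nhds hmem] with s hs
  rw [evolution, (hsum s (hball s hs)).tsum_eq_zero_add]
  simp only [dysonTerm]

end Evolution

/-! ### Decay functions -/

/-- A monotonically decreasing positive function on `[0,∞)` of order `O(r^{-∞})`, with the
normalisation `f 0 = 1`. -/
structure IsMDP (f : ℝ≥0 → ℝ≥0) : Prop where
  antitone : Antitone f
  pos : ∀ r, 0 < f r
  decay : Asymptotics.SuperpolynomialDecay atTop id f
  zero : f 0 = 1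

/-- `h(r) = c f((r-1)/2)^α / r^ν` for `r ≥ 1`, and `h(r) = h(1)` for `r ≤ 1`
(the subtraction in `ℝ≥0` is truncated). -/
def hFun (f : ℝ≥0 → ℝ≥0) (c : ℝ≥0) (α ν : ℝ) (r : ℝ≥0) : ℝ≥0 :=
  c * f ((r - 1) / 2) ^ α / (max r 1) ^ ν

/-- `f^δ(r) = ∑_{n > r/2} n^D V 2C f(n-1)`. -/
def fDelta (D : ℕ) (V C : ℝ≥0) (f : ℝ≥0 → ℝ≥0) (r : ℝ≥0) : ℝ≥0∞ :=
  ∑' n : ℕ, if r / 2 < n then (((n : ℝ≥0) ^ D * V * 2 * C * f ((n : ℝ≥0) - 1) : ℝ≥0) : ℝ≥0∞)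
    else 0

/-- `f^∂(r) = ∑_{n > r} V (n/2)^D 2C f(n/2 - 1)` (truncated subtraction). -/
def fBdry (D : ℕ) (V C : ℝ≥0) (f : ℝ≥0 → ℝ≥0) (r : ℝ≥0) : ℝ≥0∞ :=
  ∑' n : ℕ, if r < n then
    ((V * ((n : ℝ≥0) / 2) ^ D * 2 * C * f ((n : ℝ≥0) / 2 - 1) : ℝ≥0) : ℝ≥0∞) else 0

/-- `C_∂ = ∑_{n ≥ 1} V (n/2)^D 2C f(n/2 - 1)`. -/
def cBdry (D : ℕ) (V C : ℝ≥0) (f : ℝ≥0 → ℝ≥0) : ℝ≥0∞ :=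
  ∑' n : ℕ, if 1 ≤ n then
    ((V * ((n : ℝ≥0) / 2) ^ D * 2 * C * f ((n : ℝ≥0) / 2 - 1) : ℝ≥0) : ℝ≥0∞) else 0

/-- `C̃ = 2C ∑_{n ≥ 1} f(n-1)`. -/
def cTilde (C : ℝ≥0) (f : ℝ≥0 → ℝ≥0) : ℝ≥0∞ :=
  2 * C * ∑' n : ℕ, if 1 ≤ n then (f ((n : ℝ≥0) - 1) : ℝ≥0∞) else 0

/-! ### Lattices -/

section Lattice

variable {Λ : Type*} [Fintype Λ] [LinearOrder Λ] (G : SimpleGraph Λ)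

/-- The lattice, as a finite connected graph with its path distance, is `D`-dimensional with
volume constant `V`: a ball of radius `n ≥ 1` has at most `V n^D` sites. -/
structure IsLattice (D : ℕ) (V : ℝ≥0) : Prop where
  connected : G.Connected
  card_le : ∀ (x : Λ) (n : ℕ), 1 ≤ n →
    ((Finset.univ.filter fun y => G.dist x y ≤ n).card : ℝ≥0) ≤ V * (n : ℝ≥0) ^ D

/-- The ball `B_n(j) = {k | dist(k,j) < n}`. -/
def latBall (n : ℕ) (j : Λ) : Finset Λ := Finset.univ.filter fun k => G.dist k j < n

/-- `dist(A,C) = min_{a ∈ A, c ∈ C} dist(a,c)`, for nonempty `A`, `C`. -/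
def setDist (A C : Finset Λ) : ℕ := sInf {n | ∃ a ∈ A, ∃ c ∈ C, G.dist a c = n}

/-- `A, B, C` is a partition of the lattice with `B` shielding `A` from `C`: every path from `A`
to `C` passes through `B`. -/
structure IsShieldedPartition (A B C : Finset Λ) : Prop where
  disjoint_AB : Disjoint A B
  disjoint_BC : Disjoint B C
  disjoint_AC : Disjoint A C
  union_eq : A ∪ B ∪ C = Finset.univ
  nonempty_A : A.Nonempty
  nonempty_C : C.Nonempty
  shields : ∀ a ∈ A, ∀ c ∈ C, ∀ p : G.Walk a c, ∃ v ∈ p.support, v ∈ B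

/-- `{j ∈ B | dist(j,A) < w/3}`. With `w = dist(A,C)` this is the collar `A₊`; with `C` in place
of `A` it is `C₊`. -/
def collar (A B : Finset Λ) (w : ℕ) : Finset Λ :=
  B.filter fun j => (setDist G {j} A : ℝ≥0) < (w : ℝ≥0) / 3

/-- The reproducing constant
`C_h = sup_{x,y} ∑_z h(dist(x,z)) h(dist(z,y)) / h(dist(x,y))`. -/
def cRep (h : ℝ≥0 → ℝ≥0) : ℝ≥0∞ :=
  ⨆ (x : Λ) (y : Λ), ∑ z : Λ, (h (G.dist x z) : ℝ≥0∞) * h (G.dist z y) / h (G.dist x y)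

/-- `M_f = sup_{x,y} 2C / h(dist(x,y)) ∑_j ∑_{n : x,y ∈ B_n(j)} f(n-1)`. -/
def mConst (C : ℝ≥0) (f h : ℝ≥0 → ℝ≥0) : ℝ≥0∞ :=
  ⨆ (x : Λ) (y : Λ), 2 * (C : ℝ≥0∞) / h (G.dist x y) *
    ∑ j : Λ, ∑' n : ℕ, if x ∈ latBall G n j ∧ y ∈ latBall G n j then
      (f ((n : ℝ≥0) - 1) : ℝ≥0∞) else 0

/-- The Lieb–Robinson factor `(e^{2 M_f C_h |t|} - 1) / C_h`. -/
def lrFactor (C : ℝ≥0) (f h : ℝ≥0 → ℝ≥0) (t : ℝ) : ℝ≥0∞ :=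
  (EReal.exp ((2 * mConst G C f h * cRep G h * (‖t‖₊ : ℝ≥0∞) : ℝ≥0∞) : EReal) - 1) / cRep G h

/-- `f̃_t(r) = 2C sup_j ∑_{k : dist(j,k) ≥ r} ( ∑_{1 ≤ m ≤ dist(j,k)/2} f(m-1)
(e^{2 M_f C_h |t|} - 1) / C_h ∑_{x ∈ B_m(j)} h(dist(x,k)) + ∑_{m > dist(j,k)/2} f(m-1) )`. -/
def fTilde (C : ℝ≥0) (f h : ℝ≥0 → ℝ≥0) (t : ℝ) (r : ℝ≥0) : ℝ≥0∞ :=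
  2 * C * ⨆ j : Λ, ∑ k ∈ Finset.univ.filter (fun k => r ≤ (G.dist j k : ℝ≥0)),
    ((∑' m : ℕ, if 1 ≤ m ∧ (m : ℝ≥0) ≤ (G.dist j k : ℝ≥0) / 2 then
        (f ((m : ℝ≥0) - 1) : ℝ≥0∞) * lrFactor G C f h t *
          ∑ x ∈ latBall G m j, (h (G.dist x k) : ℝ≥0∞)
      else 0) +
     ∑' m : ℕ, if (G.dist j k : ℝ≥0) / 2 < m then (f ((m : ℝ≥0) - 1) : ℝ≥0∞) else 0)

/-- `F_t(r) = |t| ∑_{d ≥ ⌊r⌋} V max(d,1)^D [2 C_∂ f̃_t(d/2) + 2 C̃ f^∂(d/2) + 6 f̃_t(d/2) f^∂(d/2)]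
+ 2 |t| C_∂ f^δ(r)`. -/
def bigF (D : ℕ) (V C : ℝ≥0) (f h : ℝ≥0 → ℝ≥0) (t : ℝ) (r : ℝ≥0) : ℝ≥0∞ :=
  ‖t‖₊ * (∑' d : ℕ, if ⌊r⌋₊ ≤ d then
      ((V * (max (d : ℝ≥0) 1) ^ D : ℝ≥0) : ℝ≥0∞) *
        (2 * cBdry D V C f * fTilde G C f h t ((d : ℝ≥0) / 2)
          + 2 * cTilde C f * fBdry D V C f ((d : ℝ≥0) / 2)
          + 6 * fTilde G C f h t ((d : ℝ≥0) / 2) * fBdry D V C f ((d : ℝ≥0) / 2))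
    else 0)
  + 2 * ‖t‖₊ * cBdry D V C f * fDelta D V C f r

/-! ### Local operators

Site `j` has a finite-dimensional Hilbert space with basis `κ j`, graded by a sign
`p j : κ j → ℤˣ` (fermion parity). The grading `p = 1` gives spin systems; `κ j = Bool` with `p`
the parity of the occupation number gives spinless fermions. -/

variable {κ : Λ → Type*} [∀ j, Fintype (κ j)] [∀ j, DecidableEq (κ j)]

/-- Operators on the total Hilbert space, with the operator norm. -/
abbrev Op (κ : Λ → Type*) [∀ j, Fintype (κ j)] : Type _ := Matrix (∀ j, κ j) (∀ j, κ j) ℂ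

/-- `1 ⊗ ⋯ ⊗ E ⊗ ⋯ ⊗ 1` with `E` at site `j`. -/
def siteOp (j : Λ) (E : Matrix (κ j) (κ j) ℂ) : Op κ :=
  Matrix.of fun σ τ => if ∀ i, i ≠ j → σ i = τ i then E (σ j) (τ j) else 0

/-- The diagonal operator of the fermion parity of the region `X`. -/
def parityOp (p : ∀ j, κ j → ℤˣ) (X : Finset Λ) : Op κ :=
  Matrix.diagonal fun σ => ∏ i ∈ X, (((p i (σ i) : ℤˣ) : ℤ) : ℂ)

/-- Operators at site `j`: parity-even matrices act at `j` alone, parity-odd ones carry a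
Jordan–Wigner string. -/
def siteGenerators (p : ∀ j, κ j → ℤˣ) (j : Λ) : Set (Op κ) :=
  {O | ∃ E : Matrix (κ j) (κ j) ℂ, (∀ s s', E s s' ≠ 0 → p j s = p j s') ∧ O = siteOp j E} ∪
  {O | ∃ E : Matrix (κ j) (κ j) ℂ, (∀ s s', E s s' ≠ 0 → p j s = - p j s') ∧
    O = parityOp p (Finset.univ.filter fun i => i < j) * siteOp j E}

/-- The algebra of (parity-even) observables supported on `X`. -/
def localAlgebra (p : ∀ j, κ j → ℤˣ) (X : Finset Λ) : Subalgebra ℂ (Op κ) :=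
  Algebra.adjoin ℂ (⋃ j ∈ X, siteGenerators p j) ⊓
    Subalgebra.centralizer ℂ {parityOp p Finset.univ}

/-! ### Almost-local Hamiltonians -/

/-- `O` is `f`-localized on the site `j`. -/
def IsLocalizedOn (p : ∀ j, κ j → ℤˣ) (f : ℝ≥0 → ℝ≥0) (j : Λ) (O : Op κ) : Prop :=
  ∀ n : ℕ, 0 < n → ∃ O' ∈ localAlgebra p (latBall G n j), ‖O - O'‖ ≤ ‖O‖ * f n

/-- The time-dependent Hamiltonian `∑_j H_j(t)` is `f`-local with interactions bounded by `C`. -/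
structure IsLocalHamiltonian (p : ∀ j, κ j → ℤˣ) (f : ℝ≥0 → ℝ≥0) (C : ℝ≥0)
    (H : Λ → ℝ → Op κ) : Prop where
  continuous : ∀ j, Continuous (H j)
  isHermitian : ∀ j t, (H j t).IsHermitian
  localized : ∀ j t, IsLocalizedOn G p f j (H j t)
  norm_le : ∀ j t, ‖H j t‖ ≤ C

/-- `a n j t` is a choice of Hermitian local approximants of `H_j(t)` on the balls `B_n(j)`, with
`a 0 = 0`. -/
structure IsLocalApproximation (p : ∀ j, κ j → ℤˣ) (f : ℝ≥0 → ℝ≥0)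
    (H : Λ → ℝ → Op κ) (a : ℕ → Λ → ℝ → Op κ) : Prop where
  zero : ∀ j t, a 0 j t = 0
  continuous : ∀ n j, Continuous (a n j)
  isHermitian : ∀ n j t, (a n j t).IsHermitian
  mem : ∀ n j t, 0 < n → a n j t ∈ localAlgebra p (latBall G n j)
  norm_sub_le : ∀ n j t, 0 < n → ‖H j t - a n j t‖ ≤ ‖H j t‖ * f n

/-- The restriction `H_R = ∑_j ∑_{n ≥ 1, B_n(j) ⊆ R} H_j^{(n)}`, with
`H_j^{(n)} = a n j - a (n-1) j`. -/
def restrictH (a : ℕ → Λ → ℝ → Op κ) (R : Finset Λ) (t : ℝ) : Op κ :=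
  ∑ j : Λ, ∑' n : ℕ, if 1 ≤ n ∧ latBall G n j ⊆ R then a n j t - a (n - 1) j t else 0

/-- `Ũ_t^H = U_t^{H_B} (U_t^{H_{A₊} + H_{C₊}})† U_t^{H_{C C₊} + H_{A₊ A}}`. -/
def approxEvolution (a : ℕ → Λ → ℝ → Op κ) (A B C : Finset Λ) (t : ℝ) : Op κ :=
  let Ap := collar G A B (setDist G A C)
  let Cp := collar G C B (setDist G A C)
  evolution (restrictH G a B) t *
    star (evolution (fun s => restrictH G a Ap s + restrictH G a Cp s) t) *
    evolution (fun s => restrictH G a (C ∪ Cp) s + restrictH G a (Ap ∪ A) s) t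

end Lattice

end LGA

end

universe u v

/-! # Gluing of almost-local dynamics

With `W = U^{H_B} (U^{H_{A₊} + H_{C₊}})⋆`, the product `Ũ = W U^{H_{C ∪ C₊} + H_{A₊ ∪ A}}` is the
propagator of `H_B + W X W⋆`, where `X` is the difference of the generators of its last and middle
factors. By Duhamel (`norm_evolution_sub_mul_star_mul_le`) the error is at most `|t|` times the
supremum over times of `‖H - H_B - X‖ + ‖[W, X]‖`.

* `H - H_B - X` is the sum of the terms of `H` whose ball fits into none of the three regions. Such
  a ball has radius larger than `w/6` and meets `B`, which gives `f^δ(w/3)`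
  (`IsShieldedPartition.sum_bad_le`).
* Of the terms of `X`, those inside `A` or `C` commute with `W`; the others contain a site of `B`
  adjacent to `A` or `C` (`exists_boundary_site`). The commutator of such a term with `W` is
  controlled by its commutators with the terms of `H_B - H_{A₊} - H_{C₊}`, transported by the
  dynamics of `H_B` (`norm_commutator_evolution_mul_star_le`). Terms centred close to the boundary
  site have large balls; all others are estimated by the Lieb–Robinson bound (`lieb_robinson`) or,
  where this is not available, trivially. Summing over pairs of terms gives `F_t(w/6)`
  (`sum_commutators_le`).

Fermions enter only through the fact that even observables on disjoint regions commute
(`commute_of_disjoint`). On a finite lattice all balls of large radius agree, so the Hamiltonian is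
a finite sum of local terms.

The resulting bound `enorm_evolution_sub_approxEvolution_le` holds for every positive function `h`.
The decay statements follow from majorants `bigFMajorant` of `F_t` that do not see the lattice. For
the last part, the functions `h = (1 + r)^{-k}` are reproducing with constants depending only on `k`
and the dimension data (`exists_cRep_polyDecay_le`); they give the error bound to each polynomial
order separately, and the infimum of these bounds over `k` decays superpolynomially. -/

noncomputable section

namespace LGA

/-! ### Unitary dynamics in a C⋆-algebra -/

section Dynamics

variable {𝔸 : Type*} [CStarAlgebra 𝔸]

theorem norm_unitary_mul {u : 𝔸} (hu : u ∈ unitary 𝔸) (x : 𝔸) : ‖u * x‖ = ‖x‖ :=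
  CStarRing.norm_coe_unitary_mul ⟨u, hu⟩ x

theorem norm_mul_unitary {u : 𝔸} (hu : u ∈ unitary 𝔸) (x : 𝔸) : ‖x * u‖ = ‖x‖ :=
  CStarRing.norm_mul_coe_unitary x ⟨u, hu⟩

theorem norm_conj_unitary {u : 𝔸} (hu : u ∈ unitary 𝔸) (x : 𝔸) : ‖u * x * star u‖ = ‖x‖ := by
  rw [norm_mul_unitary (Unitary.star_mem hu), norm_unitary_mul hu]

theorem norm_commutator_le (a b : 𝔸) : ‖a * b - b * a‖ ≤ 2 * ‖a‖ * ‖b‖ := by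
  have h1 := norm_mul_le a b
  have h2 := norm_mul_le b a
  have h3 := norm_sub_le (a * b) (b * a)
  nlinarith

/-- The commutator of a conjugated operator is unitarily equivalent to the commutator with the
inversely conjugated one. -/
theorem norm_commutator_conj {u : 𝔸} (hu : u ∈ unitary 𝔸) (a b : 𝔸) :
    ‖(u * a * star u) * b - b * (u * a * star u)‖ =
      ‖a * (star u * b * u) - (star u * b * u) * a‖ := by
  have h1 : star u * u = 1 := Unitary.star_mul_self_of_mem hu
  have h2 : u * star u = 1 := Unitary.mul_star_self_of_mem hu
  rw [← norm_conj_unitary hu (a * (star u * b * u) - (star u * b * u) * a)]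
  congr 1
  calc (u * a * star u) * b - b * (u * a * star u)
      = (u * a * star u) * b * (u * star u) - (u * star u) * b * (u * a * star u) := by
        rw [h2]; noncomm_ring
    _ = _ := by noncomm_ring

theorem norm_conj_sub_self {u : 𝔸} (hu : u ∈ unitary 𝔸) (m : 𝔸) :
    ‖u * m * star u - m‖ = ‖u * m - m * u‖ := by
  rw [← norm_mul_unitary hu (u * m * star u - m), sub_mul, mul_assoc (u * m),
    Unitary.star_mul_self_of_mem hu, mul_one]

theorem evolution_mem_unitary [IsDedekindFiniteMonoid 𝔸] {H : ℝ → 𝔸} (hH : Continuous H)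
    (hsa : ∀ t, IsSelfAdjoint (H t)) (t : ℝ) : evolution H t ∈ unitary 𝔸 := by
  have key : star (evolution H t) * evolution H t = 1 := by
    have hd : ∀ s, HasDerivAt (fun s => star (evolution H s) * evolution H s) 0 s := by
      intro s
      have h1 := hasDerivAt_evolution hH s
      refine (h1.star.mul h1).congr_deriv ?_
      simp only [star_smul, star_mul, (hsa s).star_eq, star_neg, Complex.star_def, Complex.conj_I,
        neg_neg, smul_mul_assoc, mul_assoc, neg_smul]
      simp
    have := is_const_of_deriv_eq_zero (fun s => (hd s).differentiableAt) (fun s => (hd s).deriv) t 0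
    simpa [evolution_zero] using this
  exact Unitary.mem_iff.2 ⟨key, mul_eq_one_comm.1 key⟩

theorem hasDerivAt_star_evolution {H : ℝ → 𝔸} (hH : Continuous H)
    (hsa : ∀ t, IsSelfAdjoint (H t)) (t : ℝ) :
    HasDerivAt (fun s => star (evolution H s)) (Complex.I • (star (evolution H t) * H t)) t := by
  refine (hasDerivAt_evolution hH t).star.congr_deriv ?_
  simp [(hsa t).star_eq]

theorem commute_evolution [IsDedekindFiniteMonoid 𝔸] {H : ℝ → 𝔸} (hH : Continuous H)
    (hsa : ∀ t, IsSelfAdjoint (H t)) {m : 𝔸} (hm : ∀ t, Commute (H t) m) (t : ℝ) :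
    Commute (evolution H t) m := by
  have key : star (evolution H t) * m * evolution H t = m := by
    have hd : ∀ s, HasDerivAt (fun s => star (evolution H s) * m * evolution H s) 0 s := by
      intro s
      refine (((hasDerivAt_star_evolution hH hsa s).mul_const m).mul
        (hasDerivAt_evolution hH s)).congr_deriv ?_
      simp only [smul_mul_assoc, mul_assoc, neg_smul]
      rw [← mul_assoc (H s) m, (hm s).eq]
      simp [mul_assoc]
    have := is_const_of_deriv_eq_zero (fun s => (hd s).differentiableAt) (fun s => (hd s).deriv) t 0
    simpa [evolution_zero] using this
  have h2 := Unitary.mul_star_self_of_mem (evolution_mem_unitary hH hsa t)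
  calc evolution H t * m = evolution H t * (star (evolution H t) * m * evolution H t) := by rw [key]
    _ = (evolution H t * star (evolution H t)) * m * evolution H t := by noncomm_ring
    _ = m * evolution H t := by rw [h2, one_mul]

/-- **Removing the commuting part of a generator.** If the part `G - G'` of the generator of `V`
commutes with `a` at all times, then the Heisenberg evolution of `a` by `V` is also its evolution
by the unitaries generated by the rotated generator `V G' V⋆`. -/
theorem conj_eq_conj_evolution [IsDedekindFiniteMonoid 𝔸] {V G G' : ℝ → 𝔸}
    (hV : ∀ t, V t ∈ unitary 𝔸) (hV0 : V 0 = 1)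
    (hVd : ∀ t, HasDerivAt V (V t * (Complex.I • G t)) t)
    (hG : ∀ t, IsSelfAdjoint (G t)) (hG' : ∀ t, IsSelfAdjoint (G' t)) (hGc' : Continuous G') {a : 𝔸}
    (ha : ∀ t, Commute (G t - G' t) a) (t : ℝ) :
    V t * a * star (V t) = evolution (fun s => -(V s * G' s * star (V s))) t * a *
      star (evolution (fun s => -(V s * G' s * star (V s))) t) := by
  have hVc : Continuous V := continuous_iff_continuousAt.2 fun t => (hVd t).continuousAt
  set K : ℝ → 𝔸 := fun s => -(V s * G' s * star (V s)) with hK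
  have hKc : Continuous K := ((hVc.mul hGc').mul hVc.star).neg
  have hKsa : ∀ s, IsSelfAdjoint (K s) := fun s => ((hG' s).conjugate _).neg
  set Q := evolution K with hQ
  have hQu := fun s => evolution_mem_unitary hKc hKsa s
  have hRd : ∀ s, HasDerivAt (fun s => star (Q s) * V s)
      (Complex.I • (star (Q s) * V s * (G s - G' s))) s := by
    intro s
    refine ((hasDerivAt_star_evolution hKc hKsa s).mul (hVd s)).congr_deriv ?_
    have h1 : K s * V s = - (V s * G' s) := by
      simp only [hK, neg_mul, mul_assoc, Unitary.star_mul_self_of_mem (hV s), mul_one]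
    rw [smul_mul_assoc, mul_assoc (star (evolution K s)), h1, mul_smul_comm, mul_smul_comm,
      ← smul_add]
    congr 1
    simp only [hQ]
    noncomm_ring
  have key : (star (Q t) * V t) * a * star (star (Q t) * V t) = a := by
    have hd : ∀ s, HasDerivAt
        (fun s => (star (Q s) * V s) * a * star (star (Q s) * V s)) 0 s := by
      intro s
      refine (((hRd s).mul_const a).mul (hRd s).star).congr_deriv ?_
      have hsa : star (G s - G' s) = G s - G' s := ((hG s).sub (hG' s)).star_eq
      set R := star (Q s) * V s
      change Complex.I • (R * (G s - G' s)) * a * star R +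
        R * a * star (Complex.I • (R * (G s - G' s))) = 0
      rw [star_smul, star_mul R, hsa]
      simp only [Complex.star_def, Complex.conj_I, neg_smul, smul_mul_assoc, mul_smul_comm, mul_neg]
      rw [mul_assoc R, (ha s).eq]
      simp [mul_assoc]
    have := is_const_of_deriv_eq_zero (fun s => (hd s).differentiableAt) (fun s => (hd s).deriv) t 0
    simpa [evolution_zero, hV0, hQ] using this
  have h2 := Unitary.mul_star_self_of_mem (hQu t)
  conv_rhs => rw [← key]
  rw [star_mul, star_star]
  calc V t * a * star (V t) = (Q t * star (Q t)) * V t * a * star (V t) * (Q t * star (Q t)) := by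
        rw [h2]; noncomm_ring
    _ = _ := by noncomm_ring

theorem hasDerivAt_conj_evolution {K : ℝ → 𝔸} (hK : Continuous K)
    (hsa : ∀ t, IsSelfAdjoint (K t)) (b : 𝔸) (t : ℝ) :
    HasDerivAt (fun s => star (evolution K s) * b * evolution K s)
      (Complex.I • (star (evolution K t) * (K t * b - b * K t) * evolution K t)) t := by
  refine (((hasDerivAt_star_evolution hK hsa t).mul_const b).mul
    (hasDerivAt_evolution hK t)).congr_deriv ?_
  simp only [smul_mul_assoc, mul_smul_comm, neg_smul, mul_neg]
  rw [← sub_eq_add_neg, ← smul_sub]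
  congr 1
  noncomm_ring

end Dynamics

/-! ### The Lieb–Robinson bound -/

section LiebRobinson

variable {𝔸 : Type*} [CStarAlgebra 𝔸] {Λ ι : Type*} [DecidableEq Λ]

theorem sum_inter_le {J : Finset ι} {S : ι → Finset Λ} {φ : ι → ℝ} (hφ : ∀ i, 0 ≤ φ i)
    (X : Finset Λ) {q : ι → ℝ} (hq : ∀ i, 0 ≤ q i) :
    ∑ i ∈ J with ¬ Disjoint (S i) X, φ i * q i ≤
      ∑ x ∈ X, ∑ i ∈ J with x ∈ S i, φ i * q i := by
  simp_rw [Finset.sum_filter]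
  rw [Finset.sum_comm]
  refine Finset.sum_le_sum fun i _ => ?_
  have h0 : ∀ x ∈ X, 0 ≤ if x ∈ S i then φ i * q i else 0 := fun x _ => by
    split_ifs
    exacts [mul_nonneg (hφ i) (hq i), le_rfl]
  split_ifs with h
  · exact Finset.sum_nonneg h0
  · obtain ⟨x, hx1, hx2⟩ := Finset.not_disjoint_iff.1 h
    refine le_trans ?_ (Finset.single_le_sum h0 hx2)
    simp [hx1]

theorem sum_inter_inter_le {J : Finset ι} {S : ι → Finset Λ} {φ : ι → ℝ} (hφ : ∀ i, 0 ≤ φ i)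
    {h : Λ → Λ → ℝ} {M : ℝ}
    (hM : ∀ x y, ∑ i ∈ J with x ∈ S i ∧ y ∈ S i, φ i ≤ M * h x y) (X Y : Finset Λ) :
    ∑ i ∈ J with ¬ Disjoint (S i) X, φ i * (if Disjoint (S i) Y then 0 else 1) ≤
      M * ∑ x ∈ X, ∑ y ∈ Y, h x y := by
  refine (sum_inter_le hφ X fun i => by split_ifs <;> simp).trans ?_
  rw [Finset.mul_sum]
  refine Finset.sum_le_sum fun x _ => ?_
  have e : ∑ i ∈ J with x ∈ S i, φ i * (if Disjoint (S i) Y then 0 else 1) =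
      ∑ i ∈ J.filter (fun i => x ∈ S i) with ¬ Disjoint (S i) Y, φ i * 1 := by
    rw [Finset.sum_filter (p := fun i => ¬ Disjoint (S i) Y)]
    refine Finset.sum_congr rfl fun i _ => ?_
    split_ifs <;> simp_all
  rw [e]
  refine (sum_inter_le hφ Y fun i => zero_le_one).trans ?_
  rw [Finset.mul_sum]
  refine Finset.sum_le_sum fun y _ => ?_
  simpa [Finset.filter_filter] using hM x y

theorem sum_inter_tail_le [Fintype Λ] {J : Finset ι} {S : ι → Finset Λ} {φ : ι → ℝ}
    (hφ : ∀ i, 0 ≤ φ i) {h : Λ → Λ → ℝ} (hh : ∀ x y, 0 ≤ h x y) {M K : ℝ} (hM0 : 0 ≤ M)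
    (hM : ∀ x y, ∑ i ∈ J with x ∈ S i ∧ y ∈ S i, φ i ≤ M * h x y)
    (hK : ∀ x y, ∑ z, h x z * h z y ≤ K * h x y) (X Y : Finset Λ) :
    ∑ i ∈ J with ¬ Disjoint (S i) X, φ i * ∑ z ∈ S i, ∑ y ∈ Y, h z y ≤
      M * K * ∑ x ∈ X, ∑ y ∈ Y, h x y := by
  refine (sum_inter_le hφ X fun i =>
    Finset.sum_nonneg fun z _ => Finset.sum_nonneg fun y _ => hh z y).trans ?_
  rw [Finset.mul_sum]
  refine Finset.sum_le_sum fun x _ => ?_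
  calc ∑ i ∈ J with x ∈ S i, φ i * ∑ z ∈ S i, ∑ y ∈ Y, h z y
      = ∑ i ∈ J with x ∈ S i, ∑ z, if z ∈ S i then φ i * ∑ y ∈ Y, h z y else 0 := by
        refine Finset.sum_congr rfl fun i _ => ?_
        rw [Finset.mul_sum, Finset.sum_ite_mem, Finset.univ_inter]
    _ = ∑ z, (∑ i ∈ J with x ∈ S i ∧ z ∈ S i, φ i) * ∑ y ∈ Y, h z y := by
        rw [Finset.sum_comm]
        refine Finset.sum_congr rfl fun z _ => ?_
        rw [Finset.sum_mul, ← Finset.filter_filter, Finset.sum_filter (p := fun i => z ∈ S i)]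
    _ ≤ ∑ z, (M * h x z) * ∑ y ∈ Y, h z y := by
        refine Finset.sum_le_sum fun z _ => mul_le_mul_of_nonneg_right (hM x z) ?_
        exact Finset.sum_nonneg fun y _ => hh z y
    _ = M * ∑ y ∈ Y, ∑ z, h x z * h z y := by
        simp_rw [Finset.mul_sum]
        rw [Finset.sum_comm]
        refine Finset.sum_congr rfl fun y _ => Finset.sum_congr rfl fun z _ => by ring
    _ ≤ M * ∑ y ∈ Y, K * h x y := by gcongr; exact hK x _
    _ = _ := by rw [← Finset.mul_sum]; ring

set_option maxHeartbeats 1000000 in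
/-- One step of the Lieb–Robinson iteration: the remainder `(2Nτ)^k / k!` improves from `k` to
`k + 1`. -/
theorem lieb_robinson_remainder [IsDedekindFiniteMonoid 𝔸] [Fintype Λ] {J : Finset ι}
    {S : ι → Finset Λ} {Φ : ι → ℝ → 𝔸} {φ : ι → ℝ} {𝒜 : Finset Λ → Subalgebra ℂ 𝔸}
    (hcomm : ∀ X Y, Disjoint X Y → ∀ a ∈ 𝒜 X, ∀ b ∈ 𝒜 Y, Commute a b)
    (hmem : ∀ i ∈ J, ∀ t, Φ i t ∈ 𝒜 (S i)) (hcont : ∀ i ∈ J, Continuous (Φ i))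
    (hsa : ∀ i ∈ J, ∀ t, IsSelfAdjoint (Φ i t)) (hφ : ∀ i, 0 ≤ φ i)
    (hnorm : ∀ i ∈ J, ∀ t, ‖Φ i t‖ ≤ φ i)
    {h : Λ → Λ → ℝ} (hh : ∀ x y, 0 ≤ h x y) {M K : ℝ} (hM0 : 0 ≤ M) (hK0 : 0 < K)
    (hM : ∀ x y, ∑ i ∈ J with x ∈ S i ∧ y ∈ S i, φ i ≤ M * h x y)
    (hK : ∀ x y, ∑ z, h x z * h z y ≤ K * h x y)
    {V : ℝ → 𝔸} (hV : ∀ t, V t ∈ unitary 𝔸) (hV0 : V 0 = 1)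
    (hVd : ∀ t, HasDerivAt V (V t * (Complex.I • ∑ i ∈ J, Φ i t)) t)
    {Y : Finset Λ} {b : 𝔸} (hb : b ∈ 𝒜 Y) (k : ℕ) :
    ∀ (X : Finset Λ), ∀ a ∈ 𝒜 X, ∀ t, 0 ≤ t →
      ‖(V t * a * star (V t)) * b - b * (V t * a * star (V t))‖ ≤
        2 * ‖a‖ * ‖b‖ * ((if Disjoint X Y then 0 else 1) +
          (∑ x ∈ X, ∑ y ∈ Y, h x y) / K * (Real.exp (2 * M * K * t) - 1) +
          (2 * (∑ i ∈ J, φ i) * t) ^ k / k.factorial) := by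
  have hT : ∀ X : Finset Λ, 0 ≤ ∑ x ∈ X, ∑ y ∈ Y, h x y := fun X =>
    Finset.sum_nonneg fun x _ => Finset.sum_nonneg fun y _ => hh x y
  have hN : 0 ≤ ∑ i ∈ J, φ i := Finset.sum_nonneg fun i _ => hφ i
  induction k with
  | zero =>
    intro X a ha t ht
    refine (norm_commutator_le _ _).trans ?_
    rw [norm_conj_unitary (hV t)]
    refine le_mul_of_one_le_right (by positivity) ?_
    have h1 : 0 ≤ Real.exp (2 * M * K * t) - 1 := by
      have := Real.add_one_le_exp (2 * M * K * t)
      have : 0 ≤ 2 * M * K * t := by positivity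
      linarith
    have h2 : 0 ≤ (∑ x ∈ X, ∑ y ∈ Y, h x y) / K * (Real.exp (2 * M * K * t) - 1) :=
      mul_nonneg (div_nonneg (hT X) hK0.le) h1
    have h3 : (0 : ℝ) ≤ if Disjoint X Y then 0 else 1 := by split_ifs <;> simp
    simp only [pow_zero, Nat.factorial_zero, Nat.cast_one, div_one]
    linarith
  | succ k ih =>
    intro X a ha t ht
    have hVc : Continuous V := continuous_iff_continuousAt.2 fun t => (hVd t).continuousAt
    set JX := J.filter fun i => ¬ Disjoint (S i) X with hJX
    have hJXJ : ∀ i ∈ JX, i ∈ J := fun i hi => (Finset.mem_filter.1 hi).1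
    set G : ℝ → 𝔸 := fun t => ∑ i ∈ J, Φ i t with hG
    set G' : ℝ → 𝔸 := fun t => ∑ i ∈ JX, Φ i t with hG'
    have hGc' : Continuous G' := continuous_finsetSum _ fun i hi => hcont i (hJXJ i hi)
    have hGsa : ∀ t, IsSelfAdjoint (G t) := fun t => isSelfAdjoint_sum _ fun i hi => hsa i hi t
    have hGsa' : ∀ t, IsSelfAdjoint (G' t) := fun t =>
      isSelfAdjoint_sum _ fun i hi => hsa i (hJXJ i hi) t
    have hGa : ∀ t, Commute (G t - G' t) a := by
      intro s
      have : G s - G' s = ∑ i ∈ J with Disjoint (S i) X, Φ i s := by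
        rw [hG, hG', sub_eq_iff_eq_add, Finset.sum_filter_add_sum_filter_not]
      rw [this]
      refine Commute.sum_left _ _ _ fun i hi => ?_
      obtain ⟨hi1, hi2⟩ := Finset.mem_filter.1 hi
      exact hcomm _ _ hi2 _ (hmem i hi1 s) _ ha
    set Kk : ℝ → 𝔸 := fun s => -(V s * G' s * star (V s)) with hKk
    have hKc : Continuous Kk := ((hVc.mul hGc').mul hVc.star).neg
    have hKsa : ∀ s, IsSelfAdjoint (Kk s) := fun s => ((hGsa' s).conjugate _).neg
    set Q := evolution Kk with hQ
    have hQu := fun s => evolution_mem_unitary hKc hKsa s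
    have hVQ := fun s => conj_eq_conj_evolution hV hV0 hVd hGsa hGsa' hGc' hGa s
    have hstart : ‖a * b - b * a‖ ≤ 2 * ‖a‖ * ‖b‖ * (if Disjoint X Y then 0 else 1) := by
      split_ifs with hd
      · rw [(hcomm X Y hd a ha b hb).eq]; simp
      · rw [mul_one]; exact norm_commutator_le a b
    have hbound : ∀ s, 0 ≤ s → ‖Kk s * b - b * Kk s‖ ≤ 2 * ‖b‖ *
        ((∑ x ∈ X, ∑ y ∈ Y, h x y) * M * Real.exp (2 * M * K * s) +
          (∑ i ∈ J, φ i) * ((2 * (∑ i ∈ J, φ i) * s) ^ k / k.factorial)) := by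
      intro s hs
      have e : Kk s * b - b * Kk s = -∑ i ∈ JX, ((V s * Φ i s * star (V s)) * b -
          b * (V s * Φ i s * star (V s))) := by
        simp only [hKk, hG', Finset.mul_sum, Finset.sum_mul, Finset.sum_sub_distrib]
        simp only [← Finset.mul_sum, ← Finset.sum_mul]
        noncomm_ring
      rw [e, norm_neg]
      set E := Real.exp (2 * M * K * s) - 1 with hE
      have hE0 : 0 ≤ E := by
        have := Real.add_one_le_exp (2 * M * K * s)
        have : 0 ≤ 2 * M * K * s := by positivity
        rw [hE]; linarith
      set r := (2 * (∑ i ∈ J, φ i) * s) ^ k / k.factorial with hr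
      have hr0 : 0 ≤ r := by positivity
      refine (norm_sum_le _ _).trans ?_
      calc ∑ i ∈ JX, ‖(V s * Φ i s * star (V s)) * b - b * (V s * Φ i s * star (V s))‖
          ≤ ∑ i ∈ JX, 2 * φ i * ‖b‖ * ((if Disjoint (S i) Y then 0 else 1) +
              (∑ x ∈ S i, ∑ y ∈ Y, h x y) / K * E + r) := by
            refine Finset.sum_le_sum fun i hi => (ih (S i) _ (hmem i (hJXJ i hi) s) s hs).trans ?_
            have h3 : (0 : ℝ) ≤ if Disjoint (S i) Y then 0 else 1 := by split_ifs <;> simp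
            have h4 : 0 ≤ (∑ x ∈ S i, ∑ y ∈ Y, h x y) / K * E :=
              mul_nonneg (div_nonneg (hT _) hK0.le) hE0
            have := hnorm i (hJXJ i hi) s
            gcongr
        _ = 2 * ‖b‖ * ((∑ i ∈ JX, φ i * (if Disjoint (S i) Y then 0 else 1)) +
              (∑ i ∈ JX, φ i * ∑ x ∈ S i, ∑ y ∈ Y, h x y) / K * E + (∑ i ∈ JX, φ i) * r) := by
            rw [Finset.sum_div, Finset.sum_mul, Finset.sum_mul, ← Finset.sum_add_distrib,
              ← Finset.sum_add_distrib, Finset.mul_sum]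
            exact Finset.sum_congr rfl fun i _ => by ring
        _ ≤ 2 * ‖b‖ * (M * (∑ x ∈ X, ∑ y ∈ Y, h x y) +
              (M * K * ∑ x ∈ X, ∑ y ∈ Y, h x y) / K * E + (∑ i ∈ J, φ i) * r) := by
            gcongr
            · exact sum_inter_inter_le hφ hM X Y
            · exact sum_inter_tail_le hφ hh hM0 hM hK X Y
            · exact fun i _ _ => hφ i
            · exact Finset.filter_subset _ _
        _ = _ := by
            have : Real.exp (2 * M * K * s) = E + 1 := by rw [hE]; ring
            rw [this]
            field_simp
            ring
    set f : ℝ → 𝔸 := fun s => a * (star (Q s) * b * Q s) - (star (Q s) * b * Q s) * a with hf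
    have hfd : ∀ s, HasDerivAt f
        (a * (Complex.I • (star (Q s) * (Kk s * b - b * Kk s) * Q s)) -
          (Complex.I • (star (Q s) * (Kk s * b - b * Kk s) * Q s)) * a) s := fun s =>
      ((hasDerivAt_conj_evolution hKc hKsa b s).const_mul a).sub
        ((hasDerivAt_conj_evolution hKc hKsa b s).mul_const a)
    rw [hVQ, norm_commutator_conj (hQu t)]
    set c := ∑ x ∈ X, ∑ y ∈ Y, h x y with hc
    set N := ∑ i ∈ J, φ i with hNdef
    have hB : ∀ s : ℝ, HasDerivAt (fun s => 2 * ‖a‖ * ‖b‖ * ((if Disjoint X Y then 0 else 1) +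
          c / K * (Real.exp (2 * M * K * s) - 1) + (2 * N * s) ^ (k + 1) / (k + 1).factorial))
        (2 * ‖a‖ * ‖b‖ * (c / K * (Real.exp (2 * M * K * s) * (2 * M * K)) +
          (2 * N) * ((2 * N * s) ^ k / k.factorial))) s := by
      intro s
      have h1 : HasDerivAt (fun s : ℝ => 2 * M * K * s) (2 * M * K) s := by
        simpa using (hasDerivAt_id s).const_mul (2 * M * K)
      have h2 : HasDerivAt (fun s : ℝ => 2 * N * s) (2 * N) s := by
        simpa using (hasDerivAt_id s).const_mul (2 * N)
      have h3 := (((h1.exp.sub_const 1).const_mul (c / K)).const_add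
        (if Disjoint X Y then (0 : ℝ) else 1)).add
        ((h2.pow (k + 1)).div_const ((k + 1).factorial : ℝ))
      refine (h3.const_mul (2 * ‖a‖ * ‖b‖)).congr_deriv ?_
      have : ((k + 1).factorial : ℝ) = (k + 1) * k.factorial := by
        rw [Nat.factorial_succ]; push_cast; ring
      rw [this]
      have hk : (k.factorial : ℝ) ≠ 0 := by positivity
      have hk1 : (k + 1 : ℝ) ≠ 0 := by positivity
      simp only [Nat.add_sub_cancel]
      push_cast
      field_simp
    refine image_norm_le_of_norm_deriv_right_le_deriv_boundary (f := f) (a := 0) (b := t)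
      (fun s _ => (hfd s).continuousAt.continuousWithinAt) (fun s _ => (hfd s).hasDerivWithinAt)
      ?_ hB ?_ ⟨ht, le_rfl⟩
    · simpa [hf, hQ, evolution_zero] using hstart
    · intro s hs
      refine (norm_commutator_le _ _).trans ?_
      rw [norm_smul, Complex.norm_I, one_mul, norm_mul_unitary (hQu s),
        norm_unitary_mul (Unitary.star_mem (hQu s))]
      calc 2 * ‖a‖ * ‖Kk s * b - b * Kk s‖ ≤ 2 * ‖a‖ * _ :=
            mul_le_mul_of_nonneg_left (hbound s hs.1) (by positivity)
        _ = _ := by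
            field_simp

/-- **Lieb–Robinson bound.** Here `h` is a reproducing decay function with constant `K`, the
interaction strength between any two sites `x, y` is at most `M h(x,y)`, and `V` is the propagator
of the local Hamiltonian `∑ i ∈ J, Φ i`. -/
theorem lieb_robinson [IsDedekindFiniteMonoid 𝔸] [Fintype Λ] {J : Finset ι}
    {S : ι → Finset Λ} {Φ : ι → ℝ → 𝔸} {φ : ι → ℝ} {𝒜 : Finset Λ → Subalgebra ℂ 𝔸}
    (hcomm : ∀ X Y, Disjoint X Y → ∀ a ∈ 𝒜 X, ∀ b ∈ 𝒜 Y, Commute a b)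
    (hmem : ∀ i ∈ J, ∀ t, Φ i t ∈ 𝒜 (S i)) (hcont : ∀ i ∈ J, Continuous (Φ i))
    (hsa : ∀ i ∈ J, ∀ t, IsSelfAdjoint (Φ i t)) (hφ : ∀ i, 0 ≤ φ i)
    (hnorm : ∀ i ∈ J, ∀ t, ‖Φ i t‖ ≤ φ i)
    {h : Λ → Λ → ℝ} (hh : ∀ x y, 0 ≤ h x y) {M K : ℝ} (hM0 : 0 ≤ M) (hK0 : 0 < K)
    (hM : ∀ x y, ∑ i ∈ J with x ∈ S i ∧ y ∈ S i, φ i ≤ M * h x y)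
    (hK : ∀ x y, ∑ z, h x z * h z y ≤ K * h x y)
    {V : ℝ → 𝔸} (hV : ∀ t, V t ∈ unitary 𝔸) (hV0 : V 0 = 1)
    (hVd : ∀ t, HasDerivAt V (V t * (Complex.I • ∑ i ∈ J, Φ i t)) t)
    {X Y : Finset Λ} (hXY : Disjoint X Y) {a b : 𝔸} (ha : a ∈ 𝒜 X) (hb : b ∈ 𝒜 Y)
    {t : ℝ} (ht : 0 ≤ t) :
    ‖(V t * a * star (V t)) * b - b * (V t * a * star (V t))‖ ≤
      2 * ‖a‖ * ‖b‖ * ((Real.exp (2 * M * K * t) - 1) / K * ∑ x ∈ X, ∑ y ∈ Y, h x y) := by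
  have h1 := fun k => lieb_robinson_remainder hcomm hmem hcont hsa hφ hnorm hh hM0 hK0 hM hK hV hV0
    hVd hb k X a ha t ht
  have h2 := ((FloorSemiring.tendsto_pow_div_factorial_atTop
    (2 * (∑ i ∈ J, φ i) * t)).const_add ((if Disjoint X Y then (0 : ℝ) else 1) +
      (∑ x ∈ X, ∑ y ∈ Y, h x y) / K * (Real.exp (2 * M * K * t) - 1))).const_mul (2 * ‖a‖ * ‖b‖)
  refine (ge_of_tendsto' h2 h1).trans (le_of_eq ?_)
  rw [if_pos hXY]
  ring

end LiebRobinson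

/-! ### Comparing propagators -/

section Gluing

variable {𝔸 : Type*} [CStarAlgebra 𝔸] [IsDedekindFiniteMonoid 𝔸]

/-- The commutator of `m` with `U₁(s) U₂(s)⋆` is controlled by commutators of `m` with the
difference of the two generators, transported from time `r` to time `s` by the first dynamics. -/
theorem norm_commutator_evolution_mul_star_le {K₁ K₂ : ℝ → 𝔸} (h₁ : Continuous K₁)
    (h₂ : Continuous K₂) (hs₁ : ∀ t, IsSelfAdjoint (K₁ t)) (hs₂ : ∀ t, IsSelfAdjoint (K₂ t))
    {s c : ℝ} {m : 𝔸}
    (hc : ∀ r ∈ Set.uIcc 0 s,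
      ‖(evolution K₁ s * star (evolution K₁ r) * (K₁ r - K₂ r) *
          star (evolution K₁ s * star (evolution K₁ r))) * m -
        m * (evolution K₁ s * star (evolution K₁ r) * (K₁ r - K₂ r) *
          star (evolution K₁ s * star (evolution K₁ r)))‖ ≤ c) :
    ‖evolution K₁ s * star (evolution K₂ s) * m - m * (evolution K₁ s * star (evolution K₂ s))‖ ≤
      |s| * c := by
  set U := evolution K₁ with hU
  set U' := evolution K₂ with hU'
  have hu := fun r => evolution_mem_unitary h₁ hs₁ r
  have hu' := fun r => evolution_mem_unitary h₂ hs₂ r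
  rw [← hU] at hu
  rw [← hU'] at hu'
  have hWu : U s * star (U' s) ∈ unitary 𝔸 := mul_mem (hu s) (Unitary.star_mem (hu' s))
  set m' := star (U s) * m * U s with hm'
  set P : ℝ → 𝔸 := fun r => star (U r) * U' r with hP
  have hPu : ∀ r, P r ∈ unitary 𝔸 := fun r => mul_mem (Unitary.star_mem (hu r)) (hu' r)
  set D : ℝ → 𝔸 := fun r => star (U r) * (K₁ r - K₂ r) * U r with hD
  have hDsa : ∀ r, star (D r) = D r := fun r => by
    simp only [hD, star_mul, star_star, star_sub, (hs₁ r).star_eq, (hs₂ r).star_eq, mul_assoc]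
  have hPd : ∀ r, HasDerivAt P (Complex.I • (D r * P r)) r := by
    intro r
    refine ((hasDerivAt_star_evolution h₁ hs₁ r).mul (hasDerivAt_evolution h₂ r)).congr_deriv ?_
    have h0 : D r * P r = star (U r) * (K₁ r - K₂ r) * U' r := by
      simp only [hD, hP]
      rw [mul_assoc _ (U r), ← mul_assoc (U r), Unitary.mul_star_self_of_mem (hu r), one_mul]
    rw [h0]
    simp only [smul_mul_assoc, mul_smul_comm, neg_smul, mul_neg, ← hU, ← hU']
    rw [← sub_eq_add_neg, ← smul_sub]
    congr 1
    noncomm_ring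
  have hgd : ∀ r, HasDerivAt (fun r => star (P r) * m' * P r)
      (-(Complex.I • (star (P r) * (D r * m' - m' * D r) * P r))) r := by
    intro r
    refine (((hPd r).star.mul_const m').mul (hPd r)).congr_deriv ?_
    rw [star_smul, star_mul, hDsa]
    simp only [Complex.star_def, Complex.conj_I, neg_smul, smul_mul_assoc, mul_smul_comm, neg_mul]
    rw [← neg_eq_iff_eq_neg, neg_add, neg_neg, ← sub_eq_add_neg, ← smul_sub]
    congr 1
    noncomm_ring
  have hb : ∀ r ∈ Set.uIcc 0 s,
      ‖-(Complex.I • (star (P r) * (D r * m' - m' * D r) * P r))‖ ≤ c := by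
    intro r hr
    rw [norm_neg, norm_smul, Complex.norm_I, one_mul, norm_mul_unitary (hPu r),
      norm_unitary_mul (Unitary.star_mem (hPu r)), hm', ← norm_commutator_conj (hu s)]
    refine le_trans (le_of_eq ?_) (hc r hr)
    simp only [hD, star_mul, star_star, mul_assoc]
  have := (convex_uIcc (0 : ℝ) s).norm_image_sub_le_of_norm_hasDerivWithin_le
    (fun r _ => (hgd r).hasDerivWithinAt) hb Set.right_mem_uIcc Set.left_mem_uIcc
  rw [zero_sub, norm_neg, Real.norm_eq_abs, mul_comm] at this
  refine le_trans (le_of_eq ?_) this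
  have h0 : P 0 = 1 := by simp [hP, hU, hU', evolution_zero]
  rw [h0, star_one, one_mul, mul_one]
  have e1 : U s * star (U' s) * m - m * (U s * star (U' s)) =
      -(U s * star (U' s) * (star (U s * star (U' s)) * m * (U s * star (U' s)) - m)) := by
    generalize U s * star (U' s) = W at hWu
    rw [mul_sub, ← mul_assoc, ← mul_assoc, Unitary.mul_star_self_of_mem hWu, one_mul, neg_sub]
  rw [e1, norm_neg, norm_unitary_mul hWu, ← norm_conj_unitary (hu' s) (m' - _)]
  congr 1
  have h2 := Unitary.mul_star_self_of_mem (hu' s)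
  have h3 := Unitary.mul_star_self_of_mem (hu s)
  simp only [hP, hm', mul_sub, sub_mul, star_mul, star_star]
  have e2 : U' s * (star (U' s) * U s * (star (U s) * m * U s) * (star (U s) * U' s)) *
      star (U' s) = (U' s * star (U' s)) * (U s * star (U s)) * m * (U s * star (U s)) *
        (U' s * star (U' s)) := by noncomm_ring
  rw [e2, h2, h3]
  noncomm_ring

/-- Duhamel estimate for a product `U₁ U₂⋆ U₃` of propagators, whose generator is
`H₁ + W (H₃ - H₂) W⋆` with `W = U₁ U₂⋆`. -/
theorem norm_evolution_sub_mul_star_mul_le {H H₁ H₂ H₃ : ℝ → 𝔸} (h : Continuous H)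
    (h₁ : Continuous H₁) (h₂ : Continuous H₂) (h₃ : Continuous H₃)
    (hs : ∀ t, IsSelfAdjoint (H t)) (hs₁ : ∀ t, IsSelfAdjoint (H₁ t))
    (hs₂ : ∀ t, IsSelfAdjoint (H₂ t)) (hs₃ : ∀ t, IsSelfAdjoint (H₃ t)) {t c : ℝ}
    (hc : ∀ s ∈ Set.uIcc 0 t, ‖H s - H₁ s - (evolution H₁ s * star (evolution H₂ s)) *
      (H₃ s - H₂ s) * star (evolution H₁ s * star (evolution H₂ s))‖ ≤ c) :
    ‖evolution H t - evolution H₁ t * star (evolution H₂ t) * evolution H₃ t‖ ≤ |t| * c := by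
  set U := evolution H with hU
  set U₁ := evolution H₁ with hU₁
  set U₂ := evolution H₂ with hU₂
  set U₃ := evolution H₃ with hU₃
  have hu : ∀ r, U r ∈ unitary 𝔸 := fun r => evolution_mem_unitary h hs r
  have hu₁ : ∀ r, U₁ r ∈ unitary 𝔸 := fun r => evolution_mem_unitary h₁ hs₁ r
  have hu₂ : ∀ r, U₂ r ∈ unitary 𝔸 := fun r => evolution_mem_unitary h₂ hs₂ r
  have hu₃ : ∀ r, U₃ r ∈ unitary 𝔸 := fun r => evolution_mem_unitary h₃ hs₃ r
  set Z : ℝ → 𝔸 := fun s => U₁ s * star (U₂ s) * U₃ s with hZ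
  have hZu : ∀ r, Z r ∈ unitary 𝔸 := fun r =>
    mul_mem (mul_mem (hu₁ r) (Unitary.star_mem (hu₂ r))) (hu₃ r)
  set E : ℝ → 𝔸 := fun s => H s - H₁ s - (U₁ s * star (U₂ s)) *
      (H₃ s - H₂ s) * star (U₁ s * star (U₂ s)) with hE
  have hd : ∀ s, HasDerivAt (fun s => star (U s) * Z s)
      (Complex.I • (star (U s) * E s * Z s)) s := by
    intro s
    refine ((hasDerivAt_star_evolution h hs s).mul (((hasDerivAt_evolution h₁ s).mul
      (hasDerivAt_star_evolution h₂ hs₂ s)).mul (hasDerivAt_evolution h₃ s))).congr_deriv ?_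
    change Complex.I • (star (U s) * H s) * (U₁ s * star (U₂ s) * U₃ s) + star (U s) *
      ((-Complex.I • (H₁ s * U₁ s) * star (U₂ s) + U₁ s * Complex.I • (star (U₂ s) * H₂ s)) * U₃ s +
        U₁ s * star (U₂ s) * -Complex.I • (H₃ s * U₃ s)) = _
    have hW : star (U₁ s * star (U₂ s)) * (U₁ s * star (U₂ s)) = 1 :=
      Unitary.star_mul_self_of_mem (mul_mem (hu₁ s) (Unitary.star_mem (hu₂ s)))
    have e : star (U s) * E s * Z s = star (U s) * (H s - H₁ s) * Z s -
        star (U s) * (U₁ s * star (U₂ s)) * (H₃ s - H₂ s) *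
          (star (U₁ s * star (U₂ s)) * (U₁ s * star (U₂ s))) * U₃ s := by
      simp only [hE, hZ]
      noncomm_ring
    rw [e, hW]
    simp only [hZ, smul_mul_assoc, mul_smul_comm, neg_smul, mul_neg, neg_mul, mul_add, add_mul,
      mul_sub, sub_mul, smul_sub, mul_one, mul_assoc]
    abel
  have := (convex_uIcc (0 : ℝ) t).norm_image_sub_le_of_norm_hasDerivWithin_le (C := c)
    (fun r _ => (hd r).hasDerivWithinAt) (fun r hr => by
      rw [norm_smul, Complex.norm_I, one_mul, norm_mul_unitary (hZu r),
        norm_unitary_mul (Unitary.star_mem (hu r))]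
      exact hc r hr) Set.left_mem_uIcc Set.right_mem_uIcc
  rw [sub_zero, Real.norm_eq_abs, mul_comm] at this
  refine le_trans (le_of_eq ?_) this
  have h0 : star (U 0) * Z 0 = 1 := by simp [hZ, hU, hU₁, hU₂, hU₃, evolution_zero]
  rw [h0, ← norm_unitary_mul (hu t) (star (U t) * Z t - 1), mul_sub, ← mul_assoc,
    Unitary.mul_star_self_of_mem (hu t), one_mul, mul_one, norm_sub_rev]

variable {Λ ι : Type*} [DecidableEq Λ] [Fintype Λ]

/-- Lieb–Robinson bound for the two-time propagator `U(s) U(r)⋆`. -/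
theorem lieb_robinson_two_time {J : Finset ι}
    {S : ι → Finset Λ} {Φ : ι → ℝ → 𝔸} {φ : ι → ℝ} {𝒜 : Finset Λ → Subalgebra ℂ 𝔸}
    (hcomm : ∀ X Y, Disjoint X Y → ∀ a ∈ 𝒜 X, ∀ b ∈ 𝒜 Y, Commute a b)
    (hmem : ∀ i ∈ J, ∀ t, Φ i t ∈ 𝒜 (S i)) (hcont : ∀ i ∈ J, Continuous (Φ i))
    (hsa : ∀ i ∈ J, ∀ t, IsSelfAdjoint (Φ i t)) (hφ : ∀ i, 0 ≤ φ i)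
    (hnorm : ∀ i ∈ J, ∀ t, ‖Φ i t‖ ≤ φ i)
    {h : Λ → Λ → ℝ} (hh : ∀ x y, 0 ≤ h x y) {M K : ℝ} (hM0 : 0 ≤ M) (hK0 : 0 < K)
    (hM : ∀ x y, ∑ i ∈ J with x ∈ S i ∧ y ∈ S i, φ i ≤ M * h x y)
    (hK : ∀ x y, ∑ z, h x z * h z y ≤ K * h x y)
    {X Y : Finset Λ} (hXY : Disjoint X Y) {a b : 𝔸} (ha : a ∈ 𝒜 X) (hb : b ∈ 𝒜 Y)
    {s r : ℝ} (hr : r ∈ Set.uIcc 0 s) {u : 𝔸}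
    (hu : u = evolution (fun t => ∑ i ∈ J, Φ i t) s *
      star (evolution (fun t => ∑ i ∈ J, Φ i t) r)) :
    ‖(u * a * star u) * b - b * (u * a * star u)‖ ≤
      2 * ‖a‖ * ‖b‖ * ((Real.exp (2 * M * K * |s|) - 1) / K * ∑ x ∈ X, ∑ y ∈ Y, h x y) := by
  set G : ℝ → 𝔸 := fun t => ∑ i ∈ J, Φ i t with hG
  have hGc : Continuous G := continuous_finsetSum _ hcont
  have hGsa : ∀ t, IsSelfAdjoint (G t) := fun t => isSelfAdjoint_sum _ fun i hi => hsa i hi t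
  have hU := fun t => evolution_mem_unitary hGc hGsa t
  -- reparametrise the time interval from `s` down to `0` by `θ ∈ [0,1]`
  obtain ⟨θ, hθ0, hθ1, hθ⟩ : ∃ θ : ℝ, 0 ≤ θ ∧ θ ≤ 1 ∧ r = s * (1 - θ) := by
    rw [← segment_eq_uIcc] at hr
    obtain ⟨p, q, hp, hq, hpq, rfl⟩ := hr
    refine ⟨p, hp, by linarith, ?_⟩
    simp only [smul_eq_mul, mul_zero, zero_add]
    rw [← hpq]; ring
  set V : ℝ → 𝔸 := fun θ => evolution G s * star (evolution G (s * (1 - θ))) with hV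
  set Φ' : ι → ℝ → 𝔸 := fun i θ => (-s : ℂ) • Φ i (s * (1 - θ)) with hΦ'
  have hVd : ∀ θ, HasDerivAt V (V θ * (Complex.I • ∑ i ∈ J, Φ' i θ)) θ := by
    intro θ
    have h1 : HasDerivAt (fun θ : ℝ => s * (1 - θ)) (-s) θ := by
      simpa using ((hasDerivAt_id θ).const_sub 1).const_mul s
    have h2 := (HasDerivAt.scomp θ (hasDerivAt_star_evolution hGc hGsa (s * (1 - θ))) h1).const_mul
      (evolution G s)
    refine h2.congr_deriv ?_
    rw [← Finset.smul_sum]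
    simp only [mul_smul_comm, hV, mul_assoc, hG]
    rw [smul_comm Complex.I, ← Complex.coe_smul]
    push_cast
    rfl
  have hc' : ∀ i ∈ J, Continuous (Φ' i) := fun i hi =>
    ((hcont i hi).comp (by fun_prop)).const_smul (-s : ℂ)
  have hsa' : ∀ i ∈ J, ∀ t, IsSelfAdjoint (Φ' i t) := fun i hi t => by
    refine IsSelfAdjoint.smul ?_ (hsa i hi _)
    rw [IsSelfAdjoint, Complex.star_def]
    simp
  have hn' : ∀ i ∈ J, ∀ t, ‖Φ' i t‖ ≤ |s| * φ i := fun i hi t => by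
    simp only [hΦ']
    rw [norm_smul, norm_neg, Complex.norm_real, Real.norm_eq_abs]
    exact mul_le_mul_of_nonneg_left (hnorm i hi _) (abs_nonneg s)
  have key := lieb_robinson (Φ := Φ') (φ := fun i => |s| * φ i) (M := |s| * M) hcomm
    (fun i hi t => Subalgebra.smul_mem _ (hmem i hi _) _) hc' hsa'
    (fun i => mul_nonneg (abs_nonneg s) (hφ i)) hn' hh (by positivity) hK0
    (fun x y => by
      rw [← Finset.mul_sum, mul_assoc]
      exact mul_le_mul_of_nonneg_left (hM x y) (abs_nonneg s)) hK
    (fun θ => mul_mem (hU s) (Unitary.star_mem (hU _)))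
    (by simp [Unitary.mul_star_self_of_mem (hU s)]) hVd hXY ha hb hθ0
  have hVu : V θ = u := by rw [hu, hθ]
  change ‖V θ * a * star (V θ) * b - b * (V θ * a * star (V θ))‖ ≤ _ at key
  rw [hVu] at key
  refine key.trans ?_
  have hT : 0 ≤ ∑ x ∈ X, ∑ y ∈ Y, h x y :=
    Finset.sum_nonneg fun x _ => Finset.sum_nonneg fun y _ => hh x y
  have : 2 * (|s| * M) * K * θ ≤ 2 * M * K * |s| := by
    have h0 : 0 ≤ 2 * M * K * |s| := by positivity
    calc 2 * (|s| * M) * K * θ = (2 * M * K * |s|) * θ := by ring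
      _ ≤ (2 * M * K * |s|) * 1 := mul_le_mul_of_nonneg_left hθ1 h0
      _ = _ := mul_one _
  gcongr

set_option maxHeartbeats 1000000 in
/-- **Gluing of dynamics, abstract form.** The Hamiltonian is `∑ i ∈ I, Φ i` with `Φ i` supported
on `S i`, and `A'`, `C'` are the collars. The error consists of the terms that fit into none of `B`,
`C ∪ C'`, `A' ∪ A`, and of the commutators of two kinds of terms: those that cross the boundary of
`B` within `C ∪ C'` or `A' ∪ A`, and those of `B` that fit into neither collar. The weight `ρ i k`
is the better of the trivial and the Lieb–Robinson bound on the commutator. -/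
theorem norm_evolution_sub_glued_le {I : Finset ι}
    {S : ι → Finset Λ} {Φ : ι → ℝ → 𝔸} {φ : ι → ℝ} {𝒜 : Finset Λ → Subalgebra ℂ 𝔸}
    (hcomm : ∀ X Y, Disjoint X Y → ∀ a ∈ 𝒜 X, ∀ b ∈ 𝒜 Y, Commute a b)
    (hS : ∀ i ∈ I, (S i).Nonempty)
    (hmem : ∀ i ∈ I, ∀ t, Φ i t ∈ 𝒜 (S i)) (hcont : ∀ i ∈ I, Continuous (Φ i))
    (hsa : ∀ i ∈ I, ∀ t, IsSelfAdjoint (Φ i t)) (hφ : ∀ i, 0 ≤ φ i)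
    (hnorm : ∀ i ∈ I, ∀ t, ‖Φ i t‖ ≤ φ i)
    {h : Λ → Λ → ℝ} (hh : ∀ x y, 0 ≤ h x y) {M K : ℝ} (hM0 : 0 ≤ M) (hK0 : 0 < K)
    (hM : ∀ x y, ∑ i ∈ I with x ∈ S i ∧ y ∈ S i, φ i ≤ M * h x y)
    (hK : ∀ x y, ∑ z, h x z * h z y ≤ K * h x y)
    {A B C A' C' : Finset Λ} (hAB : Disjoint A B) (hBC : Disjoint B C) (hAC : Disjoint A C)
    (hA' : A' ⊆ B) (hC' : C' ⊆ B) (hAC' : Disjoint A' C')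
    {HR : Finset Λ → ℝ → 𝔸} (hHR : ∀ R s, HR R s = ∑ i ∈ I with S i ⊆ R, Φ i s)
    {ρ : ι → ι → ℝ} {t : ℝ}
    (hρ1 : ∀ i k, ¬ Disjoint (S k) (S i) → ρ i k = 1)
    (hρ : ∀ i k, Disjoint (S k) (S i) →
      ρ i k = min 1 ((Real.exp (2 * M * K * |t|) - 1) / K * ∑ x ∈ S k, ∑ y ∈ S i, h x y)) :
    ‖evolution (fun s => ∑ i ∈ I, Φ i s) t - evolution (HR B) t *
        star (evolution (fun s => HR A' s + HR C' s) t) *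
        evolution (fun s => HR (C ∪ C') s + HR (A' ∪ A) s) t‖ ≤
      |t| * ((∑ i ∈ I with ¬ S i ⊆ B ∧ ¬ S i ⊆ C ∪ C' ∧ ¬ S i ⊆ A' ∪ A, φ i) +
        |t| * ∑ i ∈ I with (S i ⊆ C ∪ C' ∨ S i ⊆ A' ∪ A) ∧ ¬ S i ⊆ B ∧ ¬ S i ⊆ A ∧ ¬ S i ⊆ C,
          ∑ k ∈ I with S k ⊆ B ∧ ¬ S k ⊆ A' ∧ ¬ S k ⊆ C', 2 * φ k * φ i * ρ i k) := by
  have hHRc : ∀ R, Continuous (HR R) := fun R => by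
    rw [funext (hHR R)]
    exact continuous_finsetSum _ fun i hi => hcont i (Finset.mem_filter.1 hi).1
  have hHRsa : ∀ R s, IsSelfAdjoint (HR R s) := fun R s => by
    rw [hHR R s]
    exact isSelfAdjoint_sum _ fun i hi => hsa i (Finset.mem_filter.1 hi).1 s
  have hsum : ∀ (p q : ι → Prop) [DecidablePred p] [DecidablePred q],
      (∀ i ∈ I, ¬ (p i ∧ q i)) → ∀ s, (∑ i ∈ I with p i, Φ i s) + ∑ i ∈ I with q i, Φ i s =
        ∑ i ∈ I with p i ∨ q i, Φ i s := by
    intro p q _ _ hpq s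
    classical
    rw [Finset.filter_or, Finset.sum_union]
    exact Finset.disjoint_filter.2 fun i hi hp hq => hpq i hi ⟨hp, hq⟩
  have hno : ∀ {X Y : Finset Λ}, Disjoint X Y → ∀ i ∈ I, ¬ (S i ⊆ X ∧ S i ⊆ Y) := by
    intro X Y hXY i hi ⟨h1, h2⟩
    obtain ⟨x, hx⟩ := hS i hi
    exact Finset.disjoint_left.1 hXY (h1 hx) (h2 hx)
  have hCA : Disjoint (C ∪ C') (A' ∪ A) := by
    rw [Finset.disjoint_union_left, Finset.disjoint_union_right, Finset.disjoint_union_right]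
    exact ⟨⟨(hBC.mono_left hA').symm, hAC.symm⟩, hAC'.symm, (hAB.mono_right hC').symm⟩
  set H₂ : ℝ → 𝔸 := fun s => HR A' s + HR C' s with hH₂
  set H₃ : ℝ → 𝔸 := fun s => HR (C ∪ C') s + HR (A' ∪ A) s with hH₃
  have hH₂c : Continuous H₂ := (hHRc _).add (hHRc _)
  have hH₃c : Continuous H₃ := (hHRc _).add (hHRc _)
  have hH₂sa : ∀ s, IsSelfAdjoint (H₂ s) := fun s => (hHRsa _ s).add (hHRsa _ s)
  have hH₃sa : ∀ s, IsSelfAdjoint (H₃ s) := fun s => (hHRsa _ s).add (hHRsa _ s)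
  have e₂ : ∀ s, H₂ s = ∑ i ∈ I with S i ⊆ A' ∨ S i ⊆ C', Φ i s := fun s => by
    simp only [hH₂, hHR]
    exact hsum _ _ (hno hAC') s
  have e₃ : ∀ s, H₃ s = ∑ i ∈ I with S i ⊆ C ∪ C' ∨ S i ⊆ A' ∪ A, Φ i s := fun s => by
    simp only [hH₃, hHR]
    exact hsum _ _ (hno hCA) s
  -- a region inside `B` and one of the enlarged regions lies in the corresponding collar
  have hcol : ∀ i, S i ⊆ B → (S i ⊆ C ∪ C' ∨ S i ⊆ A' ∪ A) → S i ⊆ A' ∨ S i ⊆ C' := by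
    intro i hi hor
    rcases hor with h1 | h1
    · right; intro x hx
      rcases Finset.mem_union.1 (h1 hx) with h2 | h2
      · exact absurd h2 (Finset.disjoint_left.1 hBC (hi hx))
      · exact h2
    · left; intro x hx
      rcases Finset.mem_union.1 (h1 hx) with h2 | h2
      · exact h2
      · exact absurd (hi hx) (Finset.disjoint_left.1 hAB h2)
  have hcol' : ∀ i, (S i ⊆ A' ∨ S i ⊆ C') → S i ⊆ B ∧ (S i ⊆ C ∪ C' ∨ S i ⊆ A' ∪ A) := by
    intro i hor
    rcases hor with h1 | h1
    · exact ⟨h1.trans hA', Or.inr (h1.trans Finset.subset_union_left)⟩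
    · exact ⟨h1.trans hC', Or.inl (h1.trans Finset.subset_union_right)⟩
  have e₃₂ : ∀ s, H₃ s - H₂ s =
      ∑ i ∈ I with (S i ⊆ C ∪ C' ∨ S i ⊆ A' ∪ A) ∧ ¬ S i ⊆ B, Φ i s := fun s => by
    rw [sub_eq_iff_eq_add, e₂, e₃, hsum]
    · refine Finset.sum_congr (Finset.filter_congr fun i _ => ?_) fun _ _ => rfl
      have := hcol i; have := hcol' i
      tauto
    · intro i _
      have := hcol' i
      tauto
  have eB₂ : ∀ s, HR B s - H₂ s =
      ∑ i ∈ I with S i ⊆ B ∧ ¬ S i ⊆ A' ∧ ¬ S i ⊆ C', Φ i s := fun s => by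
    rw [sub_eq_iff_eq_add, e₂, hHR, hsum]
    · refine Finset.sum_congr (Finset.filter_congr fun i _ => ?_) fun _ _ => rfl
      have := hcol' i
      tauto
    · intro i _
      tauto
  have ebad : ∀ s, (∑ i ∈ I, Φ i s) - HR B s - (H₃ s - H₂ s) =
      ∑ i ∈ I with ¬ S i ⊆ B ∧ ¬ S i ⊆ C ∪ C' ∧ ¬ S i ⊆ A' ∪ A, Φ i s := fun s => by
    rw [sub_sub, sub_eq_iff_eq_add, e₃₂, hHR, hsum, hsum]
    · rw [Finset.sum_filter]
      refine Finset.sum_congr rfl fun i _ => ?_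
      rw [if_pos]
      tauto
    · intro i _
      tauto
    · intro i _
      tauto
  refine norm_evolution_sub_mul_star_mul_le (continuous_finsetSum _ hcont) (hHRc B) hH₂c hH₃c
    (fun s => isSelfAdjoint_sum _ fun i hi => hsa i hi s) (hHRsa B) hH₂sa hH₃sa ?_
  intro s hs
  have hst : |s| ≤ |t| := by
    rcases Set.mem_uIcc.1 hs with h | h
    · rw [abs_of_nonneg h.1, abs_of_nonneg (h.1.trans h.2)]; exact h.2
    · rw [abs_of_nonpos h.2, abs_of_nonpos (h.1.trans h.2)]; linarith [h.1]
  set W := evolution (HR B) s * star (evolution H₂ s) with hW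
  have hWu : W ∈ unitary 𝔸 := mul_mem (evolution_mem_unitary (hHRc B) (hHRsa B) s)
    (Unitary.star_mem (evolution_mem_unitary hH₂c hH₂sa s))
  have split : (∑ i ∈ I, Φ i s) - HR B s - W * (H₃ s - H₂ s) * star W =
      ((∑ i ∈ I, Φ i s) - HR B s - (H₃ s - H₂ s)) -
        (W * (H₃ s - H₂ s) * star W - (H₃ s - H₂ s)) := by abel
  rw [split]
  refine (norm_sub_le _ _).trans (add_le_add ?_ ?_)
  · rw [ebad]
    exact (norm_sum_le _ _).trans
      (Finset.sum_le_sum fun i hi => hnorm i (Finset.mem_filter.1 hi).1 s)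
  have htwo : ∀ i, (∑ k ∈ I with S k ⊆ B ∧ ¬ S k ⊆ A' ∧ ¬ S k ⊆ C', 2 * φ k * φ i * ρ i k) ≥ 0 := by
    intro i
    refine Finset.sum_nonneg fun k _ => ?_
    have : 0 ≤ ρ i k := by
      by_cases hd : Disjoint (S k) (S i)
      · rw [hρ i k hd]
        refine le_min zero_le_one (mul_nonneg (div_nonneg ?_ hK0.le)
          (Finset.sum_nonneg fun x _ => Finset.sum_nonneg fun y _ => hh x y))
        have := Real.add_one_le_exp (2 * M * K * |t|)
        have : 0 ≤ 2 * M * K * |t| := by positivity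
        linarith
      · rw [hρ1 i k hd]; exact zero_le_one
    have := hφ k; have := hφ i
    positivity
  rw [norm_conj_sub_self hWu, e₃₂, Finset.mul_sum, Finset.sum_mul, ← Finset.sum_sub_distrib,
    Finset.mul_sum]
  refine (norm_sum_le _ _).trans ?_
  have efil : (I.filter fun i => (S i ⊆ C ∪ C' ∨ S i ⊆ A' ∪ A) ∧ ¬ S i ⊆ B ∧
      ¬ S i ⊆ A ∧ ¬ S i ⊆ C) = (I.filter fun i => (S i ⊆ C ∪ C' ∨ S i ⊆ A' ∪ A) ∧ ¬ S i ⊆ B).filter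
        fun i => ¬ S i ⊆ A ∧ ¬ S i ⊆ C := by
    rw [Finset.filter_filter]
    exact Finset.filter_congr fun i _ => by tauto
  rw [efil, Finset.sum_filter (p := fun i => ¬ S i ⊆ A ∧ ¬ S i ⊆ C)]
  refine Finset.sum_le_sum fun i hi => ?_
  have hiI : i ∈ I := (Finset.mem_filter.1 hi).1
  split_ifs with hcross
  · refine (norm_commutator_evolution_mul_star_le (hHRc B) hH₂c (hHRsa B) hH₂sa
      (c := ∑ k ∈ I with S k ⊆ B ∧ ¬ S k ⊆ A' ∧ ¬ S k ⊆ C', 2 * φ k * φ i * ρ i k) ?_).trans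
      (mul_le_mul_of_nonneg_right hst (htwo i))
    intro r hr
    set u := evolution (HR B) s * star (evolution (HR B) r) with hu
    have huu : u ∈ unitary 𝔸 := mul_mem (evolution_mem_unitary (hHRc B) (hHRsa B) s)
      (Unitary.star_mem (evolution_mem_unitary (hHRc B) (hHRsa B) r))
    rw [eB₂, Finset.mul_sum, Finset.sum_mul, Finset.sum_mul, Finset.mul_sum,
      ← Finset.sum_sub_distrib]
    refine (norm_sum_le _ _).trans (Finset.sum_le_sum fun k hk => ?_)
    have hkI : k ∈ I := (Finset.mem_filter.1 hk).1
    have hk1 := hnorm k hkI r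
    have hi1 := hnorm i hiI s
    have hk0 := hφ k
    have triv : ‖u * Φ k r * star u * Φ i s - Φ i s * (u * Φ k r * star u)‖ ≤
        2 * φ k * φ i * 1 := by
      refine (norm_commutator_le _ _).trans ?_
      rw [norm_conj_unitary huu, mul_one]
      gcongr
    by_cases hd : Disjoint (S k) (S i)
    · rw [hρ i k hd, mul_min_of_nonneg _ _ (by have := hφ i; positivity)]
      refine le_min triv ?_
      refine (lieb_robinson_two_time (J := I.filter fun i => S i ⊆ B) (Φ := Φ) hcomm
        (fun i hi => hmem i (Finset.mem_filter.1 hi).1)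
        (fun i hi => hcont i (Finset.mem_filter.1 hi).1)
        (fun i hi => hsa i (Finset.mem_filter.1 hi).1) hφ
        (fun i hi => hnorm i (Finset.mem_filter.1 hi).1) hh hM0 hK0 (fun x y => ?_) hK hd
        (hmem k hkI r) (hmem i hiI s) hr (u := u) ?_).trans ?_
      · refine le_trans (Finset.sum_le_sum_of_subset_of_nonneg ?_ fun i _ _ => hφ i) (hM x y)
        exact Finset.filter_subset_filter _ (Finset.filter_subset _ _)
      · rw [hu, funext (hHR B)]
      · have hT : 0 ≤ ∑ x ∈ S k, ∑ y ∈ S i, h x y :=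
          Finset.sum_nonneg fun x _ => Finset.sum_nonneg fun y _ => hh x y
        have h0 : 0 ≤ (Real.exp (2 * M * K * |s|) - 1) / K := by
          refine div_nonneg ?_ hK0.le
          have := Real.add_one_le_exp (2 * M * K * |s|)
          have : 0 ≤ 2 * M * K * |s| := by positivity
          linarith
        have := hφ i
        gcongr
    · rw [hρ1 i k hd]
      exact triv
  · -- terms supported in `A` or in `C` commute with the dynamics in `B`
    have hcB : ∀ r, Commute (evolution (HR B) r) (Φ i s) ∧ Commute (evolution H₂ r) (Φ i s) := by
      have hdis : Disjoint B (S i) := by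
        rcases not_and_or.1 hcross with h1 | h1
        · exact (hAB.symm).mono_right (not_not.1 h1)
        · exact hBC.mono_right (not_not.1 h1)
      have hR : ∀ R ⊆ B, ∀ r, Commute (HR R r) (Φ i s) := by
        intro R hR r
        rw [hHR]
        refine Commute.sum_left _ _ _ fun k hk => ?_
        obtain ⟨hk1, hk2⟩ := Finset.mem_filter.1 hk
        exact hcomm _ _ (hdis.mono_left (hk2.trans hR)) _ (hmem k hk1 r) _ (hmem i hiI s)
      exact fun r => ⟨commute_evolution (hHRc B) (hHRsa B) (hR B subset_rfl) r,
        commute_evolution hH₂c hH₂sa (fun r => (hR A' hA' r).add_left (hR C' hC' r)) r⟩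
    have hstar : Commute (star (evolution H₂ s)) (Φ i s) := by
      have := (hcB s).2.star_star
      rwa [(hsa i hiI s).star_eq] at this
    have : Commute W (Φ i s) := (hcB s).1.mul_left hstar
    rw [this.eq, sub_self, norm_zero]

end Gluing

/-! ### Observables on disjoint regions commute -/

section Locality

variable {Λ : Type*} [Fintype Λ] [LinearOrder Λ]
variable {κ : Λ → Type*} [∀ j, Fintype (κ j)] [∀ j, DecidableEq (κ j)]

theorem siteOp_mul_siteOp_apply {x y : Λ} (hxy : x ≠ y) (E : Matrix (κ x) (κ x) ℂ)
    (F : Matrix (κ y) (κ y) ℂ) (σ τ : ∀ j, κ j) :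
    (siteOp x E * siteOp y F : Op κ) σ τ =
      if ∀ i, i ≠ x → i ≠ y → σ i = τ i then E (σ x) (τ x) * F (σ y) (τ y) else 0 := by
  rw [Matrix.mul_apply, Finset.sum_eq_single (Function.update σ x (τ x))]
  · have h1 : ∀ i, i ≠ x → σ i = Function.update σ x (τ x) i := fun i hi => by
      rw [Function.update_of_ne hi]
    simp only [siteOp, Matrix.of_apply]
    rw [if_pos h1, Function.update_self, Function.update_of_ne hxy.symm]
    have h2 : (∀ i, i ≠ y → Function.update σ x (τ x) i = τ i) ↔
        ∀ i, i ≠ x → i ≠ y → σ i = τ i := by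
      constructor
      · intro h i hx hy
        rw [← h i hy, Function.update_of_ne hx]
      · intro h i hy
        by_cases hx : i = x
        · subst hx; simp
        · rw [Function.update_of_ne hx, h i hx hy]
    simp only [h2, mul_ite, mul_zero]
  · intro ρ _ hρ
    simp only [siteOp, Matrix.of_apply]
    by_contra hne
    apply hρ
    have h1 : ∀ i, i ≠ x → σ i = ρ i := by
      by_contra h; exact hne (by rw [if_neg h, zero_mul])
    have h2 : ∀ i, i ≠ y → ρ i = τ i := by
      by_contra h; exact hne (by rw [if_neg h, mul_zero])
    funext i
    by_cases hx : i = x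
    · subst hx; simp [h2 i hxy]
    · rw [Function.update_of_ne hx, h1 i hx]
  · intro h; exact absurd (Finset.mem_univ _) h

theorem commute_siteOp {x y : Λ} (hxy : x ≠ y) (E : Matrix (κ x) (κ x) ℂ)
    (F : Matrix (κ y) (κ y) ℂ) : Commute (siteOp x E : Op κ) (siteOp y F) := by
  ext σ τ
  rw [siteOp_mul_siteOp_apply hxy, siteOp_mul_siteOp_apply hxy.symm]
  have : (∀ i, i ≠ x → i ≠ y → σ i = τ i) ↔ (∀ i, i ≠ y → i ≠ x → σ i = τ i) :=
    ⟨fun h i a b => h i b a, fun h i a b => h i b a⟩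
  simp only [this, mul_comm]

variable (p : ∀ j, κ j → ℤˣ)

theorem commute_parityOp (X Y : Finset Λ) : Commute (parityOp p X) (parityOp p Y) := by
  simp [Commute, SemiconjBy, parityOp, Matrix.diagonal_mul_diagonal, mul_comm]

theorem parityOp_mul_self (X : Finset Λ) : parityOp p X * parityOp p X = 1 := by
  rw [parityOp, Matrix.diagonal_mul_diagonal, ← Matrix.diagonal_one]
  congr 1
  funext σ
  rw [← Finset.prod_mul_distrib]
  refine Finset.prod_eq_one fun i _ => ?_
  rcases Int.units_eq_one_or (p i (σ i)) with h | h <;> simp [h]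

/-- A site operator whose matrix changes the parity of its site by the sign `ε` is multiplied by
`ε` when moved through the parity of a region containing that site, and commutes with it
otherwise. -/
theorem parityOp_mul_siteOp {x : Λ} {E : Matrix (κ x) (κ x) ℂ} {ε : ℤˣ}
    (hE : ∀ s s', E s s' ≠ 0 → p x s = ε * p x s') (X : Finset Λ) :
    parityOp p X * siteOp x E =
      (if x ∈ X then (((ε : ℤˣ) : ℤ) : ℂ) else 1) • (siteOp x E * parityOp p X : Op κ) := by
  ext σ τ
  rw [parityOp, Matrix.smul_apply, Matrix.diagonal_mul, Matrix.mul_diagonal]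
  simp only [siteOp, Matrix.of_apply]
  by_cases h : ∀ i, i ≠ x → σ i = τ i
  · rw [if_pos h]
    by_cases hz : E (σ x) (τ x) = 0
    · simp [hz]
    have hp := hE _ _ hz
    have hoff : ∀ Z : Finset Λ, x ∉ Z → ∏ i ∈ Z, (((p i (σ i) : ℤˣ) : ℤ) : ℂ) =
        ∏ i ∈ Z, (((p i (τ i) : ℤˣ) : ℤ) : ℂ) := fun Z hZ =>
      Finset.prod_congr rfl fun i hi => by rw [h i (fun e => hZ (e ▸ hi))]
    split_ifs with hx
    · rw [← Finset.mul_prod_erase _ _ hx, ← Finset.mul_prod_erase _ _ hx,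
        hoff _ (Finset.notMem_erase x X), hp]
      push_cast
      simp only [smul_eq_mul]
      ring
    · rw [hoff _ hx]
      simp [mul_comm]
  · simp [h]

/-- The operators of parity `ε` at the site `x`: `siteOp x E`, with a Jordan–Wigner string if `ε` is
odd. -/
def IsSiteGenerator (x : Λ) (ε : ℤˣ) (O : Op κ) : Prop :=
  ∃ E : Matrix (κ x) (κ x) ℂ, (∀ s s', E s s' ≠ 0 → p x s = ε * p x s') ∧
    O = (if ε = 1 then 1 else parityOp p (Finset.univ.filter fun i => i < x)) * siteOp x E

variable {p}

theorem exists_isSiteGenerator {x : Λ} {O : Op κ} (hO : O ∈ siteGenerators p x) :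
    ∃ ε, IsSiteGenerator p x ε O := by
  rcases hO with ⟨E, hE, rfl⟩ | ⟨E, hE, rfl⟩
  · exact ⟨1, E, fun s s' h => by rw [one_mul]; exact hE s s' h, by simp⟩
  · refine ⟨-1, E, fun s s' h => by rw [neg_one_mul]; exact hE s s' h, ?_⟩
    rw [if_neg (by decide)]

theorem IsSiteGenerator.parityOp_univ_mul {x : Λ} {ε : ℤˣ} {O : Op κ}
    (hO : IsSiteGenerator p x ε O) :
    parityOp p Finset.univ * O = (((ε : ℤˣ) : ℤ) : ℂ) • (O * parityOp p Finset.univ) := by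
  obtain ⟨E, hE, rfl⟩ := hO
  have h := parityOp_mul_siteOp p hE Finset.univ
  rw [if_pos (Finset.mem_univ x)] at h
  have hc : ∀ Q : Op κ, Commute (parityOp p Finset.univ) Q →
      parityOp p Finset.univ * (Q * siteOp x E) =
        (((ε : ℤˣ) : ℤ) : ℂ) • ((Q * siteOp x E) * parityOp p Finset.univ) := by
    intro Q hQ
    rw [← mul_assoc, hQ.eq, mul_assoc, h, mul_smul_comm, mul_assoc]
  split_ifs with he
  · exact hc _ (Commute.one_right _)
  · exact hc _ (commute_parityOp p _ _)

theorem commute_parityOp_siteOp_of_even {x : Λ} {E : Matrix (κ x) (κ x) ℂ}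
    (hE : ∀ s s', E s s' ≠ 0 → p x s = 1 * p x s') (X : Finset Λ) :
    Commute (parityOp p X) (siteOp x E : Op κ) := by
  have h := parityOp_mul_siteOp p hE X
  simpa [Commute, SemiconjBy] using h

theorem anticommute_of_lt {x y : Λ} (hxy : x < y) {E : Matrix (κ x) (κ x) ℂ}
    {F : Matrix (κ y) (κ y) ℂ} (hE : ∀ s s', E s s' ≠ 0 → p x s = -1 * p x s')
    (hF : ∀ s s', F s s' ≠ 0 → p y s = -1 * p y s') {P Q : Op κ}
    (hP : P = parityOp p (Finset.univ.filter fun i => i < x))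
    (hQ : Q = parityOp p (Finset.univ.filter fun i => i < y)) :
    P * siteOp x E * (Q * siteOp y F) = -(Q * siteOp y F * (P * siteOp x E)) := by
  have h1 : Q * siteOp x E = -(siteOp x E * Q) := by
    have := parityOp_mul_siteOp p hE (Finset.univ.filter fun i => i < y)
    rw [if_pos (by simpa using hxy), ← hQ] at this
    simpa using this
  have h2 : P * siteOp y F = siteOp y F * P := by
    have := parityOp_mul_siteOp p hF (Finset.univ.filter fun i => i < x)
    rw [if_neg (by simpa using hxy.le), ← hP, one_smul] at this
    exact this
  have h3 : (siteOp x E : Op κ) * siteOp y F = siteOp y F * siteOp x E :=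
    (commute_siteOp hxy.ne E F).eq
  have h4 : P * Q = Q * P := by rw [hP, hQ]; exact (commute_parityOp p _ _).eq
  have h1' : (siteOp x E : Op κ) * Q = -(Q * siteOp x E) := by rw [h1, neg_neg]
  calc P * siteOp x E * (Q * siteOp y F) = P * (siteOp x E * Q) * siteOp y F := by noncomm_ring
    _ = -(P * Q * (siteOp x E * siteOp y F)) := by rw [h1']; noncomm_ring
    _ = -(Q * (P * siteOp y F) * siteOp x E) := by rw [h3, h4]; noncomm_ring
    _ = _ := by rw [h2]; noncomm_ring

/-- Generators at different sites commute, unless both are odd, in which case they anticommute: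
moving `O` through `O'` conjugates it with the total parity whenever `O'` is odd. -/
theorem IsSiteGenerator.mul_eq {x y : Λ} (hxy : x ≠ y) {ε ε' : ℤˣ} {O O' : Op κ}
    (hO : IsSiteGenerator p x ε O) (hO' : IsSiteGenerator p y ε' O') :
    O * O' = (if ε = -1 ∧ ε' = -1 then -1 else 1 : ℂ) • (O' * O) := by
  obtain ⟨E, hE, rfl⟩ := hO
  obtain ⟨F, hF, rfl⟩ := hO'
  have hne : (-1 : ℤˣ) ≠ 1 := by decide
  have hs := commute_siteOp hxy E F
  rcases Int.units_eq_one_or ε with rfl | rfl <;> rcases Int.units_eq_one_or ε' with rfl | rfl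
  · simpa [hne.symm] using hs.eq
  · rw [if_pos rfl, if_neg hne, if_neg (fun h => hne h.1.symm), one_mul, one_smul]
    exact ((commute_parityOp_siteOp_of_even hE _).symm.mul_right hs).eq
  · rw [if_pos rfl, if_neg hne, if_neg (fun h => hne h.2.symm), one_mul, one_smul]
    exact ((commute_parityOp_siteOp_of_even hF _).mul_left hs).eq
  · rw [if_neg hne, if_neg hne, if_pos ⟨rfl, rfl⟩, neg_one_smul]
    rcases lt_or_gt_of_ne hxy with h | h
    · exact anticommute_of_lt h hE hF rfl rfl
    · rw [anticommute_of_lt h hF hE rfl rfl, neg_neg]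

/-- Moving an element of the algebra generated by `X` through a generator outside `X`: an odd
generator conjugates it by the total parity. -/
theorem adjoin_mul_generator {X : Finset Λ} {y : Λ} (hy : y ∉ X) {ε : ℤˣ} {g : Op κ}
    (hg : IsSiteGenerator p y ε g) {O : Op κ}
    (hO : O ∈ Algebra.adjoin ℂ (⋃ j ∈ X, siteGenerators p j)) :
    O * g = g * (if ε = -1 then parityOp p Finset.univ * O * parityOp p Finset.univ else O) := by
  have hne : (-1 : ℤˣ) ≠ 1 := by decide
  have hPP := parityOp_mul_self p Finset.univ
  set P := parityOp p Finset.univ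
  induction hO using Algebra.adjoin_induction with
  | mem O hO =>
    simp only [Set.mem_iUnion] at hO
    obtain ⟨x, hx, hO⟩ := hO
    obtain ⟨η, hO⟩ := exists_isSiteGenerator hO
    have h1 := hO.mul_eq (fun e : x = y => hy (e ▸ hx)) hg
    have h2 := hO.parityOp_univ_mul
    split_ifs with he
    · rw [h1, h2, smul_mul_assoc, mul_assoc, hPP, mul_one, mul_smul_comm]
      rcases Int.units_eq_one_or η with rfl | rfl <;> simp [he]
    · rw [h1, if_neg (fun h => he h.2), one_smul]
  | algebraMap r =>
    rw [Algebra.algebraMap_eq_smul_one]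
    split_ifs <;> simp [hPP]
  | add a b _ _ iha ihb =>
    rw [add_mul, iha, ihb, ← mul_add]
    split_ifs
    · noncomm_ring
    · rfl
  | mul a b _ _ iha ihb =>
    rw [mul_assoc, ihb, ← mul_assoc, iha, mul_assoc]
    split_ifs
    · congr 1
      calc P * a * P * (P * b * P) = P * a * (P * P) * b * P := by noncomm_ring
        _ = _ := by rw [hPP]; noncomm_ring
    · rfl

/-- Even observables on disjoint regions commute. -/
theorem commute_of_disjoint {X Y : Finset Λ} (hXY : Disjoint X Y) {a b : Op κ}
    (ha : a ∈ localAlgebra p X) (hb : b ∈ localAlgebra p Y) : Commute a b := by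
  have ha2 : parityOp p Finset.univ * a * parityOp p Finset.univ = a := by
    have := (Subalgebra.mem_centralizer_iff ℂ).1 ha.2 _ rfl
    rw [this, mul_assoc, parityOp_mul_self, mul_one]
  have hb1 : b ∈ Algebra.adjoin ℂ (⋃ j ∈ Y, siteGenerators p j) := hb.1
  have hc : ∀ g ∈ ⋃ j ∈ Y, siteGenerators p j, Commute a g := by
    intro g hg
    simp only [Set.mem_iUnion] at hg
    obtain ⟨y, hy, hg⟩ := hg
    obtain ⟨ε, hg⟩ := exists_isSiteGenerator hg
    have := adjoin_mul_generator (Finset.disjoint_right.1 hXY hy) hg ha.1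
    rw [ha2, ite_self] at this
    exact this
  clear hb
  induction hb1 using Algebra.adjoin_induction with
  | mem g hg => exact hc g hg
  | algebraMap r => exact (Algebra.commutes r a).symm
  | add u v _ _ hu hv => exact hu.add_right hv
  | mul u v _ _ hu hv => exact hu.mul_right hv

theorem localAlgebra_mono {X Y : Finset Λ} (h : X ⊆ Y) :
    localAlgebra p X ≤ localAlgebra p Y :=
  inf_le_inf_right _ (Algebra.adjoin_mono (Set.biUnion_subset_biUnion_left h))

theorem isClosed_localAlgebra (X : Finset Λ) :
    IsClosed (localAlgebra p X : Set (Op κ)) :=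
  Submodule.closed_of_finiteDimensional (Subalgebra.toSubmodule (localAlgebra p X))

end Locality

/-! ### Balls, collars and counting -/

section Counting

set_option linter.unusedSectionVars false

/-- The bound `2C f(n-1)` on the norm of the part of an interaction on a ball of radius `n`. -/
def termBound (C : ℝ≥0) (f : ℝ≥0 → ℝ≥0) (n : ℕ) : ℝ≥0 := 2 * C * f ((n : ℝ≥0) - 1)

variable {Λ : Type*} [Fintype Λ] [LinearOrder Λ] {G : SimpleGraph Λ}

theorem mem_latBall {n : ℕ} {j k : Λ} : k ∈ latBall G n j ↔ G.dist k j < n := by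
  simp [latBall]

theorem mem_latBall_comm {n : ℕ} {j k : Λ} : k ∈ latBall G n j ↔ j ∈ latBall G n k := by
  rw [mem_latBall, mem_latBall, SimpleGraph.dist_comm]

theorem latBall_nonempty {n : ℕ} (hn : 1 ≤ n) (j : Λ) : (latBall G n j).Nonempty :=
  ⟨j, by rw [mem_latBall, SimpleGraph.dist_self]; exact hn⟩

variable {D : ℕ} {V : ℝ≥0}

theorem IsLattice.card_le' (hG : IsLattice G D V) (x : Λ) {n : ℕ} (hn : 1 ≤ n) :
    ((Finset.univ.filter fun y => G.dist x y ≤ n).card : ℝ≥0∞) ≤ V * (n : ℝ≥0∞) ^ D := by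
  exact_mod_cast hG.card_le x n hn

theorem IsLattice.card_latBall_le (hG : IsLattice G D V) (x : Λ) {n : ℕ} (hn : 1 ≤ n) :
    ((latBall G n x).card : ℝ≥0∞) ≤ V * (n : ℝ≥0∞) ^ D := by
  refine le_trans ?_ (hG.card_le' x hn)
  gcongr
  intro k hk
  rw [Finset.mem_filter, SimpleGraph.dist_comm]
  exact ⟨Finset.mem_univ _, (mem_latBall.1 hk).le⟩

theorem IsLattice.card_sphere_le (hG : IsLattice G D V) (x : Λ) (d : ℕ) :
    ((Finset.univ.filter fun y => G.dist x y = d).card : ℝ≥0∞) ≤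
      ((V * (max (d : ℝ≥0) 1) ^ D : ℝ≥0) : ℝ≥0∞) := by
  have h := hG.card_le x (max d 1) (le_max_right _ _)
  push_cast at h
  refine le_trans ?_ (ENNReal.coe_le_coe.2 h)
  rw [ENNReal.coe_natCast]
  gcongr
  exact fun (hk : _ = d) => hk.le.trans (le_max_left _ _)

/-- Sums over sites grouped by the distance to `x`. -/
theorem IsLattice.sum_dist_le (hG : IsLattice G D V) (x : Λ) (q : ℕ → Prop) [DecidablePred q]
    (T : ℕ → ℝ≥0∞) :
    ∑ k with q (G.dist x k), T (G.dist x k) ≤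
      ∑' d : ℕ, if q d then ((V * (max (d : ℝ≥0) 1) ^ D : ℝ≥0) : ℝ≥0∞) * T d else 0 := by
  rw [Finset.sum_filter]
  have h1 : ∀ k : Λ, (if q (G.dist x k) then T (G.dist x k) else 0) =
      ∑' d : ℕ, if G.dist x k = d then (if q d then T d else 0) else 0 := fun k => by
    rw [tsum_eq_single (G.dist x k)]
    · simp
    · intro d hd
      rw [if_neg hd.symm]
  simp_rw [h1]
  rw [← Summable.tsum_finsetSum fun _ _ => ENNReal.summable]
  refine ENNReal.tsum_le_tsum fun d => ?_
  rw [← Finset.sum_filter, Finset.sum_const, nsmul_eq_mul]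
  split_ifs
  · gcongr
    exact hG.card_sphere_le x d
  · simp

theorem setDist_le {A C : Finset Λ} {a c : Λ} (ha : a ∈ A) (hc : c ∈ C) :
    setDist G A C ≤ G.dist a c :=
  Nat.sInf_le ⟨a, ha, c, hc, rfl⟩

theorem exists_dist_eq_setDist {A C : Finset Λ} (hA : A.Nonempty) (hC : C.Nonempty) :
    ∃ a ∈ A, ∃ c ∈ C, G.dist a c = setDist G A C := by
  obtain ⟨a, ha⟩ := hA
  obtain ⟨c, hc⟩ := hC
  exact Nat.sInf_mem (s := {n | ∃ a ∈ A, ∃ c ∈ C, G.dist a c = n}) ⟨_, a, ha, c, hc, rfl⟩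

theorem collar_subset (A B : Finset Λ) (w : ℕ) : collar G A B w ⊆ B := Finset.filter_subset _ _

/-- A site of `B` outside the collar of `A` is at distance at least `w/3` from `A`. -/
theorem le_dist_of_notMem_collar {A B : Finset Λ} {w : ℕ} {y a : Λ} (hy : y ∈ B)
    (hyc : y ∉ collar G A B w) (ha : a ∈ A) : w ≤ 3 * G.dist y a := by
  have h1 : ¬ (setDist G {y} A : ℝ≥0) < (w : ℝ≥0) / 3 := fun h =>
    hyc (Finset.mem_filter.2 ⟨hy, h⟩)
  have h2 : setDist G {y} A ≤ G.dist y a := setDist_le (Finset.mem_singleton_self y) ha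
  rw [not_lt, div_le_iff₀ (by norm_num)] at h1
  have h3 : (w : ℝ≥0) ≤ (setDist G {y} A * 3 : ℕ) := by push_cast; exact h1
  have h4 : w ≤ setDist G {y} A * 3 := by exact_mod_cast h3
  omega

theorem exists_of_mem_collar {A B : Finset Λ} {w : ℕ} (hA : A.Nonempty) {y : Λ}
    (hy : y ∈ collar G A B w) : ∃ a ∈ A, 3 * G.dist y a < w := by
  have h1 := (Finset.mem_filter.1 hy).2
  obtain ⟨y', hy', a, ha, h⟩ :=
    exists_dist_eq_setDist (G := G) (Finset.singleton_nonempty y) hA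
  rw [Finset.mem_singleton] at hy'
  subst hy'
  refine ⟨a, ha, ?_⟩
  rw [← h, lt_div_iff₀ (by norm_num)] at h1
  have h3 : ((G.dist y' a * 3 : ℕ) : ℝ≥0) < w := by push_cast; exact h1
  have h4 : G.dist y' a * 3 < w := by exact_mod_cast h3
  omega

theorem disjoint_collar (hG : G.Connected) {A B C : Finset Λ} (hA : A.Nonempty)
    (hC : C.Nonempty) :
    Disjoint (collar G A B (setDist G A C)) (collar G C B (setDist G A C)) := by
  rw [Finset.disjoint_left]
  intro y h1 h2
  obtain ⟨a, ha, h3⟩ := exists_of_mem_collar hA h1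
  obtain ⟨c, hc, h4⟩ := exists_of_mem_collar hC h2
  have h5 := setDist_le (G := G) ha hc
  have h6 := hG.dist_triangle (u := a) (v := y) (w := c)
  rw [SimpleGraph.dist_comm (u := a) (v := y)] at h6
  omega

/-- Balls are connected: two sites of a ball are joined by a path inside it. -/
theorem exists_walk_latBall (hG : G.Connected) {n : ℕ} {j a c : Λ} (ha : a ∈ latBall G n j)
    (hc : c ∈ latBall G n j) : ∃ q : G.Walk a c, ∀ v ∈ q.support, v ∈ latBall G n j := by
  have key : ∀ a ∈ latBall G n j, ∃ q : G.Walk a j, ∀ v ∈ q.support, v ∈ latBall G n j := by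
    intro a ha
    obtain ⟨q, hq⟩ := hG.exists_walk_length_eq_dist a j
    refine ⟨q, fun v hv => ?_⟩
    rw [mem_latBall] at ha ⊢
    have h1 := SimpleGraph.dist_le (q.dropUntil v hv)
    have h2 := q.length_dropUntil_le_length hv
    omega
  obtain ⟨q₁, h₁⟩ := key a ha
  obtain ⟨q₂, h₂⟩ := key c hc
  refine ⟨q₁.append q₂.reverse, fun v hv => ?_⟩
  rw [SimpleGraph.Walk.mem_support_append_iff] at hv
  rcases hv with h | h
  · exact h₁ v h
  · exact h₂ v (by simpa using h)

/-- A ball in `A' ∪ A` that lies neither in `A` nor in `A'` contains a site of `A'` adjacent to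
`A`. -/
theorem exists_boundary_site (hG : G.Connected) {n : ℕ} {j : Λ} {A A' : Finset Λ}
    (hsub : latBall G n j ⊆ A' ∪ A) (h1 : ¬ latBall G n j ⊆ A) (h2 : ¬ latBall G n j ⊆ A') :
    ∃ x ∈ A', x ∈ latBall G n j ∧ ∃ a ∈ A, G.dist x a ≤ 1 := by
  obtain ⟨y, hy, hyA⟩ := Finset.not_subset.1 h1
  obtain ⟨a, ha, haA⟩ := Finset.not_subset.1 h2
  have haA : a ∈ A := (Finset.mem_union.1 (hsub ha)).resolve_left haA
  obtain ⟨q, hq⟩ := exists_walk_latBall hG ha hy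
  obtain ⟨d, hd, hd1, hd2⟩ := q.exists_boundary_dart (A : Set Λ) haA hyA
  have hd2b := hq _ (q.dart_snd_mem_support_of_mem_darts hd)
  refine ⟨d.snd, (Finset.mem_union.1 (hsub hd2b)).resolve_right hd2, hd2b, d.fst, hd1, ?_⟩
  rw [SimpleGraph.dist_eq_one_iff_adj.2 d.adj.symm]

variable {A B C : Finset Λ}

/-- A ball that fits into none of the three pieces is large. -/
theorem IsShieldedPartition.lt_of_not_subset (hP : IsShieldedPartition G A B C)
    (hG : G.Connected) {n : ℕ} {j : Λ} (h1 : ¬ latBall G n j ⊆ B)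
    (h2 : ¬ latBall G n j ⊆ C ∪ collar G C B (setDist G A C))
    (h3 : ¬ latBall G n j ⊆ collar G A B (setDist G A C) ∪ A) : setDist G A C < 6 * n := by
  have hcov : ∀ y, y ∈ A ∨ y ∈ B ∨ y ∈ C := fun y => by
    have := Finset.mem_univ y
    rw [← hP.union_eq, Finset.mem_union, Finset.mem_union] at this
    tauto
  have tri : ∀ a ∈ latBall G n j, ∀ y ∈ latBall G n j, G.dist y a < 2 * n := by
    intro a ha y hy
    rw [mem_latBall] at ha hy
    have := hG.dist_triangle (u := y) (v := j) (w := a)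
    rw [SimpleGraph.dist_comm (u := j) (v := a)] at this
    omega
  obtain ⟨x, hx, hxB⟩ := Finset.not_subset.1 h1
  have hAC : ∀ a ∈ A, ∀ c ∈ C, setDist G A C ≤ G.dist c a := fun a ha c hc => by
    rw [SimpleGraph.dist_comm]; exact setDist_le ha hc
  rcases hcov x with hxA | hxB' | hxC
  · obtain ⟨y, hy, hyn⟩ := Finset.not_subset.1 h3
    rw [Finset.mem_union, not_or] at hyn
    have := tri x hx y hy
    rcases hcov y with h | h | h
    · exact absurd h hyn.2
    · have := le_dist_of_notMem_collar h hyn.1 hxA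
      omega
    · have := hAC x hxA y h
      omega
  · exact absurd hxB' hxB
  · obtain ⟨y, hy, hyn⟩ := Finset.not_subset.1 h2
    rw [Finset.mem_union, not_or] at hyn
    have := tri x hx y hy
    rcases hcov y with h | h | h
    · have h' := hAC y h x hxC
      rw [SimpleGraph.dist_comm] at h'
      omega
    · have := le_dist_of_notMem_collar h hyn.2 hxC
      omega
    · exact absurd h hyn.1

/-- A ball that fits into neither `A` nor `C` meets `B`. -/
theorem IsShieldedPartition.exists_mem_latBall (hP : IsShieldedPartition G A B C)
    (hG : G.Connected) {n : ℕ} {j : Λ} (h1 : ¬ latBall G n j ⊆ A) (h2 : ¬ latBall G n j ⊆ C) :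
    ∃ b ∈ B, b ∈ latBall G n j := by
  by_contra hno
  push Not at hno
  have hcov : ∀ y ∈ latBall G n j, y ∈ A ∨ y ∈ C := fun y hy => by
    have := Finset.mem_univ y
    rw [← hP.union_eq, Finset.mem_union, Finset.mem_union] at this
    have := hno y
    tauto
  obtain ⟨c, hc, hcA⟩ := Finset.not_subset.1 h1
  obtain ⟨a, ha, haC⟩ := Finset.not_subset.1 h2
  obtain ⟨q, hq⟩ := exists_walk_latBall hG ha hc
  obtain ⟨v, hv, hvB⟩ := hP.shields a ((hcov a ha).resolve_right haC) c
    ((hcov c hc).resolve_left hcA) q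
  exact hno v hvB (hq v hv)

/-- The total strength of the terms that fit into none of the three pieces. -/
theorem IsShieldedPartition.sum_bad_le (hP : IsShieldedPartition G A B C) (hG : IsLattice G D V)
    (C₀ : ℝ≥0) (f : ℝ≥0 → ℝ≥0) (N : ℕ) :
    ∑ i ∈ (Finset.univ : Finset Λ) ×ˢ Finset.Icc 1 N with ¬ latBall G i.2 i.1 ⊆ B ∧
        ¬ latBall G i.2 i.1 ⊆ C ∪ collar G C B (setDist G A C) ∧
        ¬ latBall G i.2 i.1 ⊆ collar G A B (setDist G A C) ∪ A,
      (termBound C₀ f i.2 : ℝ≥0∞) ≤ B.card * fDelta D V C₀ f ((setDist G A C : ℝ≥0) / 3) := by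
  rw [Finset.sum_filter, Finset.sum_product_right, fDelta, ← ENNReal.tsum_mul_left]
  refine le_trans (Finset.sum_le_sum fun n hn => ?_) (ENNReal.sum_le_tsum (Finset.Icc 1 N))
  have hn1 : 1 ≤ n := (Finset.mem_Icc.1 hn).1
  have step : ∀ j : Λ, (if ¬ latBall G n j ⊆ B ∧
        ¬ latBall G n j ⊆ C ∪ collar G C B (setDist G A C) ∧
        ¬ latBall G n j ⊆ collar G A B (setDist G A C) ∪ A then (termBound C₀ f n : ℝ≥0∞) else 0) ≤
      ∑ b ∈ B, if (setDist G A C : ℝ≥0) / 3 / 2 < n then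
        (if j ∈ latBall G n b then (termBound C₀ f n : ℝ≥0∞) else 0) else 0 := by
    intro j
    by_cases h : ¬ latBall G n j ⊆ B ∧
        ¬ latBall G n j ⊆ C ∪ collar G C B (setDist G A C) ∧
        ¬ latBall G n j ⊆ collar G A B (setDist G A C) ∪ A
    · rw [if_pos h]
      obtain ⟨b, hb, hbj⟩ := hP.exists_mem_latBall hG.connected
        (fun h' => h.2.2 (h'.trans Finset.subset_union_right))
        (fun h' => h.2.1 (h'.trans Finset.subset_union_left))
      have hlt := hP.lt_of_not_subset hG.connected h.1 h.2.1 h.2.2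
      have hlt' : (setDist G A C : ℝ≥0) / 3 / 2 < n := by
        rw [div_lt_iff₀ (by norm_num), div_lt_iff₀ (by norm_num)]
        have : (setDist G A C : ℝ≥0) < ((6 * n : ℕ) : ℝ≥0) := by exact_mod_cast hlt
        push_cast at this
        linarith
      refine le_trans ?_ (Finset.single_le_sum (fun _ _ => zero_le) hb)
      rw [if_pos hlt', if_pos (mem_latBall_comm.1 hbj)]
    · rw [if_neg h]; exact zero_le
  refine (Finset.sum_le_sum fun j _ => step j).trans ?_
  rw [Finset.sum_comm]
  split_ifs with h
  · refine (Finset.sum_le_card_nsmul B _ (((n : ℝ≥0) ^ D * V * 2 * C₀ * f ((n : ℝ≥0) - 1) : ℝ≥0) :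
      ℝ≥0∞) fun b _ => ?_).trans (by rw [nsmul_eq_mul])
    rw [Finset.sum_ite_mem, Finset.univ_inter, Finset.sum_const, nsmul_eq_mul]
    calc ((latBall G n b).card : ℝ≥0∞) * (termBound C₀ f n : ℝ≥0∞)
        ≤ (V * (n : ℝ≥0∞) ^ D) * (termBound C₀ f n : ℝ≥0∞) := by
          gcongr; exact hG.card_latBall_le b hn1
      _ = _ := by rw [termBound]; push_cast; ring
  · simp

/-- The strength of the terms whose ball contains `x`, the ball of radius `n` around a site being
replaced by the ball of radius `2n` around `x`. -/
theorem sum_mem_latBall_le (hG : IsLattice G D V) (C₀ : ℝ≥0) (f : ℝ≥0 → ℝ≥0) (N : ℕ) (x : Λ)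
    (q : ℕ → Prop) [DecidablePred q] :
    ∑ i ∈ (Finset.univ : Finset Λ) ×ˢ Finset.Icc 1 N with x ∈ latBall G i.2 i.1,
      (if q (2 * i.2) then (termBound C₀ f i.2 : ℝ≥0∞) else 0) ≤
    ∑' n : ℕ, if q n then
      ((V * ((n : ℝ≥0) / 2) ^ D * 2 * C₀ * f ((n : ℝ≥0) / 2 - 1) : ℝ≥0) : ℝ≥0∞) else 0 := by
  rw [Finset.sum_filter, Finset.sum_product_right]
  refine le_trans ?_ (ENNReal.tsum_comp_le_tsum_of_injective
    (f := fun n : ℕ => 2 * n) (mul_right_injective₀ two_ne_zero) _)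
  refine le_trans (Finset.sum_le_sum fun n hn => ?_) (ENNReal.sum_le_tsum (Finset.Icc 1 N))
  have hn1 : 1 ≤ n := (Finset.mem_Icc.1 hn).1
  have e2 : ((2 * n : ℕ) : ℝ≥0) / 2 = n := by push_cast; field_simp
  rw [e2]
  simp_rw [mem_latBall_comm (k := x)]
  rw [Finset.sum_ite_mem, Finset.univ_inter, Finset.sum_const, nsmul_eq_mul]
  split_ifs
  · calc ((latBall G n x).card : ℝ≥0∞) * (termBound C₀ f n : ℝ≥0∞)
        ≤ (V * (n : ℝ≥0∞) ^ D) * (termBound C₀ f n : ℝ≥0∞) := by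
          gcongr; exact hG.card_latBall_le x hn1
      _ = _ := by rw [termBound]; push_cast; ring
  · simp

theorem sum_mem_latBall_le_cBdry (hG : IsLattice G D V) (C₀ : ℝ≥0) (f : ℝ≥0 → ℝ≥0) (N : ℕ)
    (x : Λ) : ∑ i ∈ (Finset.univ : Finset Λ) ×ˢ Finset.Icc 1 N with x ∈ latBall G i.2 i.1,
      (termBound C₀ f i.2 : ℝ≥0∞) ≤ cBdry D V C₀ f := by
  refine le_trans (le_of_eq ?_) (sum_mem_latBall_le hG C₀ f N x fun n => 1 ≤ n)
  refine Finset.sum_congr rfl fun i hi => ?_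
  have := (Finset.mem_Icc.1 (Finset.mem_product.1 (Finset.mem_filter.1 hi).1).2).1
  rw [if_pos (by omega)]

/-- The weight of the commutator of the evolved term at `k` with the term at `i`: the minimum of
the trivial and the Lieb–Robinson bound. -/
def commWeight (G : SimpleGraph Λ) (h : ℝ≥0 → ℝ≥0) (l : ℝ≥0) (i k : Λ × ℕ) : ℝ≥0 :=
  if Disjoint (latBall G k.2 k.1) (latBall G i.2 i.1) then
    min 1 (l * ∑ x ∈ latBall G k.2 k.1, ∑ y ∈ latBall G i.2 i.1, h (G.dist x y)) else 1

theorem commWeight_le_one (h : ℝ≥0 → ℝ≥0) (l : ℝ≥0) (i k : Λ × ℕ) :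
    commWeight G h l i k ≤ 1 := by
  rw [commWeight]
  split_ifs
  exacts [min_le_left _ _, le_rfl]

/-- The total commutator of all terms centred at `k` with a term supported at distance at least `r`
from `k` is bounded by `f̃_t(r)`. -/
theorem sum_commWeight_le_fTilde (C₀ : ℝ≥0) (f h : ℝ≥0 → ℝ≥0) (t : ℝ) {l : ℝ≥0}
    (hl : (l : ℝ≥0∞) = lrFactor G C₀ f h t) (N : ℕ) (k : Λ) (i : Λ × ℕ) (r : ℝ≥0)
    (hr : ∀ y ∈ latBall G i.2 i.1, r ≤ (G.dist k y : ℝ≥0)) :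
    ∑ n ∈ Finset.Icc 1 N, (termBound C₀ f n : ℝ≥0∞) * commWeight G h l i (k, n) ≤
      fTilde G C₀ f h t r := by
  rw [fTilde]
  refine le_trans ?_ (mul_le_mul_right (le_iSup _ k) _)
  refine le_trans ?_ (mul_le_mul_right (Finset.sum_le_sum_of_subset
    (s := latBall G i.2 i.1) fun y hy => Finset.mem_filter.2 ⟨Finset.mem_univ _, hr y hy⟩) _)
  simp_rw [← ENNReal.tsum_add]
  rw [← Summable.tsum_finsetSum fun _ _ => ENNReal.summable, ← ENNReal.tsum_mul_left]
  refine le_trans (Finset.sum_le_sum fun n hn => ?_) (ENNReal.sum_le_tsum (Finset.Icc 1 N))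
  have hn1 : 1 ≤ n := (Finset.mem_Icc.1 hn).1
  have htb : (termBound C₀ f n : ℝ≥0∞) = 2 * C₀ * f ((n : ℝ≥0) - 1) := by
    rw [termBound]; push_cast; rfl
  rw [htb, mul_assoc]
  gcongr
  by_cases hall : ∀ y ∈ latBall G i.2 i.1, (n : ℝ≥0) ≤ (G.dist k y : ℝ≥0) / 2
  · have hdis : Disjoint (latBall G n k) (latBall G i.2 i.1) := by
      rw [Finset.disjoint_right]
      intro y hy hyk
      rw [mem_latBall, SimpleGraph.dist_comm] at hyk
      have h1 := hall y hy
      rw [le_div_iff₀ (by norm_num)] at h1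
      have h2 : n * 2 ≤ G.dist k y := by exact_mod_cast h1
      omega
    have h1 : (commWeight G h l i (k, n) : ℝ≥0∞) ≤ lrFactor G C₀ f h t *
        ∑ y ∈ latBall G i.2 i.1, ∑ x ∈ latBall G n k, (h (G.dist x y) : ℝ≥0∞) := by
      rw [commWeight, if_pos hdis, ← hl, Finset.sum_comm]
      refine (ENNReal.coe_le_coe.2 (min_le_right _ _)).trans (le_of_eq ?_)
      push_cast
      rfl
    refine (mul_le_mul_right h1 _).trans ?_
    rw [← mul_assoc, Finset.mul_sum]
    refine Finset.sum_le_sum fun y hy => ?_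
    rw [if_pos ⟨hn1, hall y hy⟩]
    exact le_self_add
  · push Not at hall
    obtain ⟨y, hy, hyn⟩ := hall
    refine le_trans ?_ (Finset.single_le_sum (fun _ _ => zero_le) hy)
    rw [if_pos hyn]
    refine le_trans ?_ le_add_self
    exact mul_le_of_le_one_right' (by exact_mod_cast commWeight_le_one h l i (k, n))

theorem sum_termBound_le_cTilde (C₀ : ℝ≥0) (f : ℝ≥0 → ℝ≥0) (N : ℕ) :
    ∑ n ∈ Finset.Icc 1 N, (termBound C₀ f n : ℝ≥0∞) ≤ cTilde C₀ f := by
  rw [cTilde, ← ENNReal.tsum_mul_left]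
  refine le_trans (Finset.sum_le_sum fun n hn => ?_) (ENNReal.sum_le_tsum (Finset.Icc 1 N))
  rw [if_pos (Finset.mem_Icc.1 hn).1, termBound]
  push_cast
  rfl

/-- The commutators of the terms centred at a site `k` with the terms whose ball contains `x`. -/
theorem sum_commutators_at_le (hG : IsLattice G D V) (C₀ : ℝ≥0) (f h : ℝ≥0 → ℝ≥0) (t : ℝ)
    {l : ℝ≥0} (hl : (l : ℝ≥0∞) = lrFactor G C₀ f h t) (N : ℕ) (x k : Λ) :
    ∑ i ∈ (Finset.univ : Finset Λ) ×ˢ Finset.Icc 1 N with x ∈ latBall G i.2 i.1,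
      ∑ n ∈ Finset.Icc 1 N,
        2 * (termBound C₀ f n : ℝ≥0∞) * termBound C₀ f i.2 * commWeight G h l i (k, n) ≤
    2 * cBdry D V C₀ f * fTilde G C₀ f h t ((G.dist x k : ℝ≥0) / 2) +
      2 * cTilde C₀ f * fBdry D V C₀ f ((G.dist x k : ℝ≥0) / 2) := by
  set r : ℝ≥0 := (G.dist x k : ℝ≥0) / 2 with hr
  have key : ∀ i ∈ ((Finset.univ : Finset Λ) ×ˢ Finset.Icc 1 N).filter
      (fun i => x ∈ latBall G i.2 i.1), ∑ n ∈ Finset.Icc 1 N,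
        2 * (termBound C₀ f n : ℝ≥0∞) * termBound C₀ f i.2 * commWeight G h l i (k, n) ≤
      termBound C₀ f i.2 * (2 * fTilde G C₀ f h t r) +
        (if r < (2 * i.2 : ℕ) then (termBound C₀ f i.2 : ℝ≥0∞) else 0) * (2 * cTilde C₀ f) := by
    intro i hi
    have hx := (Finset.mem_filter.1 hi).2
    split_ifs with hlt
    · refine le_trans ?_ le_add_self
      calc ∑ n ∈ Finset.Icc 1 N,
            2 * (termBound C₀ f n : ℝ≥0∞) * termBound C₀ f i.2 * commWeight G h l i (k, n)
          ≤ ∑ n ∈ Finset.Icc 1 N, termBound C₀ f i.2 * (2 * (termBound C₀ f n : ℝ≥0∞)) := by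
            refine Finset.sum_le_sum fun n _ => ?_
            rw [mul_comm (termBound C₀ f i.2 : ℝ≥0∞)]
            exact mul_le_of_le_one_right' (by exact_mod_cast commWeight_le_one h l i (k, n))
        _ ≤ _ := by
            rw [← Finset.mul_sum, ← Finset.mul_sum]
            gcongr
            exact sum_termBound_le_cTilde C₀ f N
    · refine le_trans ?_ le_self_add
      calc ∑ n ∈ Finset.Icc 1 N,
            2 * (termBound C₀ f n : ℝ≥0∞) * termBound C₀ f i.2 * commWeight G h l i (k, n)
          = termBound C₀ f i.2 * (2 * ∑ n ∈ Finset.Icc 1 N,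
              (termBound C₀ f n : ℝ≥0∞) * commWeight G h l i (k, n)) := by
            rw [Finset.mul_sum, Finset.mul_sum]
            exact Finset.sum_congr rfl fun n _ => by ring
        _ ≤ _ := by
            gcongr
            refine sum_commWeight_le_fTilde C₀ f h t hl N k i r fun y hy => ?_
            -- `y` is within `2 n ≤ dist(x,k)/2` of `x`, hence far from `k`
            rw [not_lt, hr, le_div_iff₀ (by norm_num)] at hlt
            have h1 : 2 * i.2 * 2 ≤ G.dist x k := by exact_mod_cast hlt
            rw [mem_latBall] at hx hy
            have h2 := hG.connected.dist_triangle (u := x) (v := i.1) (w := y)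
            have h3 := hG.connected.dist_triangle (u := x) (v := y) (w := k)
            rw [SimpleGraph.dist_comm (u := i.1) (v := y)] at h2
            rw [SimpleGraph.dist_comm (u := y) (v := k)] at h3
            rw [hr, div_le_iff₀ (by norm_num)]
            have : G.dist x k ≤ G.dist k y * 2 := by omega
            exact_mod_cast this
  refine (Finset.sum_le_sum key).trans ?_
  rw [Finset.sum_add_distrib, ← Finset.sum_mul, ← Finset.sum_mul]
  have h1 := sum_mem_latBall_le_cBdry hG C₀ f N x
  have h2 := sum_mem_latBall_le hG C₀ f N x fun n => r < n
  calc _ ≤ cBdry D V C₀ f * (2 * fTilde G C₀ f h t r) + fBdry D V C₀ f r * (2 * cTilde C₀ f) := by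
        gcongr
        exact h2
    _ = _ := by ring

/-- The sum over `d` in the definition of `F_t`. -/
def farSum (G : SimpleGraph Λ) (D : ℕ) (V C : ℝ≥0) (f h : ℝ≥0 → ℝ≥0) (t : ℝ) (r : ℝ≥0) : ℝ≥0∞ :=
  ∑' d : ℕ, if ⌊r⌋₊ ≤ d then
      ((V * (max (d : ℝ≥0) 1) ^ D : ℝ≥0) : ℝ≥0∞) *
        (2 * cBdry D V C f * fTilde G C f h t ((d : ℝ≥0) / 2)
          + 2 * cTilde C f * fBdry D V C f ((d : ℝ≥0) / 2)
          + 6 * fTilde G C f h t ((d : ℝ≥0) / 2) * fBdry D V C f ((d : ℝ≥0) / 2))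
    else 0

/-- A term inside `B` but not inside the collar of `A`, centred close to a site adjacent to `A`,
has a large ball. -/
theorem lt_of_not_subset_collar (hG : G.Connected) {w n : ℕ} {x k : Λ}
    (h1 : latBall G n k ⊆ B) (h2 : ¬ latBall G n k ⊆ collar G A B w)
    (hx : ∃ a ∈ A, G.dist x a ≤ 1) (hd : 6 * G.dist x k < w) : w < 6 * n := by
  obtain ⟨a, ha, hxa⟩ := hx
  obtain ⟨y, hy, hyc⟩ := Finset.not_subset.1 h2
  have h3 := le_dist_of_notMem_collar (h1 hy) hyc ha
  rw [mem_latBall] at hy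
  have h4 := hG.dist_triangle (u := y) (v := k) (w := a)
  have h5 := hG.dist_triangle (u := k) (v := x) (w := a)
  rw [SimpleGraph.dist_comm (u := k) (v := x)] at h5
  omega

/-- All commutators involving the terms whose ball contains a given site `x` adjacent to `A` or
`C`. -/
theorem sum_commutators_boundary_le (hG : IsLattice G D V) (C₀ : ℝ≥0) (f h : ℝ≥0 → ℝ≥0) (t : ℝ)
    {l : ℝ≥0} (hl : (l : ℝ≥0∞) = lrFactor G C₀ f h t) (N w : ℕ) {x : Λ}
    (hx : (∃ a ∈ A, G.dist x a ≤ 1) ∨ (∃ a ∈ C, G.dist x a ≤ 1)) :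
    ∑ i ∈ (Finset.univ : Finset Λ) ×ˢ Finset.Icc 1 N with x ∈ latBall G i.2 i.1,
      ∑ k ∈ (Finset.univ : Finset Λ) ×ˢ Finset.Icc 1 N with latBall G k.2 k.1 ⊆ B ∧
          ¬ latBall G k.2 k.1 ⊆ collar G A B w ∧ ¬ latBall G k.2 k.1 ⊆ collar G C B w,
        2 * (termBound C₀ f k.2 : ℝ≥0∞) * termBound C₀ f i.2 * commWeight G h l i k ≤
    farSum G D V C₀ f h t ((w : ℝ≥0) / 6) +
      2 * cBdry D V C₀ f * fDelta D V C₀ f ((w : ℝ≥0) / 6) := by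
  set I := (Finset.univ : Finset Λ) ×ˢ Finset.Icc 1 N with hI
  set J := I.filter fun k => latBall G k.2 k.1 ⊆ B ∧
          ¬ latBall G k.2 k.1 ⊆ collar G A B w ∧ ¬ latBall G k.2 k.1 ⊆ collar G C B w with hJ
  set r : ℝ≥0 := (w : ℝ≥0) / 6 with hr
  simp_rw [← Finset.sum_filter_add_sum_filter_not J fun k => ⌊r⌋₊ ≤ G.dist x k.1]
  rw [Finset.sum_add_distrib]
  refine add_le_add ?_ ?_
  · -- terms centred far from `x`
    calc ∑ i ∈ I with x ∈ latBall G i.2 i.1, ∑ k ∈ J with ⌊r⌋₊ ≤ G.dist x k.1,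
          2 * (termBound C₀ f k.2 : ℝ≥0∞) * termBound C₀ f i.2 * commWeight G h l i k
        ≤ ∑ i ∈ I with x ∈ latBall G i.2 i.1,
          ∑ k ∈ (Finset.univ.filter fun k => ⌊r⌋₊ ≤ G.dist x k) ×ˢ Finset.Icc 1 N,
          2 * (termBound C₀ f k.2 : ℝ≥0∞) * termBound C₀ f i.2 * commWeight G h l i k := by
          refine Finset.sum_le_sum fun i _ => Finset.sum_le_sum_of_subset fun k hk => ?_
          obtain ⟨hk1, hk2⟩ := Finset.mem_filter.1 hk
          have := (Finset.mem_filter.1 hk1).1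
          rw [Finset.mem_product] at this ⊢
          exact ⟨Finset.mem_filter.2 ⟨Finset.mem_univ _, hk2⟩, this.2⟩
      _ = ∑ k with ⌊r⌋₊ ≤ G.dist x k, ∑ i ∈ I with x ∈ latBall G i.2 i.1, ∑ n ∈ Finset.Icc 1 N,
          2 * (termBound C₀ f n : ℝ≥0∞) * termBound C₀ f i.2 * commWeight G h l i (k, n) := by
          rw [Finset.sum_comm (s := Finset.univ.filter _)]
          exact Finset.sum_congr rfl fun i _ => Finset.sum_product _ _ _
      _ ≤ ∑ k with ⌊r⌋₊ ≤ G.dist x k,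
          (2 * cBdry D V C₀ f * fTilde G C₀ f h t ((G.dist x k : ℝ≥0) / 2) +
            2 * cTilde C₀ f * fBdry D V C₀ f ((G.dist x k : ℝ≥0) / 2)) :=
          Finset.sum_le_sum fun k _ => sum_commutators_at_le hG C₀ f h t hl N x k
      _ ≤ _ := hG.sum_dist_le x (fun d => ⌊r⌋₊ ≤ d) fun d =>
          2 * cBdry D V C₀ f * fTilde G C₀ f h t ((d : ℝ≥0) / 2) +
            2 * cTilde C₀ f * fBdry D V C₀ f ((d : ℝ≥0) / 2)
      _ ≤ farSum G D V C₀ f h t r := by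
          refine ENNReal.tsum_le_tsum fun d => ?_
          split_ifs
          · exact mul_le_mul_right le_self_add _
          · exact le_rfl
  · -- terms centred close to `x`, whose balls are large
    calc ∑ i ∈ I with x ∈ latBall G i.2 i.1, ∑ k ∈ J with ¬ ⌊r⌋₊ ≤ G.dist x k.1,
          2 * (termBound C₀ f k.2 : ℝ≥0∞) * termBound C₀ f i.2 * commWeight G h l i k
        ≤ ∑ i ∈ I with x ∈ latBall G i.2 i.1, ∑ k ∈ J with ¬ ⌊r⌋₊ ≤ G.dist x k.1,
          2 * (termBound C₀ f k.2 : ℝ≥0∞) * termBound C₀ f i.2 := by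
          refine Finset.sum_le_sum fun i _ => Finset.sum_le_sum fun k _ => ?_
          exact mul_le_of_le_one_right' (by exact_mod_cast commWeight_le_one h l i k)
      _ = 2 * (∑ i ∈ I with x ∈ latBall G i.2 i.1, (termBound C₀ f i.2 : ℝ≥0∞)) *
          ∑ k ∈ J with ¬ ⌊r⌋₊ ≤ G.dist x k.1, (termBound C₀ f k.2 : ℝ≥0∞) := by
          rw [mul_assoc, Finset.sum_mul_sum, Finset.mul_sum]
          refine Finset.sum_congr rfl fun i _ => ?_
          rw [Finset.mul_sum]
          exact Finset.sum_congr rfl fun k _ => by ring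
      _ ≤ 2 * cBdry D V C₀ f * fDelta D V C₀ f r := by
          gcongr
          · exact sum_mem_latBall_le_cBdry hG C₀ f N x
          have hsub : J.filter (fun k => ¬ ⌊r⌋₊ ≤ G.dist x k.1) ⊆
              I.filter fun k => r / 2 < k.2 ∧ G.dist x k.1 ≤ k.2 := by
            intro k hk
            obtain ⟨hk1, hk2⟩ := Finset.mem_filter.1 hk
            obtain ⟨hkI, hkB, hkA, hkC⟩ := Finset.mem_filter.1 hk1
            have h1 : (G.dist x k.1 : ℝ≥0) < r := Nat.lt_of_lt_floor (not_le.1 hk2)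
            have h2 : 6 * G.dist x k.1 < w := by
              rw [hr, lt_div_iff₀ (by norm_num)] at h1
              have : G.dist x k.1 * 6 < w := by exact_mod_cast h1
              omega
            have h3 : w < 6 * k.2 := by
              rcases hx with hx | hx
              · exact lt_of_not_subset_collar hG.connected hkB hkA hx h2
              · exact lt_of_not_subset_collar hG.connected hkB hkC hx h2
            refine Finset.mem_filter.2 ⟨hkI, ?_, by omega⟩
            rw [hr, div_lt_iff₀ (by norm_num), div_lt_iff₀ (by norm_num)]
            have : w < k.2 * 2 * 6 := by omega
            exact_mod_cast this
          refine (Finset.sum_le_sum_of_subset hsub).trans ?_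
          rw [Finset.sum_filter, hI, Finset.sum_product_right, fDelta]
          refine le_trans (Finset.sum_le_sum fun n hn => ?_)
            (ENNReal.sum_le_tsum (Finset.Icc 1 N))
          split_ifs with h
          · simp only [h, true_and]
            rw [← Finset.sum_filter, Finset.sum_const, nsmul_eq_mul]
            calc _ ≤ (V * (n : ℝ≥0∞) ^ D) * (termBound C₀ f n : ℝ≥0∞) := by
                  gcongr
                  exact hG.card_le' x (Finset.mem_Icc.1 hn).1
              _ = _ := by rw [termBound]; push_cast; ring
          · simp [h]

/-- The total commutator error. -/
theorem sum_commutators_le (hG : IsLattice G D V) (C₀ : ℝ≥0) (f h : ℝ≥0 → ℝ≥0) (t : ℝ)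
    {l : ℝ≥0} (hl : (l : ℝ≥0∞) = lrFactor G C₀ f h t) (N w : ℕ) :
    ∑ i ∈ (Finset.univ : Finset Λ) ×ˢ Finset.Icc 1 N with
        (latBall G i.2 i.1 ⊆ C ∪ collar G C B w ∨ latBall G i.2 i.1 ⊆ collar G A B w ∪ A) ∧
          ¬ latBall G i.2 i.1 ⊆ B ∧ ¬ latBall G i.2 i.1 ⊆ A ∧ ¬ latBall G i.2 i.1 ⊆ C,
      ∑ k ∈ (Finset.univ : Finset Λ) ×ˢ Finset.Icc 1 N with latBall G k.2 k.1 ⊆ B ∧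
          ¬ latBall G k.2 k.1 ⊆ collar G A B w ∧ ¬ latBall G k.2 k.1 ⊆ collar G C B w,
        2 * (termBound C₀ f k.2 : ℝ≥0∞) * termBound C₀ f i.2 * commWeight G h l i k ≤
    B.card * (farSum G D V C₀ f h t ((w : ℝ≥0) / 6) +
      2 * cBdry D V C₀ f * fDelta D V C₀ f ((w : ℝ≥0) / 6)) := by
  classical
  set I := (Finset.univ : Finset Λ) ×ˢ Finset.Icc 1 N with hI
  set g : Λ × ℕ → ℝ≥0∞ := fun i => ∑ k ∈ I with latBall G k.2 k.1 ⊆ B ∧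
          ¬ latBall G k.2 k.1 ⊆ collar G A B w ∧ ¬ latBall G k.2 k.1 ⊆ collar G C B w,
        2 * (termBound C₀ f k.2 : ℝ≥0∞) * termBound C₀ f i.2 * commWeight G h l i k with hg
  set E := B.filter fun x => (∃ a ∈ A, G.dist x a ≤ 1) ∨ (∃ a ∈ C, G.dist x a ≤ 1) with hE
  have hmem : ∀ i ∈ I, ((latBall G i.2 i.1 ⊆ C ∪ collar G C B w ∨
      latBall G i.2 i.1 ⊆ collar G A B w ∪ A) ∧ ¬ latBall G i.2 i.1 ⊆ B ∧
      ¬ latBall G i.2 i.1 ⊆ A ∧ ¬ latBall G i.2 i.1 ⊆ C) → ∃ x ∈ E, x ∈ latBall G i.2 i.1 := by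
    rintro i - ⟨hor, hB, hA, hC⟩
    rcases hor with h1 | h1
    · rw [Finset.union_comm] at h1
      obtain ⟨x, hx, hxi, hxa⟩ := exists_boundary_site hG.connected h1 hC
        (fun h' => hB (h'.trans (collar_subset _ _ _)))
      exact ⟨x, Finset.mem_filter.2 ⟨collar_subset _ _ _ hx, Or.inr hxa⟩, hxi⟩
    · obtain ⟨x, hx, hxi, hxa⟩ := exists_boundary_site hG.connected h1 hA
        (fun h' => hB (h'.trans (collar_subset _ _ _)))
      exact ⟨x, Finset.mem_filter.2 ⟨collar_subset _ _ _ hx, Or.inl hxa⟩, hxi⟩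
  calc _ ≤ ∑ i ∈ I, ∑ x ∈ E, if x ∈ latBall G i.2 i.1 then g i else 0 := by
        rw [Finset.sum_filter]
        refine Finset.sum_le_sum fun i hi => ?_
        split_ifs with h
        · obtain ⟨x, hx, hxi⟩ := hmem i hi h
          refine le_trans ?_ (Finset.single_le_sum (fun _ _ => zero_le) hx)
          rw [if_pos hxi]
        · exact zero_le
    _ = ∑ x ∈ E, ∑ i ∈ I with x ∈ latBall G i.2 i.1, g i := by
        rw [Finset.sum_comm]
        exact Finset.sum_congr rfl fun x _ => (Finset.sum_filter _ _).symm
    _ ≤ ∑ x ∈ E, (farSum G D V C₀ f h t ((w : ℝ≥0) / 6) +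
          2 * cBdry D V C₀ f * fDelta D V C₀ f ((w : ℝ≥0) / 6)) :=
        Finset.sum_le_sum fun x hx => sum_commutators_boundary_le hG C₀ f h t hl N w
          (Finset.mem_filter.1 hx).2
    _ ≤ _ := by
        rw [Finset.sum_const, nsmul_eq_mul]
        gcongr
        exact Finset.filter_subset _ _

end Counting

/-! ### Polynomial decay -/

section Decay

/-- `F` decays at least like `(1 + r)^{-k}`. -/
def HasDecay (k : ℕ) (F : ℝ≥0 → ℝ≥0∞) : Prop :=
  ∃ M : ℝ≥0, ∀ r : ℝ≥0, (1 + r : ℝ≥0∞) ^ k * F r ≤ M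

theorem HasDecay.mono {k : ℕ} {F F' : ℝ≥0 → ℝ≥0∞} (h : HasDecay k F) (hle : ∀ r, F' r ≤ F r) :
    HasDecay k F' := by
  obtain ⟨M, hM⟩ := h
  exact ⟨M, fun r => (mul_le_mul_right (hle r) _).trans (hM r)⟩

theorem HasDecay.add {k : ℕ} {F F' : ℝ≥0 → ℝ≥0∞} (h : HasDecay k F) (h' : HasDecay k F') :
    HasDecay k fun r => F r + F' r := by
  obtain ⟨M, hM⟩ := h
  obtain ⟨M', hM'⟩ := h'
  refine ⟨M + M', fun r => ?_⟩
  rw [mul_add, ENNReal.coe_add]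
  exact add_le_add (hM r) (hM' r)

theorem HasDecay.const_mul {k : ℕ} {F : ℝ≥0 → ℝ≥0∞} (h : HasDecay k F) {a : ℝ≥0∞} (ha : a ≠ ∞) :
    HasDecay k fun r => a * F r := by
  obtain ⟨M, hM⟩ := h
  lift a to ℝ≥0 using ha
  refine ⟨a * M, fun r => ?_⟩
  rw [mul_left_comm, ENNReal.coe_mul]
  exact mul_le_mul_right (hM r) _

theorem HasDecay.of_le {k l : ℕ} {F : ℝ≥0 → ℝ≥0∞} (h : HasDecay l F) (hkl : k ≤ l) :
    HasDecay k F := by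
  obtain ⟨M, hM⟩ := h
  refine ⟨M, fun r => le_trans ?_ (hM r)⟩
  gcongr
  exact le_self_add

theorem HasDecay.mul {k : ℕ} {F F' : ℝ≥0 → ℝ≥0∞} (h : HasDecay k F) (h' : HasDecay k F') :
    HasDecay k fun r => F r * F' r := by
  obtain ⟨M, hM⟩ := h
  obtain ⟨M', hM'⟩ := h'.of_le (Nat.zero_le k)
  refine ⟨M * M', fun r => ?_⟩
  rw [← mul_assoc, ENNReal.coe_mul]
  exact mul_le_mul' (hM r) (by simpa using hM' r)

theorem HasDecay.comp {k : ℕ} {F : ℝ≥0 → ℝ≥0∞} (h : HasDecay k F) {φ : ℝ≥0 → ℝ≥0} (c : ℝ≥0)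
    (hφ : ∀ r, 1 + r ≤ c * (1 + φ r)) : HasDecay k fun r => F (φ r) := by
  obtain ⟨M, hM⟩ := h
  refine ⟨c ^ k * M, fun r => ?_⟩
  have h1 : (1 + r : ℝ≥0∞) ≤ c * (1 + φ r) := by exact_mod_cast hφ r
  calc (1 + r : ℝ≥0∞) ^ k * F (φ r) ≤ (c * (1 + φ r)) ^ k * F (φ r) := by gcongr
    _ = c ^ k * ((1 + φ r) ^ k * F (φ r)) := by rw [mul_pow, mul_assoc]
    _ ≤ c ^ k * M := by gcongr; exact hM _
    _ = _ := by push_cast; rfl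

theorem HasDecay.poly_mul {k D : ℕ} {F : ℝ≥0 → ℝ≥0∞} (h : HasDecay (k + D) F)
    {P : ℝ≥0 → ℝ≥0} (c : ℝ≥0) (hP : ∀ r, P r ≤ c * (1 + r) ^ D) :
    HasDecay k fun r => P r * F r := by
  obtain ⟨M, hM⟩ := h
  refine ⟨c * M, fun r => ?_⟩
  have h1 : (P r : ℝ≥0∞) ≤ c * (1 + r) ^ D := by exact_mod_cast hP r
  calc (1 + r : ℝ≥0∞) ^ k * (P r * F r) ≤ (1 + r : ℝ≥0∞) ^ k * ((c * (1 + r) ^ D) * F r) := by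
        gcongr
    _ = c * ((1 + r) ^ (k + D) * F r) := by rw [pow_add]; ring
    _ ≤ c * M := by gcongr; exact hM r
    _ = _ := by push_cast; rfl

/-- Tail sums lose two powers of decay. -/
theorem HasDecay.tsum {k : ℕ} {F : ℝ≥0 → ℝ≥0∞} (h : HasDecay (k + 2) F)
    {q : ℝ≥0 → ℕ → Prop} [∀ r n, Decidable (q r n)] (c : ℝ≥0)
    (hq : ∀ r n, q r n → 1 + r ≤ c * (1 + n)) :
    HasDecay k fun r => ∑' n : ℕ, if q r n then F n else 0 := by
  obtain ⟨M, hM⟩ := h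
  have hs : Summable fun n : ℕ => ((1 + n : ℝ≥0) ^ 2)⁻¹ := by
    rw [← NNReal.summable_coe]
    refine ((summable_nat_add_iff 1).2 (Real.summable_nat_pow_inv.2 one_lt_two)).congr fun n => ?_
    push_cast
    rw [add_comm]
  have hs' : ∑' n : ℕ, ((((1 + n : ℝ≥0) ^ 2)⁻¹ : ℝ≥0) : ℝ≥0∞) ≠ ∞ :=
    ENNReal.tsum_coe_ne_top_iff_summable.2 hs
  refine ⟨c ^ k * M * (∑' n : ℕ, ((((1 + n : ℝ≥0) ^ 2)⁻¹ : ℝ≥0) : ℝ≥0∞)).toNNReal, fun r => ?_⟩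
  rw [ENNReal.coe_mul, ENNReal.coe_toNNReal hs', ← ENNReal.tsum_mul_left, ← ENNReal.tsum_mul_left]
  refine ENNReal.tsum_le_tsum fun n => ?_
  split_ifs with hn
  · have h1 : (1 + r : ℝ≥0∞) ≤ c * (1 + n) := by
      have : ((1 + r : ℝ≥0) : ℝ≥0∞) ≤ ((c * (1 + n) : ℝ≥0) : ℝ≥0∞) := by
        exact_mod_cast hq r n hn
      push_cast at this
      exact this
    have h0 : (1 + n : ℝ≥0∞) ^ 2 ≠ 0 := by positivity
    have ht : (1 + n : ℝ≥0∞) ^ 2 ≠ ∞ := by finiteness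
    have h2 : ((((1 + n : ℝ≥0) ^ 2)⁻¹ : ℝ≥0) : ℝ≥0∞) = ((1 + n : ℝ≥0∞) ^ 2)⁻¹ := by
      rw [ENNReal.coe_inv (by positivity)]
      push_cast
      rfl
    rw [h2, ← div_eq_mul_inv, ENNReal.le_div_iff_mul_le (Or.inl h0) (Or.inl ht)]
    have h3 := hM n
    rw [ENNReal.coe_natCast] at h3
    calc (1 + r : ℝ≥0∞) ^ k * F n * (1 + n) ^ 2 ≤ (c * (1 + n)) ^ k * F n * (1 + n) ^ 2 := by
          gcongr
      _ = c ^ k * ((1 + n) ^ (k + 2) * F n) := by rw [mul_pow, pow_add]; ring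
      _ ≤ c ^ k * M := by gcongr
      _ = _ := by push_cast; rfl
  · simp

theorem HasDecay.ne_top {k : ℕ} {F : ℝ≥0 → ℝ≥0∞} (h : HasDecay k F) (r : ℝ≥0) : F r ≠ ∞ := by
  obtain ⟨M, hM⟩ := h
  intro ht
  have := hM r
  rw [ht, ENNReal.mul_top (by positivity)] at this
  exact absurd this (by simp)

/-- The sum of a sequence with quadratic decay is finite. -/
theorem HasDecay.tsum_ne_top {F : ℝ≥0 → ℝ≥0∞} (h : HasDecay 2 F) (q : ℕ → Prop)
    [DecidablePred q] : ∑' n : ℕ, (if q n then F n else 0) ≠ ∞ := by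
  have h' : HasDecay 0 fun r => ∑' n : ℕ, if r ≤ (n : ℝ≥0) then F n else 0 :=
    HasDecay.tsum (k := 0) h (q := fun r n => r ≤ (n : ℝ≥0)) 1
      fun r n hrn => by rw [one_mul]; gcongr
  refine ne_top_of_le_ne_top (h'.ne_top 0) (ENNReal.tsum_le_tsum fun n => ?_)
  split_ifs <;> simp_all

/-- A family that for every `k` is bounded by a multiple of `(1 + r)^{-k}` is bounded by one
function of order `O(r^{-∞})`. -/
theorem exists_superpolynomialDecay {ι : Sort*} (F : ι → ℝ≥0 → ℝ≥0∞)
    (h : ∀ k : ℕ, ∃ M : ℝ≥0, ∀ i, ∀ r : ℝ≥0, (1 + r : ℝ≥0∞) ^ k * F i r ≤ M) :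
    ∃ g : ℝ≥0 → ℝ≥0, Asymptotics.SuperpolynomialDecay atTop id g ∧ ∀ i r, F i r ≤ g r := by
  choose M hM using h
  refine ⟨fun r => ⨅ k : ℕ, M k / (1 + r) ^ k, fun k => ?_, fun i r => ?_⟩
  · have h1 : Tendsto (fun r : ℝ≥0 => M (k + 1) / (1 + r)) atTop (nhds 0) := by
      have h2 : Tendsto (fun r : ℝ≥0 => 1 + r) atTop atTop :=
        tendsto_atTop_mono (fun r => le_add_self) tendsto_id
      simpa [div_eq_mul_inv] using (tendsto_inv_atTop_zero.comp h2).const_mul (M (k + 1))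
    refine tendsto_of_tendsto_of_tendsto_of_le_of_le tendsto_const_nhds h1
      (fun _ => zero_le) fun r => ?_
    calc r ^ k * (⨅ k : ℕ, M k / (1 + r) ^ k)
        ≤ (1 + r) ^ k * (M (k + 1) / (1 + r) ^ (k + 1)) := by
          gcongr
          · exact le_add_self
          · exact ciInf_le (OrderBot.bddBelow _) (k + 1)
      _ = M (k + 1) / (1 + r) := by
          have : (1 + r) ≠ 0 := by positivity
          field_simp
          ring
  · have hle : ∀ k, F i r ≤ ((M k / (1 + r) ^ k : ℝ≥0) : ℝ≥0∞) := fun k => by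
      rw [ENNReal.coe_div (by positivity)]
      rw [ENNReal.le_div_iff_mul_le (Or.inl (by push_cast; positivity)) (Or.inl (by finiteness)),
        mul_comm]
      push_cast
      exact hM k i r
    have hfin : F i r ≠ ∞ := ne_top_of_le_ne_top ENNReal.coe_ne_top (hle 0)
    lift F i r to ℝ≥0 using hfin with y
    exact_mod_cast le_ciInf fun k => ENNReal.coe_le_coe.1 (hle k)

/-! ### Decay of the error functions -/

variable {f : ℝ≥0 → ℝ≥0}

theorem IsMDP.le_one (hf : IsMDP f) (r : ℝ≥0) : f r ≤ 1 := hf.zero ▸ hf.antitone zero_le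

theorem IsMDP.hasDecay (hf : IsMDP f) (k : ℕ) : HasDecay k fun r => (f r : ℝ≥0∞) := by
  have h := (hf.decay k).eventually (gt_mem_nhds zero_lt_one)
  obtain ⟨R₀, hR₀⟩ := eventually_atTop.1 h
  set R := max R₀ 1
  refine ⟨(1 + R) ^ k + 2 ^ k, fun r => ?_⟩
  have : (1 + r) ^ k * f r ≤ (1 + R) ^ k + 2 ^ k := by
    rcases le_total r R with hr | hr
    · refine le_trans ?_ le_self_add
      calc (1 + r) ^ k * f r ≤ (1 + R) ^ k * 1 := by
            gcongr
            exact hf.le_one r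
        _ = _ := mul_one _
    · refine le_trans ?_ le_add_self
      have h1 : (1 : ℝ≥0) ≤ r := (le_max_right _ _).trans hr
      calc (1 + r) ^ k * f r ≤ (2 * r) ^ k * f r := by
            gcongr
            rw [two_mul]
            gcongr
        _ = 2 ^ k * (r ^ k * f r) := by rw [mul_pow, mul_assoc]
        _ ≤ 2 ^ k * 1 := by
            gcongr
            exact (hR₀ r ((le_max_left _ _).trans hr)).le
        _ = _ := mul_one _
  beta_reduce
  exact_mod_cast this

theorem IsMDP.hasDecay_rpow (hf : IsMDP f) {β : ℝ} (hβ : 0 < β) (k : ℕ) :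
    HasDecay k fun r => ((f r ^ β : ℝ≥0) : ℝ≥0∞) := by
  obtain ⟨q, hq⟩ := exists_nat_ge ((k : ℝ) / β)
  obtain ⟨M, hM⟩ := hf.hasDecay q
  beta_reduce at hM
  refine ⟨M ^ β, fun r => ?_⟩
  have h1 : (1 + r) ^ q * f r ≤ M := by exact_mod_cast hM r
  have h2 : (1 + r) ^ k ≤ ((1 + r) ^ q) ^ β := by
    rw [← NNReal.rpow_natCast, ← NNReal.rpow_natCast, ← NNReal.rpow_mul]
    refine NNReal.rpow_le_rpow_of_exponent_le le_self_add ?_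
    rwa [div_le_iff₀ hβ] at hq
  have h3 : (1 + r) ^ k * f r ^ β ≤ M ^ β :=
    calc (1 + r) ^ k * f r ^ β ≤ ((1 + r) ^ q) ^ β * f r ^ β := by gcongr
      _ = ((1 + r) ^ q * f r) ^ β := (NNReal.mul_rpow).symm
      _ ≤ M ^ β := NNReal.rpow_le_rpow h1 hβ.le
  beta_reduce
  exact_mod_cast h3

theorem one_add_le_two_mul_tsub (r : ℝ≥0) : 1 + r ≤ 2 * (1 + (r - 1)) := by
  have : r ≤ (r - 1) + 1 := le_tsub_add
  calc 1 + r ≤ 1 + (r - 1 + 1) := by gcongr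
    _ ≤ 2 * (1 + (r - 1)) := by
      rw [mul_add, two_mul (r - 1)]
      have : 1 + (r - 1 + 1) = 2 * 1 + (r - 1) := by ring
      rw [this]
      gcongr
      exact le_self_add

theorem one_add_le_two_mul_half (r : ℝ≥0) : 1 + r ≤ 2 * (1 + r / 2) := by
  rw [mul_add, mul_div_cancel₀ _ two_ne_zero]
  gcongr
  norm_num

theorem IsMDP.hasDecay_fDelta (hf : IsMDP f) (D : ℕ) (V C : ℝ≥0) (k : ℕ) :
    HasDecay k (fDelta D V C f) := by
  have h1 : HasDecay (k + 2) fun r =>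
      ((r ^ D * V * 2 * C : ℝ≥0) : ℝ≥0∞) * (f (r - 1) : ℝ≥0∞) :=
    ((hf.hasDecay (k + 2 + D)).comp 2 one_add_le_two_mul_tsub).poly_mul (V * 2 * C) fun r => by
      calc r ^ D * V * 2 * C = V * 2 * C * r ^ D := by ring
        _ ≤ _ := by gcongr; exact le_add_self
  refine (h1.tsum (q := fun r n => r / 2 < (n : ℝ≥0)) 2 fun r n h => ?_).mono fun r => ?_
  · refine (one_add_le_two_mul_half r).trans ?_
    gcongr
  · refine ENNReal.tsum_le_tsum fun n => ?_
    split_ifs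
    · rw [← ENNReal.coe_mul]
    · exact le_rfl

theorem IsMDP.hasDecay_bdry_term (hf : IsMDP f) (D : ℕ) (V C : ℝ≥0) (k : ℕ) :
    HasDecay k fun r => ((V * (r / 2) ^ D * 2 * C * f (r / 2 - 1) : ℝ≥0) : ℝ≥0∞) := by
  refine (((hf.hasDecay (k + D)).comp (φ := fun r => r / 2 - 1) 4 fun r => ?_).poly_mul
    (P := fun r => V * (r / 2) ^ D * 2 * C) (V * 2 * C) fun r => ?_).mono fun r => ?_
  · calc 1 + r ≤ 2 * (1 + r / 2) := one_add_le_two_mul_half r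
      _ ≤ 2 * (2 * (1 + (r / 2 - 1))) := by gcongr; exact one_add_le_two_mul_tsub _
      _ = _ := by ring
  · calc V * (r / 2) ^ D * 2 * C = V * 2 * C * (r / 2) ^ D := by ring
      _ ≤ _ := by
        gcongr
        exact (half_le_self zero_le).trans le_add_self
  · rw [← ENNReal.coe_mul]

theorem IsMDP.hasDecay_fBdry (hf : IsMDP f) (D : ℕ) (V C : ℝ≥0) (k : ℕ) :
    HasDecay k (fBdry D V C f) :=
  (hf.hasDecay_bdry_term D V C (k + 2)).tsum (q := fun r n => r < (n : ℝ≥0)) 1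
    fun r n h => by rw [one_mul]; gcongr

theorem IsMDP.cBdry_ne_top (hf : IsMDP f) (D : ℕ) (V C : ℝ≥0) : cBdry D V C f ≠ ∞ :=
  (hf.hasDecay_bdry_term D V C 2).tsum_ne_top fun n => 1 ≤ n

theorem IsMDP.tsum_ne_top (hf : IsMDP f) :
    ∑' n : ℕ, (if 1 ≤ n then (f ((n : ℝ≥0) - 1) : ℝ≥0∞) else 0) ≠ ∞ :=
  ((hf.hasDecay 2).comp 2 one_add_le_two_mul_tsub).tsum_ne_top fun n => 1 ≤ n

theorem IsMDP.cTilde_ne_top (hf : IsMDP f) (C : ℝ≥0) : cTilde C f ≠ ∞ :=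
  ENNReal.mul_ne_top (by finiteness) hf.tsum_ne_top

/-- A bound on `f̃_t` that depends on the lattice only through its dimension, its volume constant and
a bound `L` on the Lieb–Robinson factor. -/
def fTildeMajorant (D : ℕ) (V C : ℝ≥0) (f h : ℝ≥0 → ℝ≥0) (L r : ℝ≥0) : ℝ≥0∞ :=
  2 * C * ∑' d : ℕ, if r ≤ (d : ℝ≥0) then ((V * (max (d : ℝ≥0) 1) ^ D : ℝ≥0) : ℝ≥0∞) *
    ((L * ∑' m : ℕ, ((V * (m : ℝ≥0) ^ D * f ((m : ℝ≥0) - 1) : ℝ≥0) : ℝ≥0∞)) * h ((d : ℝ≥0) / 2) +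
      ∑' m : ℕ, if (d : ℝ≥0) / 2 < m then (f ((m : ℝ≥0) - 1) : ℝ≥0∞) else 0) else 0

theorem IsMDP.moment_ne_top (hf : IsMDP f) (D : ℕ) (V : ℝ≥0) :
    ∑' m : ℕ, ((V * (m : ℝ≥0) ^ D * f ((m : ℝ≥0) - 1) : ℝ≥0) : ℝ≥0∞) ≠ ∞ := by
  have h1 : HasDecay 2 fun r => ((V * r ^ D : ℝ≥0) : ℝ≥0∞) * (f (r - 1) : ℝ≥0∞) :=
    ((hf.hasDecay (2 + D)).comp 2 one_add_le_two_mul_tsub).poly_mul V fun r => by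
      gcongr; exact le_add_self
  simpa using h1.tsum_ne_top fun _ => True

theorem IsMDP.hasDecay_fTildeMajorant (hf : IsMDP f) (D : ℕ) (V C L : ℝ≥0) {h : ℝ≥0 → ℝ≥0} {k : ℕ}
    (hh : HasDecay (k + 2 + D) fun r => (h r : ℝ≥0∞)) :
    HasDecay k (fTildeMajorant D V C f h L) := by
  have h1 : HasDecay (k + 2 + D) fun r : ℝ≥0 =>
      (L * ∑' m : ℕ, ((V * (m : ℝ≥0) ^ D * f ((m : ℝ≥0) - 1) : ℝ≥0) : ℝ≥0∞)) * h (r / 2) +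
      ∑' m : ℕ, if r / 2 < m then (f ((m : ℝ≥0) - 1) : ℝ≥0∞) else 0 := by
    refine ((hh.comp 2 one_add_le_two_mul_half).const_mul
      (ENNReal.mul_ne_top ENNReal.coe_ne_top (hf.moment_ne_top D V))).add ?_
    refine ((hf.hasDecay (k + 2 + D + 2)).comp 2 one_add_le_two_mul_tsub).tsum
      (q := fun r n => r / 2 < (n : ℝ≥0)) 2 fun r n hrn => ?_
    refine (one_add_le_two_mul_half r).trans ?_
    gcongr
  have h2 := h1.poly_mul (P := fun r => V * (max r 1) ^ D) V fun r => by
    gcongr; exact max_le le_add_self le_self_add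
  exact (h2.tsum (q := fun r n => r ≤ (n : ℝ≥0)) 1
    fun r n hrn => by rw [one_mul]; gcongr).const_mul (by finiteness)

/-- The corresponding bound on `F_t`. -/
def bigFMajorant (D : ℕ) (V C : ℝ≥0) (f h : ℝ≥0 → ℝ≥0) (t : ℝ) (L r : ℝ≥0) : ℝ≥0∞ :=
  ‖t‖₊ * (∑' d : ℕ, if ⌊r⌋₊ ≤ d then
      ((V * (max (d : ℝ≥0) 1) ^ D : ℝ≥0) : ℝ≥0∞) *
        (2 * cBdry D V C f * fTildeMajorant D V C f h L ((d : ℝ≥0) / 2)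
          + 2 * cTilde C f * fBdry D V C f ((d : ℝ≥0) / 2)
          + 6 * fTildeMajorant D V C f h L ((d : ℝ≥0) / 2) * fBdry D V C f ((d : ℝ≥0) / 2))
    else 0)
  + 2 * ‖t‖₊ * cBdry D V C f * fDelta D V C f r

theorem IsMDP.hasDecay_bigFMajorant (hf : IsMDP f) (D : ℕ) (V C L : ℝ≥0) {h : ℝ≥0 → ℝ≥0}
    (t : ℝ) {k : ℕ} (hh : HasDecay (k + 2 + D + 2 + D) fun r => (h r : ℝ≥0∞)) :
    HasDecay k (bigFMajorant D V C f h t L) := by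
  have hT := (hf.hasDecay_fTildeMajorant D V C L hh).comp 2 one_add_le_two_mul_half
  have hB := (hf.hasDecay_fBdry D V C (k + 2 + D)).comp 2 one_add_le_two_mul_half
  have h1 := ((hT.const_mul (a := 2 * cBdry D V C f)
      (ENNReal.mul_ne_top (by finiteness) (hf.cBdry_ne_top D V C))).add
    (hB.const_mul (a := 2 * cTilde C f)
      (ENNReal.mul_ne_top (by finiteness) (hf.cTilde_ne_top C)))).add
    ((hT.const_mul (a := 6) (by finiteness)).mul hB)
  have h2 := h1.poly_mul (P := fun r => V * (max r 1) ^ D) V fun r => by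
    gcongr; exact max_le le_add_self le_self_add
  refine ((h2.tsum (q := fun r n => ⌊r⌋₊ ≤ n) 2 fun r n hrn => ?_).const_mul
    (a := ‖t‖₊) (by finiteness)).add ((hf.hasDecay_fDelta D V C k).const_mul ?_)
  · have h3 : r ≤ n + 1 := by
      refine (Nat.lt_floor_add_one r).le.trans ?_
      gcongr
    calc 1 + r ≤ 1 + (n + 1 : ℝ≥0) := by gcongr
      _ ≤ 1 + (n + 1 : ℝ≥0) + n := le_self_add
      _ = 2 * (1 + n) := by ring
  · exact ENNReal.mul_ne_top (by finiteness) (hf.cBdry_ne_top D V C)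

variable {Λ : Type*} [Fintype Λ] [LinearOrder Λ] {G : SimpleGraph Λ} {D : ℕ} {V : ℝ≥0}

theorem IsLattice.fTilde_le (hG : IsLattice G D V) (C : ℝ≥0) {h : ℝ≥0 → ℝ≥0} (hh : Antitone h)
    {t : ℝ} {L : ℝ≥0} (hL : lrFactor G C f h t ≤ L) (r : ℝ≥0) :
    fTilde G C f h t r ≤ fTildeMajorant D V C f h L r := by
  rw [fTilde, fTildeMajorant]
  refine mul_le_mul_right (iSup_le fun j => ?_) _
  refine le_trans (Finset.sum_le_sum fun k _ => ?_) (hG.sum_dist_le j (fun d => r ≤ (d : ℝ≥0))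
    fun d => (L * ∑' m : ℕ, ((V * (m : ℝ≥0) ^ D * f ((m : ℝ≥0) - 1) : ℝ≥0) : ℝ≥0∞)) *
      h ((d : ℝ≥0) / 2) + ∑' m : ℕ, if (d : ℝ≥0) / 2 < m then (f ((m : ℝ≥0) - 1) : ℝ≥0∞) else 0)
  refine add_le_add ?_ le_rfl
  rw [mul_assoc, ← ENNReal.tsum_mul_right, ← ENNReal.tsum_mul_left]
  refine ENNReal.tsum_le_tsum fun m => ?_
  split_ifs with hm
  · have hsum : ∑ x ∈ latBall G m j, (h (G.dist x k) : ℝ≥0∞) ≤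
        V * (m : ℝ≥0∞) ^ D * h ((G.dist j k : ℝ≥0) / 2) := by
      refine (Finset.sum_le_card_nsmul _ _ (h ((G.dist j k : ℝ≥0) / 2) : ℝ≥0∞)
        fun x hx => ?_).trans ?_
      · refine ENNReal.coe_le_coe.2 (hh ?_)
        have h1 := hm.2
        rw [le_div_iff₀ (by norm_num)] at h1
        have h2 : m * 2 ≤ G.dist j k := by exact_mod_cast h1
        rw [mem_latBall, SimpleGraph.dist_comm] at hx
        have h3 := hG.connected.dist_triangle (u := j) (v := x) (w := k)
        rw [div_le_iff₀ (by norm_num)]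
        have : G.dist j k ≤ G.dist x k * 2 := by omega
        exact_mod_cast this
      · rw [nsmul_eq_mul]
        gcongr
        exact hG.card_latBall_le j hm.1
    calc (f ((m : ℝ≥0) - 1) : ℝ≥0∞) * lrFactor G C f h t * ∑ x ∈ latBall G m j,
          (h (G.dist x k) : ℝ≥0∞)
        ≤ (f ((m : ℝ≥0) - 1) : ℝ≥0∞) * L * (V * (m : ℝ≥0∞) ^ D * h ((G.dist j k : ℝ≥0) / 2)) := by
          gcongr
      _ = _ := by push_cast; ring
  · exact zero_le

theorem IsLattice.bigF_le (hG : IsLattice G D V) (C : ℝ≥0) {h : ℝ≥0 → ℝ≥0} (hh : Antitone h)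
    {t : ℝ} {L : ℝ≥0} (hL : lrFactor G C f h t ≤ L) (r : ℝ≥0) :
    bigF G D V C f h t r ≤ bigFMajorant D V C f h t L r := by
  rw [bigF, bigFMajorant]
  gcongr with d
  have := hG.fTilde_le C hh hL ((d : ℝ≥0) / 2)
  split_ifs
  · gcongr
  · exact le_rfl

/-- The Lieb–Robinson velocity is bounded uniformly in the lattice, if `f(n-1) / h(d) ≤ v(n)` for
`d ≤ 2n - 2`, the largest distance within a ball of radius `n`. -/
theorem IsLattice.mConst_le (hG : IsLattice G D V) (C : ℝ≥0) {h : ℝ≥0 → ℝ≥0}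
    (hpos : ∀ r, 0 < h r) {v : ℕ → ℝ≥0}
    (hv : ∀ n d : ℕ, d + 2 ≤ 2 * n → f ((n : ℝ≥0) - 1) ≤ v n * h d) :
    mConst G C f h ≤ 2 * C * ∑' n : ℕ, ((V * (n : ℝ≥0) ^ D * v n : ℝ≥0) : ℝ≥0∞) := by
  refine iSup_le fun x => iSup_le fun y => ?_
  have hne : (h (G.dist x y) : ℝ≥0∞) ≠ 0 := by exact_mod_cast (hpos _).ne'
  rw [div_eq_mul_inv, mul_assoc, mul_assoc, mul_assoc]
  gcongr
  rw [← Summable.tsum_finsetSum fun _ _ => ENNReal.summable, ← ENNReal.tsum_mul_left]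
  refine ENNReal.tsum_le_tsum fun n => ?_
  by_cases hn : 1 ≤ n ∧ G.dist x y + 2 ≤ 2 * n
  · calc _ ≤ (h (G.dist x y) : ℝ≥0∞)⁻¹ *
          ∑ j, if j ∈ latBall G n x then (f ((n : ℝ≥0) - 1) : ℝ≥0∞) else 0 := by
          gcongr with j
          split_ifs with h1 h2 h2
          · exact le_rfl
          · exact absurd (mem_latBall_comm.1 h1.1) h2
          · exact zero_le
          · exact le_rfl
      _ = (h (G.dist x y) : ℝ≥0∞)⁻¹ * ((latBall G n x).card * f ((n : ℝ≥0) - 1)) := by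
          rw [Finset.sum_ite_mem, Finset.univ_inter, Finset.sum_const, nsmul_eq_mul]
      _ ≤ (h (G.dist x y) : ℝ≥0∞)⁻¹ * ((V * (n : ℝ≥0∞) ^ D) * (v n * h (G.dist x y))) := by
          gcongr
          · exact hG.card_latBall_le x hn.1
          · exact_mod_cast hv n _ hn.2
      _ = ((h (G.dist x y) : ℝ≥0∞)⁻¹ * h (G.dist x y)) * (V * (n : ℝ≥0∞) ^ D * v n) := by ring
      _ = _ := by
          rw [ENNReal.inv_mul_cancel hne ENNReal.coe_ne_top, one_mul]
          push_cast
          rfl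
  · rw [Finset.sum_eq_zero, mul_zero]
    · exact zero_le
    · intro j _
      rw [if_neg]
      rintro ⟨h1, h2⟩
      rw [mem_latBall] at h1 h2
      have h3 := hG.connected.dist_triangle (u := x) (v := j) (w := y)
      rw [SimpleGraph.dist_comm (u := j) (v := y)] at h3
      omega

/-- The Lieb–Robinson factor is bounded in terms of bounds on the velocity and the reproducing
constant; note that `C_h ≥ h(0)`. -/
theorem IsLattice.lrFactor_le (hG : IsLattice G D V) (C : ℝ≥0) {h : ℝ≥0 → ℝ≥0}
    (hpos : ∀ r, 0 < h r) {M K : ℝ≥0} (hM : mConst G C f h ≤ M) (hK : cRep G h ≤ K) (t : ℝ) :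
    lrFactor G C f h t ≤ ((Real.exp (2 * M * K * ‖t‖₊)).toNNReal / h 0 : ℝ≥0) := by
  have hne : (h 0 : ℝ≥0∞) ≠ 0 := by exact_mod_cast (hpos 0).ne'
  have h1 : (h 0 : ℝ≥0∞) ≤ cRep G h := by
    obtain ⟨x⟩ := hG.connected.nonempty
    refine le_trans ?_ (le_iSup₂ (f := fun x y => ∑ z : Λ, (h (G.dist x z) : ℝ≥0∞) *
      h (G.dist z y) / h (G.dist x y)) x x)
    refine le_trans ?_ (Finset.single_le_sum (fun _ _ => zero_le) (Finset.mem_univ x))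
    simp only [SimpleGraph.dist_self, Nat.cast_zero]
    rw [mul_div_assoc, ENNReal.div_self hne ENNReal.coe_ne_top, mul_one]
  rw [lrFactor, ENNReal.coe_div (hpos 0).ne']
  refine ENNReal.div_le_div (tsub_le_self.trans ?_) h1
  have h2 : (2 * mConst G C f h * cRep G h * (‖t‖₊ : ℝ≥0∞) : ℝ≥0∞) ≤
      ((2 * M * K * ‖t‖₊ : ℝ≥0) : ℝ≥0∞) := by
    push_cast
    gcongr
  refine (EReal.exp_monotone (EReal.coe_ennreal_le_coe_ennreal_iff.2 h2)).trans (le_of_eq ?_)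
  have h3 : (((2 * M * K * ‖t‖₊ : ℝ≥0) : ℝ≥0∞) : EReal) =
      (((2 * M * K * ‖t‖₊ : ℝ≥0) : ℝ) : EReal) := rfl
  rw [h3, EReal.exp_coe, ENNReal.ofReal]
  push_cast
  rfl

end Decay

/-! ### The local decomposition of the Hamiltonian -/

section Decomposition

set_option linter.unusedSectionVars false

variable {Λ : Type*} [Fintype Λ] [LinearOrder Λ] {G : SimpleGraph Λ}
variable {κ : Λ → Type*} [∀ j, Fintype (κ j)] [∀ j, DecidableEq (κ j)] {p : ∀ j, κ j → ℤˣ}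
variable {f : ℝ≥0 → ℝ≥0} {C : ℝ≥0} {H : Λ → ℝ → Op κ} {a : ℕ → Λ → ℝ → Op κ}

variable (G) in
/-- The smallest radius for which all balls are the whole lattice. -/
def coverRadius : ℕ := (Finset.univ.sup fun x : Λ => Finset.univ.sup fun y : Λ => G.dist x y) + 1

theorem latBall_coverRadius {n : ℕ} (hn : coverRadius G ≤ n) (j : Λ) :
    latBall G n j = Finset.univ := by
  refine Finset.eq_univ_of_forall fun k => mem_latBall.2 ?_
  refine lt_of_lt_of_le ?_ hn
  rw [coverRadius, Nat.lt_succ_iff]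
  exact (Finset.le_sup (f := fun y => G.dist k y) (Finset.mem_univ j)).trans
    (Finset.le_sup (f := fun x => Finset.univ.sup fun y : Λ => G.dist x y) (Finset.mem_univ k))

variable (G) in
/-- The part of `H_j` on the ball of radius `n`: the increment of the approximants, with everything
beyond the last ball collected in the term of radius `coverRadius G`. -/
def localTerm (H : Λ → ℝ → Op κ) (a : ℕ → Λ → ℝ → Op κ) (i : Λ × ℕ) (t : ℝ) : Op κ :=
  (if i.2 = coverRadius G then H i.1 t else a i.2 i.1 t) - a (i.2 - 1) i.1 t

theorem IsLocalApproximation.norm_sub_le' (ha : IsLocalApproximation G p f H a)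
    (hH : IsLocalHamiltonian G p f C H) (hf : IsMDP f) (n : ℕ) (j : Λ) (t : ℝ) :
    ‖H j t - a n j t‖ ≤ C * f n := by
  rcases Nat.eq_zero_or_pos n with rfl | hn
  · rw [ha.zero, sub_zero, Nat.cast_zero, hf.zero, NNReal.coe_one, mul_one]
    exact hH.norm_le j t
  · refine (ha.norm_sub_le n j t hn).trans ?_
    gcongr
    exact hH.norm_le j t

theorem norm_localTerm_le (hf : IsMDP f) (hH : IsLocalHamiltonian G p f C H)
    (ha : IsLocalApproximation G p f H a) (i : Λ × ℕ) (t : ℝ) :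
    ‖localTerm G H a i t‖ ≤ termBound C f i.2 := by
  have e : ((i.2 - 1 : ℕ) : ℝ≥0) = (i.2 : ℝ≥0) - 1 := by
    rw [Nat.cast_tsub, Nat.cast_one]
  have h1 := ha.norm_sub_le' hH hf (i.2 - 1) i.1 t
  rw [e] at h1
  rw [localTerm, termBound]
  push_cast
  split_ifs
  · refine h1.trans ?_
    have : (0 : ℝ) ≤ C * f ((i.2 : ℝ≥0) - 1) := by positivity
    linarith
  · have h2 := ha.norm_sub_le' hH hf i.2 i.1 t
    have h3 : (f i.2 : ℝ) ≤ f ((i.2 : ℝ≥0) - 1) := NNReal.coe_le_coe.2 (hf.antitone tsub_le_self)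
    have h4 : (C : ℝ) * f i.2 ≤ C * f ((i.2 : ℝ≥0) - 1) := by gcongr
    calc ‖a i.2 i.1 t - a (i.2 - 1) i.1 t‖
        = ‖(H i.1 t - a (i.2 - 1) i.1 t) - (H i.1 t - a i.2 i.1 t)‖ := by congr 1; abel
      _ ≤ _ := norm_sub_le _ _
      _ ≤ _ := by linarith

theorem continuous_localTerm (hH : IsLocalHamiltonian G p f C H)
    (ha : IsLocalApproximation G p f H a) (i : Λ × ℕ) : Continuous (localTerm G H a i) := by
  unfold localTerm
  split_ifs
  · exact (hH.continuous _).sub (ha.continuous _ _)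
  · exact (ha.continuous _ _).sub (ha.continuous _ _)

theorem isSelfAdjoint_localTerm (hH : IsLocalHamiltonian G p f C H)
    (ha : IsLocalApproximation G p f H a) (i : Λ × ℕ) (t : ℝ) :
    IsSelfAdjoint (localTerm G H a i t) := by
  have h1 : IsSelfAdjoint (H i.1 t) := hH.isHermitian _ _
  have h2 : ∀ n, IsSelfAdjoint (a n i.1 t) := fun n => ha.isHermitian _ _ _
  unfold localTerm
  split_ifs
  · exact h1.sub (h2 _)
  · exact (h2 _).sub (h2 _)

theorem approximant_mem (ha : IsLocalApproximation G p f H a) {m n : ℕ} (hmn : m ≤ n) (j : Λ)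
    (t : ℝ) : a m j t ∈ localAlgebra p (latBall G n j) := by
  rcases Nat.eq_zero_or_pos m with rfl | hm
  · rw [ha.zero]; exact zero_mem _
  · refine localAlgebra_mono (fun k hk => ?_) (ha.mem m j t hm)
    rw [mem_latBall] at hk ⊢
    omega

theorem tendsto_approximant (hf : IsMDP f) (hH : IsLocalHamiltonian G p f C H)
    (ha : IsLocalApproximation G p f H a) (j : Λ) (t : ℝ) :
    Tendsto (fun n => a n j t) atTop (nhds (H j t)) := by
  have h1 : Tendsto f atTop (nhds 0) := by simpa using hf.decay 0
  have h2 : Tendsto (fun n : ℕ => (C * f n : ℝ)) atTop (nhds 0) := by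
    have := (h1.comp tendsto_natCast_atTop_atTop).const_mul C
    rw [mul_zero] at this
    have h3 := (NNReal.continuous_coe.tendsto _).comp this
    simpa [Function.comp_def] using h3
  rw [tendsto_iff_norm_sub_tendsto_zero]
  refine squeeze_zero (fun _ => norm_nonneg _) (fun n => ?_) h2
  rw [norm_sub_rev]
  exact ha.norm_sub_le' hH hf n j t

theorem localTerm_mem (hf : IsMDP f) (hH : IsLocalHamiltonian G p f C H)
    (ha : IsLocalApproximation G p f H a) (i : Λ × ℕ) (t : ℝ) :
    localTerm G H a i t ∈ localAlgebra p (latBall G i.2 i.1) := by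
  unfold localTerm
  split_ifs with h
  · refine sub_mem ?_ (approximant_mem ha (Nat.sub_le _ _) _ _)
    refine (isClosed_localAlgebra (p := p) _).mem_of_tendsto
      (tendsto_approximant hf hH ha i.1 t) (Eventually.of_forall fun n => ?_)
    have := approximant_mem ha (le_max_left n i.2) i.1 t
    rwa [latBall_coverRadius (h ▸ le_max_right _ _), ← latBall_coverRadius h.ge i.1] at this
  · exact sub_mem (approximant_mem ha le_rfl _ _) (approximant_mem ha (Nat.sub_le _ _) _ _)

variable (G) in
/-- The index set of the local terms. -/
def termIndex : Finset (Λ × ℕ) := Finset.univ ×ˢ Finset.Icc 1 (coverRadius G)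

theorem one_le_of_mem_termIndex {i : Λ × ℕ} (hi : i ∈ termIndex G) : 1 ≤ i.2 :=
  (Finset.mem_Icc.1 (Finset.mem_product.1 hi).2).1

theorem sum_localTerm (ha : IsLocalApproximation G p f H a) (t : ℝ) :
    ∑ i ∈ termIndex G, localTerm G H a i t = ∑ j, H j t := by
  rw [termIndex, Finset.sum_product]
  refine Finset.sum_congr rfl fun j _ => ?_
  have hN : coverRadius G = (coverRadius G - 1) + 1 := rfl
  have key : ∀ m, m + 1 ≤ coverRadius G →
      ∑ n ∈ Finset.Icc 1 m, localTerm G H a (j, n) t = a m j t := by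
    intro m hm
    induction m with
    | zero => simp [ha.zero]
    | succ m ih =>
      rw [Finset.sum_Icc_succ_top (by omega), ih (by omega), localTerm, if_neg (by simp; omega)]
      simp
  rw [hN, Finset.sum_Icc_succ_top (by omega), key _ (by omega), localTerm, if_pos hN.symm]
  simp

theorem restrictH_eq_sum (R : Finset Λ) (hR : R ≠ Finset.univ) (t : ℝ) :
    restrictH G a R t =
      ∑ i ∈ termIndex G with latBall G i.2 i.1 ⊆ R, localTerm G H a i t := by
  rw [Finset.sum_filter, termIndex, Finset.sum_product, restrictH]
  refine Finset.sum_congr rfl fun j _ => ?_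
  have hno : ∀ n, coverRadius G ≤ n → ¬ latBall G n j ⊆ R := fun n hn hsub => by
    rw [latBall_coverRadius hn] at hsub
    exact hR (Finset.univ_subset_iff.1 hsub)
  rw [tsum_eq_sum (s := Finset.Icc 1 (coverRadius G))]
  · refine Finset.sum_congr rfl fun n hn => ?_
    have hn1 := (Finset.mem_Icc.1 hn).1
    by_cases h : latBall G n j ⊆ R
    · have hne : n ≠ coverRadius G := fun e => hno n e.ge h
      rw [if_pos ⟨hn1, h⟩, if_pos h, localTerm, if_neg hne]
    · rw [if_neg (fun h' => h h'.2), if_neg h]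
  · intro n hn
    rw [if_neg]
    rintro ⟨h1, h2⟩
    refine hno n ?_ h2
    by_contra hlt
    exact hn (Finset.mem_Icc.2 ⟨h1, by omega⟩)

/-! ### The constants of the Lieb–Robinson bound are finite -/

theorem iSup_iSup_ne_top {F : Λ → Λ → ℝ≥0∞} (hF : ∀ x y, F x y ≠ ∞) :
    (⨆ x, ⨆ y, F x y) ≠ ∞ := by
  refine ne_top_of_le_ne_top (ENNReal.sum_ne_top.2 fun x (_ : x ∈ Finset.univ) =>
    ENNReal.sum_ne_top.2 fun y (_ : y ∈ Finset.univ) => hF x y) ?_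
  refine iSup_le fun x => iSup_le fun y => ?_
  exact (Finset.single_le_sum (f := fun y => F x y) (fun _ _ => zero_le)
    (Finset.mem_univ y)).trans (Finset.single_le_sum (f := fun x => ∑ y, F x y)
      (fun _ _ => zero_le) (Finset.mem_univ x))

theorem mConst_ne_top (hf : IsMDP f) (C : ℝ≥0) {h : ℝ≥0 → ℝ≥0} (hpos : ∀ r, 0 < h r) :
    mConst G C f h ≠ ∞ := by
  have hfin : ∀ x y : Λ, 2 * (C : ℝ≥0∞) / h (G.dist x y) *
      ∑ j : Λ, ∑' n : ℕ, (if x ∈ latBall G n j ∧ y ∈ latBall G n j then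
        (f ((n : ℝ≥0) - 1) : ℝ≥0∞) else 0) ≠ ∞ := by
    intro x y
    refine ENNReal.mul_ne_top (ENNReal.div_ne_top (by finiteness)
      (by exact_mod_cast (hpos _).ne')) (ENNReal.sum_ne_top.2 fun j _ => ?_)
    refine ne_top_of_le_ne_top hf.tsum_ne_top (ENNReal.tsum_le_tsum fun n => ?_)
    split_ifs with h1 h2
    · exact le_rfl
    · have := mem_latBall.1 h1.1
      omega
    · exact zero_le
    · exact le_rfl
  exact iSup_iSup_ne_top hfin

theorem cRep_ne_top {h : ℝ≥0 → ℝ≥0} (hpos : ∀ r, 0 < h r) : cRep G h ≠ ∞ := by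
  have hfin : ∀ x y : Λ, ∑ z : Λ, (h (G.dist x z) : ℝ≥0∞) * h (G.dist z y) / h (G.dist x y) ≠ ∞ :=
    fun x y => ENNReal.sum_ne_top.2 fun z _ =>
      ENNReal.div_ne_top (by finiteness) (by exact_mod_cast (hpos _).ne')
  exact iSup_iSup_ne_top hfin

theorem cRep_pos [Nonempty Λ] {h : ℝ≥0 → ℝ≥0} (hpos : ∀ r, 0 < h r) : 0 < cRep G h := by
  obtain ⟨x⟩ := ‹Nonempty Λ›
  refine lt_of_lt_of_le ?_ (le_iSup₂ (f := fun x y => ∑ z : Λ, (h (G.dist x z) : ℝ≥0∞) *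
      h (G.dist z y) / h (G.dist x y)) x x)
  refine lt_of_lt_of_le ?_ (Finset.single_le_sum (fun _ _ => zero_le) (Finset.mem_univ x))
  refine ENNReal.div_pos (mul_ne_zero ?_ ?_) ENNReal.coe_ne_top <;>
  exact_mod_cast (hpos _).ne'

theorem sum_termBound_le_mConst (hf : IsMDP f) {h : ℝ≥0 → ℝ≥0} (hpos : ∀ r, 0 < h r) (x y : Λ) :
    ∑ i ∈ termIndex G with x ∈ latBall G i.2 i.1 ∧ y ∈ latBall G i.2 i.1,
      (termBound C f i.2 : ℝ) ≤ (mConst G C f h).toReal * h (G.dist x y) := by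
  have hne : (h (G.dist x y) : ℝ≥0∞) ≠ 0 := by exact_mod_cast (hpos _).ne'
  have key : ∑ i ∈ termIndex G with x ∈ latBall G i.2 i.1 ∧ y ∈ latBall G i.2 i.1,
      (termBound C f i.2 : ℝ≥0∞) ≤ mConst G C f h * h (G.dist x y) := by
    calc _ ≤ 2 * (C : ℝ≥0∞) * ∑ j : Λ, ∑' n : ℕ,
          (if x ∈ latBall G n j ∧ y ∈ latBall G n j then
            (f ((n : ℝ≥0) - 1) : ℝ≥0∞) else 0) := by
          rw [Finset.sum_filter, termIndex, Finset.sum_product, Finset.mul_sum]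
          refine Finset.sum_le_sum fun j _ => ?_
          rw [← ENNReal.tsum_mul_left]
          refine le_trans (Finset.sum_le_sum fun n _ => ?_) (ENNReal.sum_le_tsum _)
          split_ifs
          · rw [termBound]; push_cast; rfl
          · exact zero_le
      _ = 2 * (C : ℝ≥0∞) / h (G.dist x y) * (∑ j : Λ, ∑' n : ℕ,
          (if x ∈ latBall G n j ∧ y ∈ latBall G n j then
            (f ((n : ℝ≥0) - 1) : ℝ≥0∞) else 0)) * h (G.dist x y) := by
          rw [mul_right_comm (2 * (C : ℝ≥0∞) / h (G.dist x y)),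
            ENNReal.div_mul_cancel hne ENNReal.coe_ne_top]
      _ ≤ _ := by
          gcongr
          exact le_iSup₂ (f := fun x y => 2 * (C : ℝ≥0∞) / h (G.dist x y) * ∑ j : Λ, ∑' n : ℕ,
            (if x ∈ latBall G n j ∧ y ∈ latBall G n j then
              (f ((n : ℝ≥0) - 1) : ℝ≥0∞) else 0)) x y
  have h2 := ENNReal.toReal_mono (ENNReal.mul_ne_top (mConst_ne_top hf C hpos)
    ENNReal.coe_ne_top) key
  rw [ENNReal.toReal_mul, ENNReal.toReal_sum (fun _ _ => ENNReal.coe_ne_top)] at h2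
  exact h2

theorem sum_mul_le_cRep {h : ℝ≥0 → ℝ≥0} (hpos : ∀ r, 0 < h r) (x y : Λ) :
    ∑ z : Λ, (h (G.dist x z) : ℝ) * h (G.dist z y) ≤ (cRep G h).toReal * h (G.dist x y) := by
  have hne : (h (G.dist x y) : ℝ≥0∞) ≠ 0 := by exact_mod_cast (hpos _).ne'
  have key : ∑ z : Λ, (h (G.dist x z) : ℝ≥0∞) * h (G.dist z y) ≤ cRep G h * h (G.dist x y) := by
    rw [← ENNReal.div_le_iff_le_mul (Or.inl hne) (Or.inl ENNReal.coe_ne_top), div_eq_mul_inv,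
      Finset.sum_mul]
    exact le_iSup₂ (f := fun x y => ∑ z : Λ, (h (G.dist x z) : ℝ≥0∞) *
      h (G.dist z y) / h (G.dist x y)) x y
  have h2 := ENNReal.toReal_mono (ENNReal.mul_ne_top (cRep_ne_top hpos)
    ENNReal.coe_ne_top) key
  rw [ENNReal.toReal_mul, ENNReal.toReal_sum (fun _ _ => by finiteness)] at h2
  simpa only [ENNReal.toReal_mul, ENNReal.coe_toReal] using h2

theorem exists_coe_eq_lrFactor [Nonempty Λ] (hf : IsMDP f) {h : ℝ≥0 → ℝ≥0} (hpos : ∀ r, 0 < h r)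
    (t : ℝ) : ∃ l : ℝ≥0, (l : ℝ≥0∞) = lrFactor G C f h t ∧ (l : ℝ) =
      (Real.exp (2 * (mConst G C f h).toReal * (cRep G h).toReal * |t|) - 1) /
        (cRep G h).toReal := by
  rw [lrFactor]
  have hK0 := cRep_pos (G := G) hpos
  have hM := mConst_ne_top (G := G) hf C hpos
  have hK := cRep_ne_top (G := G) hpos
  generalize mConst G C f h = M at hM ⊢
  generalize cRep G h = K at hK hK0 ⊢
  lift M to ℝ≥0 using hM
  lift K to ℝ≥0 using hK
  have hK0' : 0 < K := by exact_mod_cast hK0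
  have h1 : (0 : ℝ) ≤ Real.exp (2 * M * K * |t|) - 1 := by
    have := Real.add_one_le_exp (2 * M * K * |t|)
    have : (0 : ℝ) ≤ 2 * M * K * |t| := by positivity
    linarith
  refine ⟨(Real.exp (2 * M * K * |t|) - 1).toNNReal / K, ?_, ?_⟩
  · rw [ENNReal.coe_div hK0'.ne']
    congr 1
    have h3 : ((2 * (M : ℝ≥0∞) * K * (‖t‖₊ : ℝ≥0∞) : ℝ≥0∞) : EReal) =
        ((2 * M * K * |t| : ℝ) : EReal) := by
      have : (2 * (M : ℝ≥0∞) * K * (‖t‖₊ : ℝ≥0∞) : ℝ≥0∞) = ((2 * M * K * ‖t‖₊ : ℝ≥0) : ℝ≥0∞) := by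
        push_cast; rfl
      rw [this]
      have h4 : (((2 * M * K * ‖t‖₊ : ℝ≥0) : ℝ≥0∞) : EReal) =
        (((2 * M * K * ‖t‖₊ : ℝ≥0) : ℝ) : EReal) := rfl
      rw [h4]
      push_cast
      rfl
    rw [h3, EReal.exp_coe, ← ENNReal.ofReal_one, ← ENNReal.ofReal_sub _ zero_le_one]
    rfl
  · rw [NNReal.coe_div, Real.coe_toNNReal _ h1]
    rfl

set_option maxHeartbeats 1000000 in
/-- **The gluing error**, for an arbitrary positive decay function `h` in the Lieb–Robinson
bound. -/
theorem enorm_evolution_sub_approxEvolution_le {D : ℕ} {V : ℝ≥0} (hf : IsMDP f)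
    {h : ℝ≥0 → ℝ≥0} (hpos : ∀ r, 0 < h r) (hG : IsLattice G D V)
    (hH : IsLocalHamiltonian G p f C H) (ha : IsLocalApproximation G p f H a)
    {RA RB RC : Finset Λ} (hP : IsShieldedPartition G RA RB RC) (t : ℝ) :
    ‖evolution (fun s => ∑ j, H j s) t - approxEvolution G a RA RB RC t‖ₑ ≤
      2 * (RB.card : ℝ≥0∞) * ‖t‖₊ * fDelta D V C f ((setDist G RA RC : ℝ≥0) / 3) +
      2 * (RB.card : ℝ≥0∞) ^ 2 * ‖t‖₊ * bigF G D V C f h t ((setDist G RA RC : ℝ≥0) / 6) := by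
  have : Nonempty Λ := hG.connected.nonempty
  set w := setDist G RA RC with hw
  set A' := collar G RA RB w with hA'
  set C' := collar G RC RB w with hC'
  obtain ⟨l, hl, hl'⟩ := exists_coe_eq_lrFactor (G := G) (C := C) hf hpos t
  have hnuniv : ∀ {R X : Finset Λ}, X.Nonempty → Disjoint X R → R ≠ Finset.univ := by
    rintro R X ⟨x, hx⟩ hd rfl
    exact Finset.disjoint_left.1 hd hx (Finset.mem_univ x)
  have hBu := hnuniv hP.nonempty_A hP.disjoint_AB
  have hA'u := hnuniv hP.nonempty_A (hP.disjoint_AB.mono_right (collar_subset (G := G) RA RB w))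
  have hC'u := hnuniv hP.nonempty_A (hP.disjoint_AB.mono_right (collar_subset (G := G) RC RB w))
  have hCu : RC ∪ C' ≠ Finset.univ := hnuniv hP.nonempty_A (Finset.disjoint_union_right.2
    ⟨hP.disjoint_AC, hP.disjoint_AB.mono_right (collar_subset (G := G) RC RB w)⟩)
  have hAu : A' ∪ RA ≠ Finset.univ := hnuniv hP.nonempty_C (Finset.disjoint_union_right.2
    ⟨(hP.disjoint_BC.mono_left (collar_subset (G := G) RA RB w)).symm, hP.disjoint_AC.symm⟩)
  -- the restricted Hamiltonian of a proper region as a finite sum of local terms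
  set HR : Finset Λ → ℝ → Op κ := fun R s =>
    ∑ i ∈ termIndex G with latBall G i.2 i.1 ⊆ R, localTerm G H a i s with hHR
  have hres : ∀ R, R ≠ Finset.univ → restrictH G a R = HR R := fun R hR =>
    funext fun s => restrictH_eq_sum (H := H) R hR s
  have happ : approxEvolution G a RA RB RC t = evolution (HR RB) t *
      star (evolution (fun s => HR A' s + HR C' s) t) *
      evolution (fun s => HR (RC ∪ C') s + HR (A' ∪ RA) s) t := by
    simp only [approxEvolution, ← hw, ← hA', ← hC']
    rw [hres _ hBu, hres _ hA'u, hres _ hC'u, hres _ hCu, hres _ hAu]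
  have hfull : (fun s => ∑ j, H j s) = fun s => ∑ i ∈ termIndex G, localTerm G H a i s :=
    funext fun s => (sum_localTerm ha s).symm
  have key := norm_evolution_sub_glued_le (I := termIndex G) (S := fun i => latBall G i.2 i.1)
    (Φ := localTerm G H a) (φ := fun i => (termBound C f i.2 : ℝ)) (𝒜 := localAlgebra p)
    (fun X Y hXY a ha b hb => commute_of_disjoint hXY ha hb)
    (fun i hi => latBall_nonempty (one_le_of_mem_termIndex hi) i.1)
    (fun i _ s => localTerm_mem hf hH ha i s) (fun i _ => continuous_localTerm hH ha i)
    (fun i _ s => isSelfAdjoint_localTerm hH ha i s) (fun i => NNReal.coe_nonneg _)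
    (fun i _ s => norm_localTerm_le hf hH ha i s)
    (h := fun x y => (h (G.dist x y) : ℝ)) (fun x y => NNReal.coe_nonneg _)
    ENNReal.toReal_nonneg (ENNReal.toReal_pos (cRep_pos (G := G) hpos).ne' (cRep_ne_top hpos))
    (sum_termBound_le_mConst hf hpos) (sum_mul_le_cRep hpos)
    hP.disjoint_AB hP.disjoint_BC hP.disjoint_AC (collar_subset (G := G) RA RB w)
    (collar_subset (G := G) RC RB w)
    (disjoint_collar hG.connected hP.nonempty_A hP.nonempty_C) (HR := HR) (fun R s => rfl)
    (ρ := fun i k => (commWeight G h l i k : ℝ)) (t := t)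
    (fun i k hik => by simp only [commWeight, if_neg hik, NNReal.coe_one])
    (fun i k hik => by
      simp only [commWeight, if_pos hik, ← hl']
      push_cast
      rfl)
  rw [hfull, happ]
  -- pass to extended nonnegative reals
  have key2 : ‖evolution (fun s => ∑ i ∈ termIndex G, localTerm G H a i s) t -
      evolution (HR RB) t * star (evolution (fun s => HR A' s + HR C' s) t) *
        evolution (fun s => HR (RC ∪ C') s + HR (A' ∪ RA) s) t‖ₑ ≤
      ‖t‖₊ * ((∑ i ∈ termIndex G with ¬ latBall G i.2 i.1 ⊆ RB ∧ ¬ latBall G i.2 i.1 ⊆ RC ∪ C' ∧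
          ¬ latBall G i.2 i.1 ⊆ A' ∪ RA, (termBound C f i.2 : ℝ≥0∞)) +
        ‖t‖₊ * ∑ i ∈ termIndex G with
          (latBall G i.2 i.1 ⊆ RC ∪ C' ∨ latBall G i.2 i.1 ⊆ A' ∪ RA) ∧
            ¬ latBall G i.2 i.1 ⊆ RB ∧ ¬ latBall G i.2 i.1 ⊆ RA ∧ ¬ latBall G i.2 i.1 ⊆ RC,
          ∑ k ∈ termIndex G with latBall G k.2 k.1 ⊆ RB ∧ ¬ latBall G k.2 k.1 ⊆ A' ∧
            ¬ latBall G k.2 k.1 ⊆ C',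
            2 * (termBound C f k.2 : ℝ≥0∞) * termBound C f i.2 * commWeight G h l i k) := by
    rw [enorm_eq_nnnorm]
    exact_mod_cast key
  refine key2.trans ?_
  have h1 := hP.sum_bad_le hG C f (coverRadius G)
  have h2 := sum_commutators_le (A := RA) (B := RB) (C := RC) hG C f h t hl (coverRadius G) w
  rw [← hw] at h1
  have hB1 : (RB.card : ℝ≥0∞) ≤ (RB.card : ℝ≥0∞) ^ 2 := by
    exact_mod_cast Nat.le_self_pow two_ne_zero _
  have htwo : ∀ x : ℝ≥0∞, x ≤ 2 * x := fun x => by rw [two_mul]; exact le_self_add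
  set Z := farSum G D V C f h t ((w : ℝ≥0) / 6) +
    2 * cBdry D V C f * fDelta D V C f ((w : ℝ≥0) / 6) with hZ
  have hbig : (‖t‖₊ : ℝ≥0∞) * Z = bigF G D V C f h t ((w : ℝ≥0) / 6) := by
    rw [hZ, bigF, farSum]
    ring
  calc _ ≤ (‖t‖₊ : ℝ≥0∞) * (RB.card * fDelta D V C f ((w : ℝ≥0) / 3) +
        ‖t‖₊ * (RB.card * Z)) := by
        gcongr
        · exact h1
        · exact h2
    _ = RB.card * ‖t‖₊ * fDelta D V C f ((w : ℝ≥0) / 3) +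
        RB.card * ‖t‖₊ * bigF G D V C f h t ((w : ℝ≥0) / 6) := by rw [← hbig]; ring
    _ ≤ _ := by
        gcongr
        · exact htwo _
        · exact hB1.trans (htwo _)

end Decomposition

/-! ### Two choices of the decay function -/

section Choices

variable {f : ℝ≥0 → ℝ≥0} {c : ℝ≥0} {α ν : ℝ}

theorem IsMDP.hFun_pos (hf : IsMDP f) (hc : 0 < c) (r : ℝ≥0) : 0 < hFun f c α ν r :=
  div_pos (mul_pos hc (NNReal.rpow_pos (hf.pos _)))
    (NNReal.rpow_pos (lt_of_lt_of_le one_pos (le_max_right _ _)))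

theorem IsMDP.antitone_hFun (hf : IsMDP f) (hα : 0 < α) (hν : 0 < ν) :
    Antitone (hFun f c α ν) := by
  intro r s hrs
  have h1 : f ((s - 1) / 2) ≤ f ((r - 1) / 2) := hf.antitone (by gcongr)
  have h2 : f ((s - 1) / 2) ^ α ≤ f ((r - 1) / 2) ^ α := NNReal.rpow_le_rpow h1 hα.le
  have h3 : (max r 1) ^ ν ≤ (max s 1) ^ ν :=
    NNReal.rpow_le_rpow (max_le_max hrs le_rfl) hν.le
  have h4 : 0 < (max r 1) ^ ν := NNReal.rpow_pos (lt_of_lt_of_le one_pos (le_max_right _ _))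
  unfold hFun
  gcongr

theorem IsMDP.hasDecay_hFun (hf : IsMDP f) (hα : 0 < α) (hν : 0 < ν) (k : ℕ) :
    HasDecay k fun r => (hFun f c α ν r : ℝ≥0∞) := by
  refine (((hf.hasDecay_rpow hα k).comp (φ := fun r => (r - 1) / 2) 4 fun r => ?_).const_mul
    (a := c) ENNReal.coe_ne_top).mono fun r => ?_
  · calc 1 + r ≤ 2 * (1 + (r - 1)) := one_add_le_two_mul_tsub r
      _ ≤ 2 * (2 * (1 + (r - 1) / 2)) := by gcongr; exact one_add_le_two_mul_half _
      _ = _ := by ring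
  · rw [← ENNReal.coe_mul]
    refine ENNReal.coe_le_coe.2 (div_le_self zero_le ?_)
    exact NNReal.one_le_rpow (le_max_right _ _) hν.le

/-- For `h = hFun` the factor `f(n-1)^α` of `f(n-1)` compensates the numerator of `h`. -/
theorem IsMDP.le_mul_hFun (hf : IsMDP f) (hc : 0 < c) (hα : 0 < α) (hν : 0 < ν)
    (n d : ℕ) (hd : d + 2 ≤ 2 * n) :
    f ((n : ℝ≥0) - 1) ≤
      (f ((n : ℝ≥0) - 1) ^ (1 - α) * (2 * n : ℝ≥0) ^ ν / c) * hFun f c α ν d := by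
  have h0 : f ((n : ℝ≥0) - 1) ≠ 0 := (hf.pos _).ne'
  have h1 : (((d : ℝ≥0) - 1) / 2) ≤ (n : ℝ≥0) - 1 := by
    have h2 : ((d : ℝ≥0) - 1) ≤ d := tsub_le_self
    refine le_tsub_of_add_le_right ?_
    have h3 : (d : ℝ≥0) + 2 ≤ 2 * n := by exact_mod_cast hd
    calc ((d : ℝ≥0) - 1) / 2 + 1 ≤ d / 2 + 1 := by gcongr
      _ = (d + 2) / 2 := by field_simp
      _ ≤ (2 * n) / 2 := by gcongr
      _ = n := by field_simp
  have h2 : f ((n : ℝ≥0) - 1) ^ α ≤ f (((d : ℝ≥0) - 1) / 2) ^ α :=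
    NNReal.rpow_le_rpow (hf.antitone h1) hα.le
  have hpos : 0 < (max (d : ℝ≥0) 1) ^ ν :=
    NNReal.rpow_pos (lt_of_lt_of_le one_pos (le_max_right _ _))
  have h3 : (max (d : ℝ≥0) 1) ^ ν ≤ (2 * n : ℝ≥0) ^ ν := by
    refine NNReal.rpow_le_rpow (max_le ?_ ?_) hν.le
    · have : d ≤ 2 * n := by omega
      exact_mod_cast this
    · have : 1 ≤ 2 * n := by omega
      exact_mod_cast this
  have h4 : f ((n : ℝ≥0) - 1) = f ((n : ℝ≥0) - 1) ^ (1 - α) * f ((n : ℝ≥0) - 1) ^ α := by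
    rw [← NNReal.rpow_add h0, sub_add_cancel, NNReal.rpow_one]
  calc f ((n : ℝ≥0) - 1) = f ((n : ℝ≥0) - 1) ^ (1 - α) * f ((n : ℝ≥0) - 1) ^ α := h4
    _ ≤ f ((n : ℝ≥0) - 1) ^ (1 - α) * f (((d : ℝ≥0) - 1) / 2) ^ α *
        ((2 * n : ℝ≥0) ^ ν / (max (d : ℝ≥0) 1) ^ ν) := by
      refine le_trans (mul_le_mul_right h2 _) (le_mul_of_one_le_right zero_le ?_)
      rwa [one_le_div hpos]
    _ = _ := by
      unfold hFun
      field_simp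

theorem IsMDP.tsum_hFun_ne_top (hf : IsMDP f) (c : ℝ≥0) (hα : α < 1) (hν : 0 < ν) (D : ℕ) (V : ℝ≥0) :
    ∑' n : ℕ, ((V * (n : ℝ≥0) ^ D * (f ((n : ℝ≥0) - 1) ^ (1 - α) * (2 * n : ℝ≥0) ^ ν / c) : ℝ≥0) :
      ℝ≥0∞) ≠ ∞ := by
  obtain ⟨q, hq⟩ := exists_nat_ge ν
  have h1 := ((hf.hasDecay_rpow (sub_pos.2 hα) (2 + (D + q))).comp 2
    one_add_le_two_mul_tsub).poly_mul (P := fun r => V * r ^ D * (2 * r) ^ ν / c)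
    (V * 2 ^ q / c) fun r => by
      have h2 : (2 * (1 + r)) ^ ν ≤ (2 * (1 + r)) ^ q := by
        rw [← NNReal.rpow_natCast]
        refine NNReal.rpow_le_rpow_of_exponent_le ?_ hq
        calc (1 : ℝ≥0) ≤ 2 * 1 := by norm_num
          _ ≤ 2 * (1 + r) := by gcongr; exact le_self_add
      have h3 : (2 * r) ^ ν ≤ (2 * (1 + r)) ^ ν :=
        NNReal.rpow_le_rpow (by gcongr; exact le_add_self) hν.le
      calc V * r ^ D * (2 * r) ^ ν / c
          ≤ V * (1 + r) ^ D * (2 * (1 + r)) ^ q / c := by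
            gcongr
            · exact le_add_self
            · exact h3.trans h2
        _ = _ := by rw [mul_pow, pow_add]; ring
  refine ne_top_of_le_ne_top (h1.tsum_ne_top fun _ => True) (ENNReal.tsum_le_tsum fun n => ?_)
  rw [if_pos trivial, ← ENNReal.coe_mul]
  exact ENNReal.coe_le_coe.2 (le_of_eq (by ring))

/-- The polynomially decaying function `(1 + r)^{-k}`. -/
def polyDecay (k : ℕ) (r : ℝ≥0) : ℝ≥0 := ((1 + r) ^ k)⁻¹

theorem polyDecay_pos (k : ℕ) (r : ℝ≥0) : 0 < polyDecay k r := by unfold polyDecay; positivity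

theorem antitone_polyDecay (k : ℕ) : Antitone (polyDecay k) := by
  intro r s hrs
  unfold polyDecay
  gcongr

theorem hasDecay_polyDecay (k : ℕ) : HasDecay k fun r => (polyDecay k r : ℝ≥0∞) := by
  refine ⟨1, fun r => le_of_eq ?_⟩
  have h : (1 + r) ^ k * polyDecay k r = 1 := mul_inv_cancel₀ (by positivity)
  beta_reduce
  exact_mod_cast h

theorem le_mul_polyDecay (f : ℝ≥0 → ℝ≥0) (k n d : ℕ) (hd : d + 2 ≤ 2 * n) :
    f ((n : ℝ≥0) - 1) ≤ (f ((n : ℝ≥0) - 1) * (2 * n : ℝ≥0) ^ k) * polyDecay k d := by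
  have h1 : (1 + d : ℝ≥0) ≤ 2 * n := by
    have : 1 + d ≤ 2 * n := by omega
    exact_mod_cast this
  rw [mul_assoc]
  refine le_mul_of_one_le_right zero_le ?_
  rw [polyDecay, ← div_eq_mul_inv, one_le_div (by positivity)]
  gcongr

theorem IsMDP.tsum_polyDecay_ne_top (hf : IsMDP f) (k D : ℕ) (V : ℝ≥0) :
    ∑' n : ℕ, ((V * (n : ℝ≥0) ^ D * (f ((n : ℝ≥0) - 1) * (2 * n : ℝ≥0) ^ k) : ℝ≥0) : ℝ≥0∞) ≠ ∞ := by
  have h1 := ((hf.hasDecay (2 + (D + k))).comp 2 one_add_le_two_mul_tsub).poly_mul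
    (P := fun r => V * r ^ D * (2 * r) ^ k) (V * 2 ^ k) fun r => by
      calc V * r ^ D * (2 * r) ^ k ≤ V * (1 + r) ^ D * (2 * (1 + r)) ^ k := by
            gcongr <;> exact le_add_self
        _ = _ := by rw [mul_pow, pow_add]; ring
  have h2 := h1.tsum_ne_top fun _ => True
  refine ne_top_of_le_ne_top h2 (ENNReal.tsum_le_tsum fun n => ?_)
  rw [if_pos trivial, ← ENNReal.coe_mul]
  exact ENNReal.coe_le_coe.2 (le_of_eq (by ring))

theorem polyDecay_mul_div_le (k : ℕ) {a b d : ℝ≥0} (h : d ≤ a + b) :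
    polyDecay k a * polyDecay k b / polyDecay k d ≤ 2 ^ k * (polyDecay k a + polyDecay k b) := by
  have key : (1 + d) ^ k ≤ 2 ^ k * ((1 + a) ^ k + (1 + b) ^ k) := by
    rcases le_total a b with hab | hab
    · calc (1 + d) ^ k ≤ (2 * (1 + b)) ^ k := by
            gcongr
            calc 1 + d ≤ 1 + (b + b) := by gcongr; exact h.trans (by gcongr)
              _ ≤ 1 + (b + b) + 1 := le_self_add
              _ = _ := by ring
        _ = 2 ^ k * (1 + b) ^ k := mul_pow _ _ _
        _ ≤ _ := by gcongr; exact le_add_self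
    · calc (1 + d) ^ k ≤ (2 * (1 + a)) ^ k := by
            gcongr
            calc 1 + d ≤ 1 + (a + a) := by gcongr; exact h.trans (by gcongr)
              _ ≤ 1 + (a + a) + 1 := le_self_add
              _ = _ := by ring
        _ = 2 ^ k * (1 + a) ^ k := mul_pow _ _ _
        _ ≤ _ := by gcongr; exact le_self_add
  unfold polyDecay
  have ha : (1 + a) ^ k ≠ 0 := by positivity
  have hb : (1 + b) ^ k ≠ 0 := by positivity
  calc ((1 + a) ^ k)⁻¹ * ((1 + b) ^ k)⁻¹ / ((1 + d) ^ k)⁻¹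
      = ((1 + a) ^ k)⁻¹ * ((1 + b) ^ k)⁻¹ * (1 + d) ^ k := by rw [div_inv_eq_mul]
    _ ≤ ((1 + a) ^ k)⁻¹ * ((1 + b) ^ k)⁻¹ * (2 ^ k * ((1 + a) ^ k + (1 + b) ^ k)) := by gcongr
    _ = _ := by field_simp; ring

/-- Polynomially decaying functions of sufficiently high order are reproducing, uniformly in the
lattice. -/
theorem exists_cRep_polyDecay_le (D : ℕ) (V : ℝ≥0) {k : ℕ} (hk : D + 2 ≤ k) :
    ∃ K : ℝ≥0, ∀ (Λ : Type*) [Fintype Λ] [LinearOrder Λ] (G : SimpleGraph Λ), IsLattice G D V →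
      cRep G (polyDecay k) ≤ K := by
  set S : ℝ≥0∞ := ∑' d : ℕ, ((V * (max (d : ℝ≥0) 1) ^ D : ℝ≥0) : ℝ≥0∞) * polyDecay k d with hS
  have hSfin : S ≠ ∞ := by
    have h1 := ((hasDecay_polyDecay k).of_le (k := 2 + D) (by omega)).poly_mul
      (P := fun r => V * (max r 1) ^ D) V fun r => by
        gcongr; exact max_le le_add_self le_self_add
    simpa [hS] using h1.tsum_ne_top fun _ => True
  refine ⟨2 ^ k * (S.toNNReal + S.toNNReal), fun Λ _ _ G hG => iSup_le fun x => iSup_le fun y => ?_⟩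
  have hsum : ∀ x, ∑ z : Λ, (polyDecay k (G.dist x z) : ℝ≥0∞) ≤ S := fun x => by
    have := hG.sum_dist_le x (fun _ => True) fun d => (polyDecay k d : ℝ≥0∞)
    simpa [hS] using this
  calc ∑ z : Λ, (polyDecay k (G.dist x z) : ℝ≥0∞) * polyDecay k (G.dist z y) /
        polyDecay k (G.dist x y)
      ≤ ∑ z : Λ, 2 ^ k * ((polyDecay k (G.dist x z) : ℝ≥0∞) + polyDecay k (G.dist y z)) := by
        refine Finset.sum_le_sum fun z _ => ?_
        have h1 : (G.dist x y : ℝ≥0) ≤ G.dist x z + G.dist z y := by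
          exact_mod_cast hG.connected.dist_triangle
        have h2 := polyDecay_mul_div_le k h1
        rw [← ENNReal.coe_mul, ← ENNReal.coe_div (polyDecay_pos _ _).ne',
          SimpleGraph.dist_comm (u := y)]
        exact_mod_cast h2
    _ = 2 ^ k * (∑ z : Λ, (polyDecay k (G.dist x z) : ℝ≥0∞) +
          ∑ z : Λ, (polyDecay k (G.dist y z) : ℝ≥0∞)) := by
        rw [← Finset.mul_sum, Finset.sum_add_distrib]
    _ ≤ 2 ^ k * (S + S) := by gcongr <;> exact hsum _
    _ = _ := by push_cast; rw [ENNReal.coe_toNNReal hSfin]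

/-- Uniform bound on `F_t` over all lattices on which `h` is reproducing with constant `K`. -/
theorem exists_bigF_le {D : ℕ} {V C : ℝ≥0} {h : ℝ≥0 → ℝ≥0} (hpos : ∀ r, 0 < h r)
    (hanti : Antitone h) {v : ℕ → ℝ≥0}
    (hv : ∀ n d : ℕ, d + 2 ≤ 2 * n → f ((n : ℝ≥0) - 1) ≤ v n * h d)
    (hvs : ∑' n : ℕ, ((V * (n : ℝ≥0) ^ D * v n : ℝ≥0) : ℝ≥0∞) ≠ ∞) (t : ℝ) (K : ℝ≥0) :
    ∃ L : ℝ≥0, ∀ (Λ : Type*) [Fintype Λ] [LinearOrder Λ] (G : SimpleGraph Λ), IsLattice G D V →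
      cRep G h ≤ K → ∀ r, bigF G D V C f h t r ≤ bigFMajorant D V C f h t L r := by
  obtain ⟨M, hM⟩ : ∃ M : ℝ≥0, 2 * C * ∑' n : ℕ, ((V * (n : ℝ≥0) ^ D * v n : ℝ≥0) : ℝ≥0∞) = M :=
    ⟨_, (ENNReal.coe_toNNReal (ENNReal.mul_ne_top (by finiteness) hvs)).symm⟩
  exact ⟨_, fun Λ _ _ G hG hK r => hG.bigF_le C hanti
    (hG.lrFactor_le C hpos ((hG.mConst_le C hpos hv).trans hM.le) hK t) r⟩

end Choices

end LGA

end

theorem mainTheorem3 (D : ℕ) (V C : ℝ≥0) (f : ℝ≥0 → ℝ≥0) (hf : LGA.IsMDP f) :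
    -- the explicit error bound
    (∀ (c : ℝ≥0) (α ν : ℝ), 0 < c → 0 < α → α < 1 → 1 < ν →
      ∀ (Λ : Type u) [Fintype Λ] [LinearOrder Λ] (G : SimpleGraph Λ), LGA.IsLattice G D V →
      ∀ (κ : Λ → Type v) [∀ j, Fintype (κ j)] [∀ j, DecidableEq (κ j)] (p : ∀ j, κ j → ℤˣ)
        (H : Λ → ℝ → LGA.Op κ), LGA.IsLocalHamiltonian G p f C H →
      ∀ a : ℕ → Λ → ℝ → LGA.Op κ, LGA.IsLocalApproximation G p f H a →
      ∀ RA RB RC : Finset Λ, LGA.IsShieldedPartition G RA RB RC →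
      ∀ (t : ℝ) (w : ℕ), w = LGA.setDist G RA RC →
        ‖LGA.evolution (fun s => ∑ j, H j s) t - LGA.approxEvolution G a RA RB RC t‖ₑ ≤
          2 * (RB.card : ℝ≥0∞) * ‖t‖₊ * LGA.fDelta D V C f ((w : ℝ≥0) / 3) +
          2 * (RB.card : ℝ≥0∞) ^ 2 * ‖t‖₊ *
            LGA.bigF G D V C f (LGA.hFun f c α ν) t ((w : ℝ≥0) / 6)) ∧
    -- superpolynomial decay of the two functions, uniformly in the system
    (∃ g : ℝ≥0 → ℝ≥0, Asymptotics.SuperpolynomialDecay atTop id g ∧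
      ∀ r, LGA.fDelta D V C f r ≤ g r) ∧
    (∀ (c : ℝ≥0) (α ν : ℝ), 0 < c → 0 < α → α < 1 → 1 < ν → ∀ (t : ℝ) (K : ℝ≥0),
      ∃ g : ℝ≥0 → ℝ≥0, Asymptotics.SuperpolynomialDecay atTop id g ∧
        ∀ (Λ : Type u) [Fintype Λ] [LinearOrder Λ] (G : SimpleGraph Λ), LGA.IsLattice G D V →
          LGA.cRep G (LGA.hFun f c α ν) ≤ K →
          ∀ r, LGA.bigF G D V C f (LGA.hFun f c α ν) t r ≤ g r) ∧
    -- the error is `O(poly(|B|) w(B)^{-∞})`, uniformly in the system, for every `f`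
    (∀ t : ℝ, ∃ g : ℝ≥0 → ℝ≥0, Asymptotics.SuperpolynomialDecay atTop id g ∧
      ∀ (Λ : Type u) [Fintype Λ] [LinearOrder Λ] (G : SimpleGraph Λ), LGA.IsLattice G D V →
      ∀ (κ : Λ → Type v) [∀ j, Fintype (κ j)] [∀ j, DecidableEq (κ j)] (p : ∀ j, κ j → ℤˣ)
        (H : Λ → ℝ → LGA.Op κ), LGA.IsLocalHamiltonian G p f C H →
      ∀ a : ℕ → Λ → ℝ → LGA.Op κ, LGA.IsLocalApproximation G p f H a →
      ∀ RA RB RC : Finset Λ, LGA.IsShieldedPartition G RA RB RC →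
      ∀ w : ℕ, w = LGA.setDist G RA RC →
        ‖LGA.evolution (fun s => ∑ j, H j s) t - LGA.approxEvolution G a RA RB RC t‖ ≤
          (RB.card : ℝ) ^ 2 * g w) := by
  refine ⟨?_, ?_, ?_, ?_⟩
  · rintro c α ν hc - - - Λ _ _ G hG κ _ _ p H hH a ha RA RB RC hP t w rfl
    exact LGA.enorm_evolution_sub_approxEvolution_le hf (hf.hFun_pos hc) hG hH ha hP t
  · obtain ⟨g, hg, hle⟩ := LGA.exists_superpolynomialDecay (fun _ : Unit => LGA.fDelta D V C f)
      fun k => (hf.hasDecay_fDelta D V C k).imp fun M hM _ => hM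
    exact ⟨g, hg, hle ()⟩
  · intro c α ν hc hα hα1 hν t K
    have hν0 : 0 < ν := one_pos.trans hν
    obtain ⟨L, hL⟩ := LGA.exists_bigF_le (C := C) (hf.hFun_pos hc) (hf.antitone_hFun hα hν0)
      (hf.le_mul_hFun hc hα hν0) (hf.tsum_hFun_ne_top c hα1 hν0 D V) t K
    obtain ⟨g, hg, hle⟩ := LGA.exists_superpolynomialDecay
      (fun _ : Unit => LGA.bigFMajorant D V C f (LGA.hFun f c α ν) t L)
      fun k => (hf.hasDecay_bigFMajorant D V C L t (hf.hasDecay_hFun hα hν0 _)).imp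
        fun M hM _ => hM
    exact ⟨g, hg, fun Λ _ _ G hG hK r => (hL Λ G hG hK r).trans (hle () r)⟩
  · intro t
    -- for each order of decay use the polynomial decay function `(1 + r)^{-m}` of a higher order
    set m : ℕ → ℕ := fun k => k + 2 + D + 2 + D with hm
    choose K hK using fun k => LGA.exists_cRep_polyDecay_le D V (k := m k) (by simp only [hm]; omega)
    choose L hL using fun k => LGA.exists_bigF_le (C := C) (LGA.polyDecay_pos (m k))
      (LGA.antitone_polyDecay (m k)) (LGA.le_mul_polyDecay f (m k))
      (hf.tsum_polyDecay_ne_top (m k) D V) t (K k)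
    set E : ℕ → ℝ≥0 → ℝ≥0∞ := fun k r => 2 * ‖t‖₊ * LGA.fDelta D V C f (r / 3) +
      2 * ‖t‖₊ * LGA.bigFMajorant D V C f (LGA.polyDecay (m k)) t (L k) (r / 6) with hE
    have hEd : ∀ k, LGA.HasDecay k (E k) := fun k => by
      refine (((hf.hasDecay_fDelta D V C k).comp 3 fun r => ?_).const_mul (by finiteness)).add
        (((hf.hasDecay_bigFMajorant D V C (L k) t (LGA.hasDecay_polyDecay _)).comp 6
          fun r => ?_).const_mul (by finiteness))
      · rw [mul_add, mul_div_cancel₀ _ (by norm_num)]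
        gcongr
        norm_num
      · rw [mul_add, mul_div_cancel₀ _ (by norm_num)]
        gcongr
        norm_num
    obtain ⟨g, hg, hle⟩ := LGA.exists_superpolynomialDecay (fun (_ : Unit) r => ⨅ k, E k r)
      fun k => (hEd k).imp fun M hM _ r => le_trans (mul_le_mul_right (iInf_le _ k) _) (hM r)
    refine ⟨g, hg, ?_⟩
    rintro Λ _ _ G hG κ _ _ p H hH a ha RA RB RC hP w rfl
    set w := LGA.setDist G RA RC with hw
    have hB : (RB.card : ℝ≥0∞) ≤ (RB.card : ℝ≥0∞) ^ 2 := by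
      exact_mod_cast Nat.le_self_pow two_ne_zero _
    have hEk : ∀ k, ‖LGA.evolution (fun s => ∑ j, H j s) t -
        LGA.approxEvolution G a RA RB RC t‖ₑ ≤ (RB.card : ℝ≥0∞) ^ 2 * E k w := fun k => by
      refine (LGA.enorm_evolution_sub_approxEvolution_le hf (LGA.polyDecay_pos (m k)) hG hH ha
        hP t).trans ?_
      rw [← hw]
      calc _ ≤ 2 * (RB.card : ℝ≥0∞) ^ 2 * ‖t‖₊ * LGA.fDelta D V C f ((w : ℝ≥0) / 3) +
            2 * (RB.card : ℝ≥0∞) ^ 2 * ‖t‖₊ *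
              LGA.bigFMajorant D V C f (LGA.polyDecay (m k)) t (L k) ((w : ℝ≥0) / 6) := by
            gcongr
            exact hL k Λ G hG (hK k Λ G hG) _
        _ = _ := by simp only [hE]; ring
    have hinf : ‖LGA.evolution (fun s => ∑ j, H j s) t -
        LGA.approxEvolution G a RA RB RC t‖ₑ ≤ (((RB.card : ℝ≥0) ^ 2 * g w : ℝ≥0) : ℝ≥0∞) := by
      rcases eq_or_ne ((RB.card : ℝ≥0∞) ^ 2) 0 with h0 | h0
      · have := hEk 0
        rw [h0, zero_mul] at this
        exact this.trans zero_le
      · calc _ ≤ ⨅ k, (RB.card : ℝ≥0∞) ^ 2 * E k w := le_iInf hEk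
          _ = (RB.card : ℝ≥0∞) ^ 2 * ⨅ k, E k w :=
              (ENNReal.mul_iInf_of_ne h0 (by finiteness)).symm
          _ ≤ (RB.card : ℝ≥0∞) ^ 2 * g w := by gcongr; exact hle () w
          _ = _ := by push_cast; rfl
    rw [enorm_eq_nnnorm, ENNReal.coe_le_coe] at hinf
    exact_mod_cast hinf
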